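/- **Setting.** Consider a chain Alice – $N_1$ – … – $N_n$ – Bob with $n$ nodes and $n+1$ segments $S_1,\dots,S_{n+1}$, each consisting of two qubits shared by neighbouring parties. For a two-qubit operator $X$ let $F(X)=\max_\phi\langle\phi|X|\phi\rangle$ over maximally entangled $\phi$. For a two-qubit state $\rho$ let $F^\star(\rho)=\sup_\Lambda F(\Lambda(\rho))$ over all LOCC maps $\Lambda$ between its two holders with two-qubit output. For given states of the segments let $F^\star_{AB}$ be the supremum of $F$ of the final two-qubit state of Alice and Bob over all LOCC protocols among Alice, all the nodes and Bob. A free segment shares a pure state $\psi(\alpha)$ with vector $\sqrt{\alpha}\,|u_0v_0\rangle+\sqrt{1-\alpha}\,|u_1v_1\rangle$, where $\alpha\in[1/2,1)$ and $(u_0,u_1)$, $(v_0,v_1)$ are arbitrary orthonormal qubit bases. The noisy segment shares $\rho(p,\delta)=p\,|u_0v_1\rangle\langle u_0v_1|+(1-p)\,|\zeta\rangle\langle\zeta|$ with $|\zeta\rangle=\sqrt{\delta}\,|u_0v_0\rangle+\sqrt{1-\delta}\,|u_1v_1\rangle$, $p\in[0,1]$, $\delta\in[1/2,1)$, again for arbitrary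 orthonormal bases. These bases are called the local bases of the segment. **Theorem.** (a) Let $n=2$, let $S_2$ share $\rho(p,\delta)$, and let $S_1$, $S_3$ share $\psi(\alpha'_l)$, $\psi(\alpha'_r)$ with $\alpha'_l,\alpha'_r\in[1/2,1)$. If $$\frac{\alpha'_l\alpha'_r}{(1-\alpha'_l)(1-\alpha'_r)}\le\frac{p^2}{\delta(1-\delta)(1-p)^2}\qquad(*)$$ (the right-hand side is $+\infty$ for $p=1$), then the Bell measurements at both nodes (in the Bell bases formed from the local bases of the two qubits at each node), with outcome probabilities $p_{ij}$ and post-measurement states $\rho_{ij}$ of Alice and Bob, satisfy $$\sum_{i,j}p_{ij}F^\star(\rho_{ij})=F^\star(\rho(p,\delta)),$$ and this is optimal: $F^\star_{AB}=F^\star(\rho(p,\delta))$, where the supremum defining $F^\star_{AB}$ is attained. (b) Let $n\ge2$, $2\le m\le n$, let $S_m$ share $\rho(p,\delta)$ and let every other segment $S_i$ share $\psi(\alpha_i)$, $\alpha_i\in[1/2,1)$. Put $\mathcal C_i=2\sqrt{\alpha_i(1-\alpha_i)}$, $\mathcal C_l=\prod_{i<m}\mathcal C_i$, $\mathcal C_r=\prod_{i>m}\mathcal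 C_i$, $\alpha'_l=\tfrac12\bigl(1+\sqrt{1-\mathcal C_l^2}\bigr)$ and $\alpha'_r=\tfrac12\bigl(1+\sqrt{1-\mathcal C_r^2}\bigr)$. Then $\alpha'_l,\alpha'_r\in[1/2,1)$, and LOCC converts the chain deterministically into the two-node chain with nodes $N_{m-1},N_m$ and segment states $\psi(\alpha'_l)$, $\rho(p,\delta)$, $\psi(\alpha'_r)$, where $\psi(\alpha'_l)$ and $\psi(\alpha'_r)$ have computational local bases and $\rho(p,\delta)$ is unchanged. If $(*)$ holds for these $\alpha'_l,\alpha'_r$, then the Bell measurements at both nodes of that two-node chain have average $\sum_{i,j}p_{ij}F^\star(\rho_{ij})=F^\star(\rho(p,\delta))$, and the original chain has $F^\star_{AB}=F^\star(\rho(p,\delta))$, with the supremum attained. -/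

import Mathlib

open scoped Matrix Kronecker BigOperators

namespace Repeater

noncomputable section

/-! ### Multipartite systems and LOCC -/

/-- Computational basis labels of a multipartite system whose party `j` holds a
`d j`-dimensional quantum system. -/
abbrev Idx {ι : Type} (d : ι → ℕ) : Type := ∀ j, Fin (d j)

/-- Operators on the multipartite Hilbert space `⨂ j, ℂ ^ (d j)`. -/
abbrev Op {ι : Type} (d : ι → ℕ) : Type := Matrix (Idx d) (Idx d) ℂ

/-- The product operator `⨂ j, K j`. -/
def tensorOp {ι : Type} [Fintype ι] {d d' : ι → ℕ}
    (K : ∀ j, Matrix (Fin (d' j)) (Fin (d j)) ℂ) : Matrix (Idx d') (Idx d) ℂ :=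
  Matrix.of fun y x => ∏ j, K j (y j) (x j)

/-- Finite-round LOCC maps between multipartite systems. Either nothing is done, or a party `i`
performs a local measurement with Kraus operators `K x i` (`∑ x, (K x i)ᴴ * K x i = 1`) and
broadcasts the outcome `x`, every other party `j` applies a local isometry `K x j`
(e.g. the identity), and then all parties go on with an LOCC map `Λ x` chosen according to `x`.
The classical record is summed over at the end; local dimensions may change on the way, so local
ancillas and the discarding of local systems are included. -/
inductive IsLOCC {ι : Type} [Fintype ι] [DecidableEq ι] {e : ι → ℕ} :
    {d : ι → ℕ} → (Op d → Op e) → Prop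
  | done : IsLOCC (d := e) (fun X => X)
  | step {d : ι → ℕ} (i : ι) {N : ℕ} {mid : Fin N → ι → ℕ}
      (K : ∀ (x : Fin N) (j : ι), Matrix (Fin (mid x j)) (Fin (d j)) ℂ)
      (h_meas : ∑ x, (K x i)ᴴ * K x i = 1)
      (h_isom : ∀ x, ∀ j, j ≠ i → (K x j)ᴴ * K x j = 1)
      (Λ : ∀ x : Fin N, Op (mid x) → Op e)
      (hΛ : ∀ x, IsLOCC (Λ x)) :
      IsLOCC (fun X : Op d => ∑ x, Λ x (tensorOp (K x) * X * (tensorOp (K x))ᴴ))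

/-! ### Repeater chains -/

/-- The parties of a repeater chain with `n` nodes: Alice, the nodes `0, …, n - 1`, and Bob. -/
inductive Party (n : ℕ) : Type
  | alice : Party n
  | node (k : Fin n) : Party n
  | bob : Party n
  deriving DecidableEq, Fintype

/-- Alice and Bob hold one qubit each, every node holds two. -/
def chainDims (n : ℕ) : Party n → ℕ
  | .alice => 2
  | .node _ => 2 * 2
  | .bob => 2

/-- After the protocol Alice and Bob hold one qubit each, the nodes have been discarded. -/
def endDims (n : ℕ) : Party n → ℕ
  | .alice => 2
  | .node _ => 1
  | .bob => 2

/-- A chain label from Alice's bit, the pairs of bits of the nodes, and Bob's bit. -/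
def mkIdx {n : ℕ} (a : Fin 2) (q : Fin n → Fin 2 × Fin 2) (b : Fin 2) : Idx (chainDims n)
  | .alice => a
  | .node k => (finProdFinEquiv (q k) : Fin (2 * 2))
  | .bob => b

/-- The two bits of node `k`; the first belongs to the segment on the left of the node, the second
one to the segment on its right. -/
def nodeBits {n : ℕ} (x : Idx (chainDims n)) (k : Fin n) : Fin 2 × Fin 2 :=
  finProdFinEquiv.symm (x (.node k) : Fin (2 * 2))

/-- The label of the left qubit of each of the `n + 1` segments. -/
def leftBit {n : ℕ} (x : Idx (chainDims n)) : Fin (n + 1) → Fin 2 :=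
  Fin.cons (α := fun _ => Fin 2) (x .alice : Fin 2) (fun k => (nodeBits x k).2)

/-- The label of the right qubit of each of the `n + 1` segments. -/
def rightBit {n : ℕ} (x : Idx (chainDims n)) : Fin (n + 1) → Fin 2 :=
  Fin.snoc (α := fun _ => Fin 2) (fun k => (nodeBits x k).1) (x .bob : Fin 2)

/-- Operators on two qubits. -/
abbrev TwoQubit : Type := Matrix (Fin 2 × Fin 2) (Fin 2 × Fin 2) ℂ

/-- The state `⨂ s, σ s` of the chain in which segment `s` (`s = 0, …, n`) shares `σ s`. -/
def chainState {n : ℕ} (σ : Fin (n + 1) → TwoQubit) : Op (chainDims n) :=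
  Matrix.of fun x y => ∏ s, σ s (leftBit x s, rightBit x s) (leftBit y s, rightBit y s)

/-- A label of the final system from the bits of Alice and Bob. -/
def endIdx {n : ℕ} (q : Fin 2 × Fin 2) : Idx (endDims n)
  | .alice => q.1
  | .node _ => (0 : Fin 1)
  | .bob => q.2

/-- The final operator as an operator on the two qubits of Alice and Bob. -/
def endState {n : ℕ} (X : Op (endDims n)) : TwoQubit := X.submatrix endIdx endIdx

/-! ### Fully entangled fraction -/

/-- A vector of two qubits is maximally entangled: it is a unit vector with maximally mixed
reduced state. -/
def IsMaxEntangled (φ : Fin 2 × Fin 2 → ℂ) : Prop :=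
  (Matrix.of fun i j => φ (i, j)) * (Matrix.of fun i j => φ (i, j))ᴴ =
    (1 / 2 : ℂ) • (1 : Matrix (Fin 2) (Fin 2) ℂ)

/-- The fully entangled fraction `max ⟨φ|X|φ⟩` over the maximally entangled vectors `φ`. -/
def fef (X : TwoQubit) : ℝ :=
  sSup {r : ℝ | ∃ φ, IsMaxEntangled φ ∧ r = (star φ ⬝ᵥ (X *ᵥ φ)).re}

/-- The fully entangled fractions that can be reached between Alice and Bob from the segment states
`σ` by LOCC among Alice, all the nodes, and Bob. -/
def achievableFEF {n : ℕ} (σ : Fin (n + 1) → TwoQubit) : Set ℝ :=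
  {r | ∃ Λ : Op (chainDims n) → Op (endDims n), IsLOCC Λ ∧ r = fef (endState (Λ (chainState σ)))}

/-- The end-to-end optimal fully entangled fraction of a chain with segment states `σ`. -/
def chainOFEF {n : ℕ} (σ : Fin (n + 1) → TwoQubit) : ℝ := sSup (achievableFEF σ)

/-- The optimal fully entangled fraction of a two-qubit state, over LOCC between its two holders
(there is no node). -/
def ofef (ρ : TwoQubit) : ℝ := chainOFEF (n := 0) fun _ => ρ

/-! ### The states of the segments -/

/-- Unitary `2 × 2` matrices; the columns form an orthonormal basis of a qubit. -/
abbrev QubitBasis : Type := Matrix.unitaryGroup (Fin 2) ℂ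

/-- The vector whose coordinates in the product basis `U ⊗ V` are `c`. -/
def inBasis (U V : QubitBasis) (c : Fin 2 × Fin 2 → ℂ) : Fin 2 × Fin 2 → ℂ :=
  ((U : Matrix (Fin 2) (Fin 2) ℂ) ⊗ₖ (V : Matrix (Fin 2) (Fin 2) ℂ)) *ᵥ c

/-- The rank one operator `|v⟩⟨v|`. -/
def proj (v : Fin 2 × Fin 2 → ℂ) : TwoQubit := Matrix.vecMulVec v (star v)

/-- `√α |00⟩ + √(1 - α) |11⟩`. -/
def schmidtVec (α : ℝ) : Fin 2 × Fin 2 → ℂ := fun q =>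
  if q = (0, 0) then ((Real.sqrt α : ℝ) : ℂ)
  else if q = (1, 1) then ((Real.sqrt (1 - α) : ℝ) : ℂ) else 0

/-- `|01⟩`. -/
def ket01 : Fin 2 × Fin 2 → ℂ := Pi.single (0, 1) 1

/-- The pure state with Schmidt coefficients `√α, √(1 - α)` and Schmidt bases `U, V`. -/
def pureState (α : ℝ) (U V : QubitBasis) : TwoQubit := proj (inBasis U V (schmidtVec α))

/-- The noisy state `p P + (1 - p) ζ(δ)`, where `P` is the product vector `u₀ ⊗ v₁` and `ζ(δ)` the
orthogonal vector `√δ u₀ ⊗ v₀ + √(1 - δ) u₁ ⊗ v₁`, for the bases `U = (u₀, u₁)`, `V = (v₀, v₁)`. -/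
def noisyState (p δ : ℝ) (U V : QubitBasis) : TwoQubit :=
  (p : ℂ) • proj (inBasis U V ket01) + ((1 - p : ℝ) : ℂ) • proj (inBasis U V (schmidtVec δ))

/-! ### Bell measurements at the two nodes -/

/-- The Bell basis `(|00⟩ ± |11⟩) / √2`, `(|01⟩ ± |10⟩) / √2`. -/
def bellVec : Fin 4 → Fin 2 × Fin 2 → ℂ :=
  let c : ℂ := ((1 / Real.sqrt 2 : ℝ) : ℂ)
  ![c • (Pi.single (0, 0) 1 + Pi.single (1, 1) 1), c • (Pi.single (0, 0) 1 - Pi.single (1, 1) 1),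
    c • (Pi.single (0, 1) 1 + Pi.single (1, 0) 1), c • (Pi.single (0, 1) 1 - Pi.single (1, 0) 1)]

/-- The unnormalised state of Alice and Bob in a two-node chain in the state `η` when node `0` is
projected on the vector `f` and node `1` on the vector `g`, i.e. the partial trace over the nodes
of `(|f⟩⟨f| ⊗ |g⟩⟨g| ⊗ 1_AB) η`. -/
def projectNodes (f g : Fin 2 × Fin 2 → ℂ) (η : Op (chainDims 2)) : TwoQubit :=
  Matrix.of fun s t => ∑ q, ∑ r, ∑ q', ∑ r',
    star (f q) * star (g r) * η (mkIdx s.1 ![q, r] s.2) (mkIdx t.1 ![q', r'] t.2) * f q' * g r'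

/-- The probability of the outcome with unnormalised post-measurement state `τ`. -/
def outcomeProb (τ : TwoQubit) : ℝ := (Matrix.trace τ).re

/-- The normalised post-measurement state. -/
def outcomeState (τ : TwoQubit) : TwoQubit := ((outcomeProb τ)⁻¹ : ℂ) • τ

/-- The average optimal fully entangled fraction `∑ p_ij F⋆(ρ_ij)` of Alice and Bob after Bell
measurements at both nodes of a two-node chain with segment states `σ`. The Bell basis of a node is
taken with respect to given bases of its two qubits: `V 0, U 1` at node `0`, and `V 1, U 2` at node
`1`, where segment `s` has the local bases `U s` (left qubit) and `V s` (right qubit). -/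
def bellAverageOFEF (σ : Fin 3 → TwoQubit) (U V : Fin 3 → QubitBasis) : ℝ :=
  ∑ i, ∑ j,
    let τ := projectNodes (inBasis (V 0) (U 1) (bellVec i)) (inBasis (V 1) (U 2) (bellVec j))
      (chainState (n := 2) σ)
    outcomeProb τ * ofef (outcomeState τ)

/-! ### Concatenation of the side chains -/

/-- The concurrence of a pure two-qubit state with Schmidt coefficients `√α, √(1 - α)`. -/
def concurrence (α : ℝ) : ℝ := 2 * Real.sqrt (α * (1 - α))

/-- The larger squared Schmidt coefficient of a pure two-qubit state of concurrence `c`. -/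
def schmidtOfConcurrence (c : ℝ) : ℝ := (1 + Real.sqrt (1 - c ^ 2)) / 2

/-- Effective parameter of the segments on the left of segment `m`. -/
def alphaLeft {n : ℕ} (m : Fin (n + 1)) (α : Fin (n + 1) → ℝ) : ℝ :=
  schmidtOfConcurrence (∏ s ∈ Finset.univ.filter (· < m), concurrence (α s))

/-- Effective parameter of the segments on the right of segment `m`. -/
def alphaRight {n : ℕ} (m : Fin (n + 1)) (α : Fin (n + 1) → ℝ) : ℝ :=
  schmidtOfConcurrence (∏ s ∈ Finset.univ.filter (m < ·), concurrence (α s))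

/-- The isometry that places a two-node chain in an `n`-node chain, with Alice and Bob as they are,
the two nodes at the two ends of segment `m` (nodes `m - 1` and `m`), and all the other nodes in
the fixed state `|00⟩`. -/
def placeTwoNode {n : ℕ} (m : Fin (n + 1)) : Matrix (Idx (chainDims n)) (Idx (chainDims 2)) ℂ :=
  Matrix.of fun y x =>
    if y = mkIdx (x .alice)
        (fun k => if (k : ℕ) + 1 = m then nodeBits x 0 else if (k : ℕ) = m then nodeBits x 1
          else (0, 0))
        (x .bob)
    then 1 else 0

end

end Repeater

open Repeater

namespace Repeater

noncomputable section

/-! The argument lives in the family `mixState q x z`: weight q on u₀ ⊗ v₁ plus the vector x u₀ ⊗ v₀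
+ z u₁ ⊗ v₁. The noisy state is the member with q = p, x = √((1-p)δ), z = √((1-p)(1-δ)). The
decisive number is B = (q + x² + z² + (xz)²/q)/2.

Upper bound: adding the positive operator of weight (xz)²/q on u₁ ⊗ v₀ turns the mixture into a sum
of product vectors of total squared norm 2B (`mixState_add_eq_sum_product`). With a product vector
in segment m, the whole chain is a product across the cut through m. Every branch of an LOCC
protocol keeps it a product, and a product vector has squared overlap at most half its squared norm
with a maximally entangled vector. Hence no protocol exceeds B, whatever the free segments are
(`IsLOCC.overlap_chain_le`).

Lower bound: if xz ≤ q, the filter diag(xz/q, 1) on Alice's side, with a product state prepared on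
failure, reaches B (`exists_isLOCC_overlap_mixState`). So B is the optimal fraction of a single
mixture (`ofef_mixState`).

Bell measurements: up to local unitaries, each outcome applies diagonal filters with entries √α,
√(1-α) to the two sides of the mixture (`swap_bellVec`), so the family is preserved. Weighted with
probabilities, B is homogeneous of degree one, and the squared filter entries sum to constants, so
the average of B is again B (`sum_bell_value`). This needs xz ≤ q after every outcome. Condition (*)
is that inequality for the worst outcome (`bell_parameters`).

Longer chains: a node sharing pure states with both neighbours measures in a maximally entangled
basis whose amplitudes have equal modulus in the Schmidt bases. All outcomes then give the same
Schmidt coefficients, and concurrences multiply (`exists_swap_basis`). Repeating this on both sides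
of segment m leaves the two-node chain (`exists_isLOCC_reduce`), where the Bell measurements and the
filter attain the upper bound. -/

/-- The rank one operator `|v⟩⟨v|` on an arbitrary finite system. -/
def rankOne {κ : Type*} (v : κ → ℂ) : Matrix κ κ ℂ := Matrix.vecMulVec v (star v)

lemma sandwich_rankOne {κ κ' : Type*} [Fintype κ] (M : Matrix κ' κ ℂ) (v : κ → ℂ) :
    M * rankOne v * Mᴴ = rankOne (M *ᵥ v) := by
  rw [rankOne, Matrix.mul_vecMulVec, Matrix.vecMulVec_mul, rankOne, Matrix.star_mulVec]

lemma rankOne_smul {κ : Type*} (c : ℂ) (v : κ → ℂ) :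
    rankOne (c • v) = (c * star c) • rankOne v := by
  ext i j
  simp [rankOne, Matrix.vecMulVec_apply]
  ring

/-! ### Local operators and basic LOCC protocols -/

section LOCC

variable {ι : Type} [Fintype ι]

lemma tensorOp_mul [DecidableEq ι] {d d' d'' : ι → ℕ}
    (K : ∀ j, Matrix (Fin (d'' j)) (Fin (d' j)) ℂ)
    (L : ∀ j, Matrix (Fin (d' j)) (Fin (d j)) ℂ) :
    tensorOp K * tensorOp L = tensorOp fun j => K j * L j := by
  ext y x
  simp only [tensorOp, Matrix.mul_apply, Matrix.of_apply, ← Finset.prod_mul_distrib]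
  exact (Fintype.prod_sum (fun j t => K j (y j) t * L j t (x j))).symm

lemma tensorOp_conjTranspose {d d' : ι → ℕ} (K : ∀ j, Matrix (Fin (d' j)) (Fin (d j)) ℂ) :
    (tensorOp K)ᴴ = tensorOp fun j => (K j)ᴴ := by
  ext y x
  simp [tensorOp, Matrix.conjTranspose_apply]

lemma tensorOp_one {d : ι → ℕ} :
    tensorOp (fun j => (1 : Matrix (Fin (d j)) (Fin (d j)) ℂ)) = 1 := by
  ext y x
  simp only [tensorOp, Matrix.of_apply, Matrix.one_apply]
  by_cases h : y = x
  · subst h; simp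
  · rw [if_neg h]
    obtain ⟨j, hj⟩ := Function.ne_iff.mp h
    exact Finset.prod_eq_zero (Finset.mem_univ j) (if_neg hj)

variable [DecidableEq ι]

/-- The operator `M` of party `i`, tensored with the identity of all other parties. -/
def localOp {d : ι → ℕ} (i : ι) (M : Matrix (Fin (d i)) (Fin (d i)) ℂ) : Op d :=
  tensorOp (Function.update (fun j => (1 : Matrix (Fin (d j)) (Fin (d j)) ℂ)) i M)

/-- The identity factors vanish unless the two labels agree away from party i, so only the sum over
the label of party i survives. -/
lemma localOp_mulVec {d : ι → ℕ} (i : ι) (M : Matrix (Fin (d i)) (Fin (d i)) ℂ)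
    (v : Idx d → ℂ) (y : Idx d) :
    (localOp i M *ᵥ v) y = ∑ t, M (y i) t * v (Function.update y i t) := by
  have hval : ∀ x, localOp i M y x =
      if Function.update y i (x i) = x then M (y i) (x i) else 0 := by
    intro x
    simp only [localOp, tensorOp, Matrix.of_apply]
    split_ifs with h
    · rw [Finset.prod_eq_single i]
      · simp
      · intro j _ hj
        rw [Function.update_of_ne hj, ← h, Function.update_of_ne hj, Matrix.one_apply_eq]
      · simp
    · obtain ⟨j, hj⟩ := Function.ne_iff.mp h
      have hji : j ≠ i := by
        rintro rfl; simp at hj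
      rw [Function.update_of_ne hji] at hj
      refine Finset.prod_eq_zero (Finset.mem_univ j) ?_
      rw [Function.update_of_ne hji, Matrix.one_apply_ne hj]
  simp only [Matrix.mulVec, dotProduct, hval]
  symm
  refine Finset.sum_of_injOn (fun t => Function.update y i t) ?_ (by simp) ?_ ?_
  · intro a _ b _ h
    have := congrFun h i
    simpa using this
  · intro x _ hx
    rw [if_neg, zero_mul]
    intro h
    exact hx ⟨x i, by simp, h⟩
  · intro t _
    simp

/-- The operator `M` of party `i`, whose basis labels are identified with `κ`, tensored with the
identity of all other parties. -/
def localOpOn {d : ι → ℕ} {i : ι} {κ : Type} (ε : κ ≃ Fin (d i)) (M : Matrix κ κ ℂ) : Op d :=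
  localOp i (M.submatrix ε.symm ε.symm)

lemma localOpOn_mulVec {d : ι → ℕ} {i : ι} {κ : Type} [Fintype κ] (ε : κ ≃ Fin (d i))
    (M : Matrix κ κ ℂ) (v : Idx d → ℂ) (y : Idx d) :
    (localOpOn ε M *ᵥ v) y = ∑ t, M (ε.symm (y i)) t * v (Function.update y i (ε t)) := by
  rw [localOpOn, localOp_mulVec, ← Equiv.sum_comp ε]
  simp

namespace IsLOCC

/-- `IsLOCC` speaks of bare functions. Linearity is what allows a protocol to be evaluated
separately on the components of a mixture. -/
lemma exists_linear {d e : ι → ℕ} {Λ : Op d → Op e} (h : IsLOCC Λ) :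
    ∃ L : Op d →ₗ[ℂ] Op e, ∀ X, Λ X = L X := by
  induction h with
  | done => exact ⟨LinearMap.id, fun _ => rfl⟩
  | step i K h_meas h_isom Λ hΛ ih =>
    choose L hL using ih
    exact ⟨{ toFun := fun X => ∑ x, L x (tensorOp (K x) * X * (tensorOp (K x))ᴴ)
             map_add' := fun X Y => by
              simp only [Matrix.mul_add, Matrix.add_mul, map_add, Finset.sum_add_distrib]
             map_smul' := fun c X => by
              simp only [Matrix.mul_smul, Matrix.smul_mul, map_smul, RingHom.id_apply,
                Finset.smul_sum] }, fun X => Finset.sum_congr rfl fun x _ => hL x _⟩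

/-- The second protocol is appended at every leaf of the first. Its linearity pulls it through the
sums over outcomes. -/
lemma comp {d e e' : ι → ℕ} {Λ : Op d → Op e} {Λ' : Op e → Op e'} (h : IsLOCC Λ)
    (h' : IsLOCC Λ') : IsLOCC (fun X => Λ' (Λ X)) := by
  obtain ⟨L', hL'⟩ := h'.exists_linear
  induction h with
  | done => exact h'
  | step i K h_meas h_isom Λ hΛ ih =>
    have := IsLOCC.step i K h_meas h_isom (fun x X => Λ' (Λ x X)) ih
    simpa only [hL', map_sum] using this

lemma measure {d e : ι → ℕ} (i : ι) {N : ℕ} (M : Fin N → Matrix (Fin (d i)) (Fin (d i)) ℂ)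
    (hM : ∑ x, (M x)ᴴ * M x = 1) (Λ : Fin N → Op d → Op e) (hΛ : ∀ x, IsLOCC (Λ x)) :
    IsLOCC (fun X : Op d => ∑ x, Λ x (localOp i (M x) * X * (localOp i (M x))ᴴ)) := by
  refine IsLOCC.step i (mid := fun _ => d)
    (fun x => Function.update (fun j => (1 : Matrix (Fin (d j)) (Fin (d j)) ℂ)) i (M x))
    ?_ ?_ Λ hΛ
  · simpa using hM
  · intro x j hj
    simp [Function.update_of_ne hj]

lemma measureOn {d e : ι → ℕ} {i : ι} {κ : Type} [Fintype κ] [DecidableEq κ] (ε : κ ≃ Fin (d i))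
    {N : ℕ} (M : Fin N → Matrix κ κ ℂ) (hM : ∑ x, (M x)ᴴ * M x = 1) (Λ : Fin N → Op d → Op e)
    (hΛ : ∀ x, IsLOCC (Λ x)) :
    IsLOCC (fun X : Op d => ∑ x, Λ x (localOpOn ε (M x) * X * (localOpOn ε (M x))ᴴ)) := by
  refine measure i (fun x => (M x).submatrix ε.symm ε.symm) ?_ Λ hΛ
  have h := congrArg (fun X : Matrix κ κ ℂ => X.submatrix ε.symm ε.symm) hM
  simp only [Matrix.submatrix_one_equiv] at h
  rw [← h]
  ext a b
  simp [Matrix.sum_apply, Matrix.conjTranspose_submatrix, Matrix.submatrix_mul_equiv]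

lemma localUnitary {d : ι → ℕ} {i : ι} {κ : Type} [Fintype κ] [DecidableEq κ] (ε : κ ≃ Fin (d i))
    (U : Matrix κ κ ℂ) (hU : Uᴴ * U = 1) :
    IsLOCC (fun X : Op d => localOpOn ε U * X * (localOpOn ε U)ᴴ) := by
  simpa using measureOn ε (fun _ : Fin 1 => U) (by simpa using hU) (fun _ X => X) (fun _ => done)

end IsLOCC

/-- LOCC undoes a tensor product of local isometries. -/
lemma exists_isLOCC_undo_isometry [Nonempty ι] {e : ι → ℕ} (he : ∀ j, 0 < e j) (S : Finset ι) :
    ∀ (d : ι → ℕ) (J : ∀ j, Matrix (Fin (d j)) (Fin (e j)) ℂ), (∀ j, (J j)ᴴ * J j = 1) →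
      (∀ j ∉ S, J j * (J j)ᴴ = 1) →
      ∃ Λ : Op d → Op e, IsLOCC Λ ∧ ∀ X, Λ (tensorOp J * X * (tensorOp J)ᴴ) = X := by
  induction S using Finset.induction_on with
  | empty =>
    intro d J hJ hJ'
    -- Here every `J j` is unitary, so a single round in which each party applies its adjoint
    -- suffices. A round needs an acting party, whence `Nonempty`.
    obtain ⟨i⟩ := ‹Nonempty ι›
    refine ⟨_, IsLOCC.step i (N := 1) (mid := fun _ => e) (fun _ j => (J j)ᴴ) ?_ ?_ (fun _ X => X)
      (fun _ => IsLOCC.done), fun X => ?_⟩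
    · simpa using hJ' i
    · intro _ j _
      simpa using hJ' j
    · have h1 : tensorOp (fun j => (J j)ᴴ) * tensorOp J = 1 := by
        rw [tensorOp_mul, ← tensorOp_one]
        simp only [hJ]
      have h2 : (tensorOp J)ᴴ * (tensorOp (fun j => (J j)ᴴ))ᴴ = 1 := by
        rw [← Matrix.conjTranspose_mul, h1, Matrix.conjTranspose_one]
      simp only [Finset.univ_unique, Finset.sum_singleton]
      calc _ = (tensorOp (fun j => (J j)ᴴ) * tensorOp J) * X *
            ((tensorOp J)ᴴ * (tensorOp (fun j => (J j)ᴴ))ᴴ) := by simp only [Matrix.mul_assoc]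
        _ = X := by rw [h1, h2, one_mul, mul_one]
  | insert i S hi ih =>
    intro d J hJ hJ'
    -- In a round only one party may act non-isometrically, so the parties of S are treated one at a
    -- time. Outcome `none` undoes the isometry of party i, and the outcomes `some q` never occur on
    -- its range. The other parties do nothing.
    have hloc : ∀ j, ∃ (m : ℕ) (J' : Matrix (Fin m) (Fin (e j)) ℂ)
        (K : Option (Fin (d i)) → Matrix (Fin m) (Fin (d j)) ℂ),
        J'ᴴ * J' = 1 ∧ (j ∉ S → J' * J'ᴴ = 1) ∧ K none * J j = J' ∧
        (j = i → ∑ x, (K x)ᴴ * K x = 1 ∧ ∀ q, K (some q) * J j = 0) ∧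
        (j ≠ i → ∀ x, (K x)ᴴ * K x = 1) := by
      intro j
      by_cases hji : j = i
      · subst hji
        -- The projection on the complement of the range of `J j`. To complete the measurement, each
        -- basis vector q after P is sent to label 0, which exists because `e j` is positive.
        let P : Matrix (Fin (d j)) (Fin (d j)) ℂ := 1 - J j * (J j)ᴴ
        have hP : Pᴴ = P := by simp [P]
        have hPJ : P * J j = 0 := by
          simp only [P, Matrix.sub_mul, Matrix.mul_assoc, hJ, Matrix.one_mul, Matrix.mul_one,
            sub_self]
        have hPP : P * P = P := by
          conv_lhs => rhs; simp only [P]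
          rw [Matrix.mul_sub, ← Matrix.mul_assoc, hPJ]; simp
        refine ⟨e j, 1, fun x => x.elim (J j)ᴴ
          fun q => Matrix.single (⟨0, he j⟩ : Fin (e j)) q (1 : ℂ) * P, by simp, by simp,
          hJ j, fun _ => ⟨?_, fun q => ?_⟩, fun h => (h rfl).elim⟩
        · rw [Fintype.sum_option]
          have : ∀ q : Fin (d j), (Matrix.single (⟨0, he j⟩ : Fin (e j)) q (1 : ℂ) * P)ᴴ *
              (Matrix.single (⟨0, he j⟩ : Fin (e j)) q (1 : ℂ) * P) =
              P * Matrix.single q q 1 * P := by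
            intro q
            rw [Matrix.conjTranspose_mul, hP, Matrix.conjTranspose_single, Matrix.mul_assoc,
              ← Matrix.mul_assoc (Matrix.single _ _ _), Matrix.single_mul_single_same]
            simp [Matrix.mul_assoc]
          simp only [Option.elim, this, ← Matrix.mul_sum, ← Matrix.sum_mul]
          rw [Matrix.sum_single_one, mul_one, hPP]
          simp [P]
        · simp only [Option.elim]
          rw [Matrix.mul_assoc, hPJ, Matrix.mul_zero]
      · refine ⟨d j, J j, fun _ => 1, hJ j, fun h => hJ' j (by simp [hji, h]), by simp,
          fun h => (hji h).elim, fun _ _ => by simp⟩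
    choose m J' K h1 h2 h3 h4 h5 using hloc
    obtain ⟨Λ, hΛ, hΛ'⟩ := ih m J' h1 h2
    let eqv := Fintype.equivFin (Option (Fin (d i)))
    refine ⟨_, IsLOCC.step i (mid := fun _ => m) (fun x j => K j (eqv.symm x)) ?_ ?_ (fun _ => Λ)
      (fun _ => hΛ), fun X => ?_⟩
    · rw [← (h4 i rfl).1]
      exact Equiv.sum_comp eqv.symm (fun x => (K i x)ᴴ * K i x)
    · intro x j hj
      exact h5 j hj _
    · rw [Equiv.sum_comp eqv.symm (fun x => Λ (tensorOp (fun j => K j x) *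
        (tensorOp J * X * (tensorOp J)ᴴ) * (tensorOp fun j => K j x)ᴴ)), Fintype.sum_option]
      have key : ∀ x, tensorOp (fun j => K j x) * (tensorOp J * X * (tensorOp J)ᴴ) *
          (tensorOp fun j => K j x)ᴴ = tensorOp (fun j => K j x * J j) * X *
          (tensorOp (fun j => K j x * J j))ᴴ := by
        intro x
        rw [← tensorOp_mul, Matrix.conjTranspose_mul]
        simp only [Matrix.mul_assoc]
      simp only [key, h3, hΛ']
      rw [Finset.sum_eq_zero, add_zero]
      intro q _
      have : tensorOp (fun j => K j (some q) * J j) = 0 := by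
        ext y x
        exact Finset.prod_eq_zero (Finset.mem_univ i)
            (congrFun (congrFun ((h4 i rfl).2 q) (y i)) (x i))
      rw [this, Matrix.zero_mul, Matrix.zero_mul]
      -- Applied to the zero operator, `hΛ'` says that `Λ` maps 0 to 0.
      simpa using hΛ' 0

end LOCC

/-! ### Chain states as functions of the bits of individual qubits -/

section Slots

variable {n : ℕ}

/-- The qubits of a chain: `(s, false)` and `(s, true)` are the left and the right qubit of
segment `s`. -/
abbrev Slot (n : ℕ) : Type := Fin (n + 1) × Bool

/-- The labels of Alice's qubit. -/
def aliceEquiv : Fin 2 ≃ Fin (chainDims n .alice) := Equiv.refl (Fin 2)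

/-- The labels of Bob's qubit. -/
def bobEquiv : Fin 2 ≃ Fin (chainDims n .bob) := Equiv.refl (Fin 2)

/-- The labels of the two qubits of a node. -/
def nodeEquiv (k : Fin n) : Fin 2 × Fin 2 ≃ Fin (chainDims n (.node k)) :=
  finProdFinEquiv (m := 2) (n := 2)

lemma nodeBits_eq (x : Idx (chainDims n)) (k : Fin n) :
    nodeBits x k = (nodeEquiv k).symm (x (.node k)) := rfl

lemma mkIdx_alice (a : Fin 2) (q : Fin n → Fin 2 × Fin 2) (b : Fin 2) :
    mkIdx a q b .alice = aliceEquiv a := rfl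

lemma mkIdx_node (a : Fin 2) (q : Fin n → Fin 2 × Fin 2) (b : Fin 2) (k : Fin n) :
    mkIdx a q b (.node k) = nodeEquiv k (q k) := rfl

lemma mkIdx_bob (a : Fin 2) (q : Fin n → Fin 2 × Fin 2) (b : Fin 2) :
    mkIdx a q b .bob = bobEquiv b := rfl

@[simp] lemma leftBit_zero (x : Idx (chainDims n)) :
    leftBit x 0 = aliceEquiv.symm (x .alice) := rfl

@[simp] lemma leftBit_succ (x : Idx (chainDims n)) (k : Fin n) :
    leftBit x k.succ = (nodeBits x k).2 := rfl

@[simp] lemma rightBit_castSucc (x : Idx (chainDims n)) (k : Fin n) :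
    rightBit x k.castSucc = (nodeBits x k).1 :=
  Fin.snoc_castSucc (α := fun _ => Fin 2) _ _ _

@[simp] lemma rightBit_last (x : Idx (chainDims n)) :
    rightBit x (Fin.last n) = bobEquiv.symm (x .bob) :=
  Fin.snoc_last (α := fun _ => Fin 2) _ _

@[simp] lemma nodeBits_mkIdx (a : Fin 2) (q : Fin n → Fin 2 × Fin 2) (b : Fin 2) (k : Fin n) :
    nodeBits (mkIdx a q b) k = q k := by
  simp [nodeBits_eq, mkIdx_node]

/-- The bits of all qubits of a chain. -/
def slotBits : Idx (chainDims n) ≃ (Slot n → Fin 2) where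
  toFun x t := bif t.2 then rightBit x t.1 else leftBit x t.1
  invFun β := mkIdx (β (0, false)) (fun k => (β (k.castSucc, true), β (k.succ, false)))
    (β (Fin.last n, true))
  left_inv x := by
    funext j
    cases j with
    | alice => rfl
    | node k => simp [mkIdx_node, nodeBits_eq]
    | bob => simp [mkIdx_bob]
  right_inv β := by
    funext ⟨s, b⟩
    cases b with
    | false =>
      cases s using Fin.cases with
      | zero => rfl
      | succ k => simp
    | true =>
      cases s using Fin.lastCases with
      | last => simp [mkIdx_bob]
      | cast k => simp

@[simp] lemma slotBits_false (x : Idx (chainDims n)) (s : Fin (n + 1)) :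
    slotBits x (s, false) = leftBit x s := rfl

@[simp] lemma slotBits_true (x : Idx (chainDims n)) (s : Fin (n + 1)) :
    slotBits x (s, true) = rightBit x s := rfl

/-- This and the next two lemmas translate a change of one party's label into changes of qubit bits.
Node k holds the right qubit of segment `k.castSucc` and the left qubit of segment `k.succ`. -/
lemma slotBits_update_alice (x : Idx (chainDims n)) (c : Fin 2) :
    slotBits (Function.update x .alice (aliceEquiv c)) =
      Function.update (slotBits x) (0, false) c := by
  funext ⟨s, b⟩
  cases b with
  | false =>
    cases s using Fin.cases with
    | zero => simp
    | succ k => simp [nodeBits_eq, Function.update]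
  | true =>
    cases s using Fin.lastCases with
    | last => simp
    | cast k => simp [nodeBits_eq]

lemma slotBits_update_bob (x : Idx (chainDims n)) (c : Fin 2) :
    slotBits (Function.update x .bob (bobEquiv c)) =
      Function.update (slotBits x) (Fin.last n, true) c := by
  funext ⟨s, b⟩
  cases b with
  | false =>
    cases s using Fin.cases with
    | zero => simp
    | succ k => simp [nodeBits_eq]
  | true =>
    cases s using Fin.lastCases with
    | last => simp
    | cast k => simp [nodeBits_eq, Function.update, Fin.castSucc_ne_last]

lemma slotBits_update_node (x : Idx (chainDims n)) (k : Fin n) (q : Fin 2 × Fin 2) :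
    slotBits (Function.update x (.node k) (nodeEquiv k q)) =
      Function.update (Function.update (slotBits x) (k.castSucc, true) q.1)
        (k.succ, false) q.2 := by
  funext ⟨s, b⟩
  cases b with
  | false =>
    cases s using Fin.cases with
    | zero => simp [Function.update, (Fin.succ_ne_zero _).symm]
    | succ l =>
      by_cases h : l = k
      · subst h; simp [nodeBits_eq]
      · simp [nodeBits_eq, Function.update, h]
  | true =>
    cases s using Fin.lastCases with
    | last => simp [Function.update, (Fin.castSucc_ne_last _).symm]
    | cast l =>
      by_cases h : l = k
      · subst h; simp [nodeBits_eq]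
      · simp [nodeBits_eq, Function.update, h]

/-- The chain state with amplitudes `v`. -/
def slotState (v : (Slot n → Fin 2) → ℂ) : Op (chainDims n) := rankOne (v ∘ slotBits)

lemma slotState_smul (c : ℂ) (v : (Slot n → Fin 2) → ℂ) :
    slotState (c • v) = (c * star c) • slotState v := by
  rw [slotState, slotState, ← rankOne_smul]; rfl

/-- The single-qubit operator `U` on the qubit `t`. -/
def slotOp (t : Slot n) (U : Matrix (Fin 2) (Fin 2) ℂ) (v : (Slot n → Fin 2) → ℂ) :
    (Slot n → Fin 2) → ℂ :=
  fun β => ∑ c, U (β t) c * v (Function.update β t c)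

/-- The operator `|00⟩⟨f|` on the two qubits of node `k`. -/
def nodeOp (k : Fin n) (f : Fin 2 × Fin 2 → ℂ) (v : (Slot n → Fin 2) → ℂ) :
    (Slot n → Fin 2) → ℂ :=
  fun β => if β (k.castSucc, true) = 0 ∧ β (k.succ, false) = 0 then
    ∑ q : Fin 2 × Fin 2, star (f q) * v (Function.update (Function.update β (k.castSucc, true) q.1)
        (k.succ, false) q.2) else 0

lemma localOp_alice_comp (U : Matrix (Fin 2) (Fin 2) ℂ) (v : (Slot n → Fin 2) → ℂ) :
    localOpOn (aliceEquiv (n := n)) U *ᵥ (v ∘ slotBits) = slotOp (0, false) U v ∘ slotBits := by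
  funext y
  simp only [localOpOn_mulVec, Function.comp_apply, slotBits_update_alice, slotOp]
  simp

lemma localOp_bob_comp (U : Matrix (Fin 2) (Fin 2) ℂ) (v : (Slot n → Fin 2) → ℂ) :
    localOpOn (bobEquiv (n := n)) U *ᵥ (v ∘ slotBits) =
      slotOp (Fin.last n, true) U v ∘ slotBits := by
  funext y
  simp only [localOpOn_mulVec, Function.comp_apply, slotBits_update_bob, slotOp]
  simp

lemma localOp_node_comp (k : Fin n) (M : Matrix (Fin 2 × Fin 2) (Fin 2 × Fin 2) ℂ)
    (v : (Slot n → Fin 2) → ℂ) :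
    localOpOn (nodeEquiv k) M *ᵥ (v ∘ slotBits) =
      (fun β => ∑ q : Fin 2 × Fin 2, M (β (k.castSucc, true), β (k.succ, false)) q *
        v (Function.update (Function.update β (k.castSucc, true) q.1) (k.succ, false) q.2)) ∘
        slotBits := by
  funext y
  rw [localOpOn_mulVec]
  refine Finset.sum_congr rfl fun q _ => ?_
  rw [Function.comp_apply, slotBits_update_node]
  simp [nodeBits_eq]

lemma kronecker_isometry {U V : Matrix (Fin 2) (Fin 2) ℂ} (hU : Uᴴ * U = 1) (hV : Vᴴ * V = 1) :
    (U ⊗ₖ V)ᴴ * (U ⊗ₖ V) = 1 := by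
  rw [Matrix.conjTranspose_kronecker, ← Matrix.mul_kronecker_mul, hU, hV, Matrix.one_kronecker_one]

/-- A unitary on any single qubit of the chain is LOCC. -/
lemma exists_isLOCC_slotOp (t : Slot n) (U : Matrix (Fin 2) (Fin 2) ℂ) (hU : Uᴴ * U = 1) :
    ∃ Λ : Op (chainDims n) → Op (chainDims n), IsLOCC Λ ∧
      ∀ v, Λ (slotState v) = slotState (slotOp t U v) := by
  obtain ⟨s, b⟩ := t
  cases b with
  | false =>
    cases s using Fin.cases with
    | zero =>
      refine ⟨_, IsLOCC.localUnitary aliceEquiv U hU, fun v => ?_⟩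
      simp only [slotState, sandwich_rankOne, localOp_alice_comp]
    | succ k =>
      refine ⟨_, IsLOCC.localUnitary (nodeEquiv k) _
        (kronecker_isometry (U := 1) (by simp) hU), fun v => ?_⟩
      simp only [slotState, sandwich_rankOne, localOp_node_comp]
      congr 2
      funext β
      simp [slotOp, Fintype.sum_prod_type, Matrix.kroneckerMap_apply, Matrix.one_apply]
  | true =>
    cases s using Fin.lastCases with
    | last =>
      refine ⟨_, IsLOCC.localUnitary bobEquiv U hU, fun v => ?_⟩
      simp only [slotState, sandwich_rankOne, localOp_bob_comp]
    | cast k =>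
      refine ⟨_, IsLOCC.localUnitary (nodeEquiv k) _
        (kronecker_isometry (V := 1) hU (by simp)), fun v => ?_⟩
      simp only [slotState, sandwich_rankOne, localOp_node_comp]
      congr 2
      funext β
      simp only [Fintype.sum_prod_type, Matrix.kroneckerMap_apply, Matrix.one_apply,
        mul_ite, mul_one, mul_zero, ite_mul, zero_mul, Finset.sum_ite_eq, Finset.mem_univ, if_true,
        slotOp]
      refine Finset.sum_congr rfl fun c _ => ?_
      congr 2
      rw [Function.update_eq_self_iff, Function.update_of_ne]
      simp

/-- A measurement of the two qubits of a node in an orthonormal basis `f`, after which the node is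
left in the state `|00⟩` and the parties go on according to the outcome. -/
lemma exists_isLOCC_nodeOp {e : Party n → ℕ} (k : Fin n) (f : Fin 4 → Fin 2 × Fin 2 → ℂ)
    (hf : ∀ q q', ∑ i, f i q * star (f i q') = if q = q' then 1 else 0)
    (Λ : Fin 4 → Op (chainDims n) → Op e) (hΛ : ∀ i, IsLOCC (Λ i)) :
    ∃ Λ' : Op (chainDims n) → Op e, IsLOCC Λ' ∧
      ∀ v, Λ' (slotState v) = ∑ i, Λ i (slotState (nodeOp k (f i) v)) := by
  let M : Fin 4 → Matrix (Fin 2 × Fin 2) (Fin 2 × Fin 2) ℂ := fun i =>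
    Matrix.of fun q q' => if q = (0, 0) then star (f i q') else 0
  refine ⟨_, IsLOCC.measureOn (nodeEquiv k) M ?_ Λ hΛ, fun v => ?_⟩
  · ext q q'
    simp only [Matrix.sum_apply, Matrix.mul_apply, M, Matrix.conjTranspose_apply, Matrix.of_apply,
      Matrix.one_apply]
    rw [← hf]
    refine Finset.sum_congr rfl fun i _ => ?_
    rw [Finset.sum_eq_single (0, 0)] <;> simp +contextual
  · simp only [slotState, sandwich_rankOne, localOp_node_comp]
    refine Finset.sum_congr rfl fun i _ => ?_
    congr 3
    funext β
    simp only [nodeOp, M, Matrix.of_apply, Prod.mk.injEq]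
    split_ifs <;> simp

end Slots

/-! ### Schmidt decomposition of two qubits -/

section Schmidt

lemma QubitBasis.conjTranspose_mul (U : QubitBasis) :
    (U : Matrix (Fin 2) (Fin 2) ℂ)ᴴ * (U : Matrix (Fin 2) (Fin 2) ℂ) = 1 :=
  Matrix.UnitaryGroup.star_mul_self U

lemma QubitBasis.mul_conjTranspose (U : QubitBasis) :
    (U : Matrix (Fin 2) (Fin 2) ℂ) * (U : Matrix (Fin 2) (Fin 2) ℂ)ᴴ = 1 :=
  (Matrix.mem_unitaryGroup_iff).mp U.2

lemma QubitBasis.transpose_mul_map_star (U : QubitBasis) :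
    (U : Matrix (Fin 2) (Fin 2) ℂ)ᵀ * (U : Matrix (Fin 2) (Fin 2) ℂ).map star = 1 := by
  rw [← Matrix.transpose_inj, Matrix.transpose_mul, Matrix.transpose_transpose,
    Matrix.transpose_one]
  exact U.conjTranspose_mul

/-- The unitary matrix with a given isometry property. -/
def QubitBasis.ofIsometry (U : Matrix (Fin 2) (Fin 2) ℂ) (h : Uᴴ * U = 1) : QubitBasis :=
  ⟨U, Matrix.mem_unitaryGroup_iff'.mpr h⟩

@[simp] lemma QubitBasis.coe_ofIsometry (U : Matrix (Fin 2) (Fin 2) ℂ) (h : Uᴴ * U = 1) :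
    (QubitBasis.ofIsometry U h : Matrix (Fin 2) (Fin 2) ℂ) = U := rfl

/-- The entrywise complex conjugate of a unitary matrix. -/
def QubitBasis.conj (U : QubitBasis) : QubitBasis :=
  QubitBasis.ofIsometry ((U : Matrix (Fin 2) (Fin 2) ℂ).map star) (by
    rw [← Matrix.transpose_inj, Matrix.transpose_mul, Matrix.transpose_one,
      ← U.conjTranspose_mul]
    congr 1
    ext i j
    simp)

/-- The transpose of a unitary matrix. -/
def QubitBasis.transpose (U : QubitBasis) : QubitBasis :=
  QubitBasis.ofIsometry (U : Matrix (Fin 2) (Fin 2) ℂ)ᵀ (by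
    rw [← Matrix.transpose_inj, Matrix.transpose_mul, Matrix.transpose_one, ← U.mul_conjTranspose]
    congr 1)

@[simp] lemma QubitBasis.coe_transpose (U : QubitBasis) :
    (U.transpose : Matrix (Fin 2) (Fin 2) ℂ) = (U : Matrix (Fin 2) (Fin 2) ℂ)ᵀ := rfl

/-- The matrix of amplitudes of `√α |00⟩ + √(1 - α) |11⟩`. -/
def schmidtMat (α : ℝ) : Matrix (Fin 2) (Fin 2) ℂ :=
  Matrix.diagonal ![((Real.sqrt α : ℝ) : ℂ), ((Real.sqrt (1 - α) : ℝ) : ℂ)]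

lemma exists_ordered_spectral_decomposition {H : Matrix (Fin 2) (Fin 2) ℂ} (hH : H.IsHermitian) :
    ∃ (W : QubitBasis) (μ : Fin 2 → ℝ), μ 1 ≤ μ 0 ∧
      H = (W : Matrix (Fin 2) (Fin 2) ℂ) * Matrix.diagonal (fun i => (μ i : ℂ)) *
        (W : Matrix (Fin 2) (Fin 2) ℂ)ᴴ := by
  have h := hH.spectral_theorem
  rw [Unitary.conjStarAlgAut_apply] at h
  rcases le_total (hH.eigenvalues 1) (hH.eigenvalues 0) with hle | hle
  · exact ⟨hH.eigenvectorUnitary, hH.eigenvalues, hle, h⟩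
  · let S : QubitBasis := QubitBasis.ofIsometry !![0, 1; 1, 0] (by
      ext i j; fin_cases i <;> fin_cases j <;> simp [Matrix.mul_apply])
    refine ⟨hH.eigenvectorUnitary * S, hH.eigenvalues ∘ Equiv.swap 0 1, by simpa using hle, ?_⟩
    refine h.trans ?_
    have hS : (S : Matrix (Fin 2) (Fin 2) ℂ) *
        Matrix.diagonal (fun i => (((hH.eigenvalues ∘ Equiv.swap 0 1) i : ℝ) : ℂ)) *
        (S : Matrix (Fin 2) (Fin 2) ℂ)ᴴ =
        Matrix.diagonal (fun i => ((hH.eigenvalues i : ℝ) : ℂ)) := by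
      ext i j
      fin_cases i <;> fin_cases j <;>
        simp [S, Matrix.mul_apply, Matrix.vecMul_diagonal, Fin.sum_univ_two]
    rw [Submonoid.coe_mul, Matrix.conjTranspose_mul]
    calc _ = (hH.eigenvectorUnitary : Matrix (Fin 2) (Fin 2) ℂ) *
          Matrix.diagonal (fun i => ((hH.eigenvalues i : ℝ) : ℂ)) *
          (hH.eigenvectorUnitary : Matrix (Fin 2) (Fin 2) ℂ)ᴴ := rfl
      _ = _ := by rw [← hS]; simp only [Matrix.mul_assoc]

/-- If μ + ν = 1 then 1 - 4μν = (μ - ν)², so the concurrence determines the larger Schmidt weight.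
-/
lemma schmidtOfConcurrence_eq {μ ν : ℝ} (h : μ + ν = 1) (hle : ν ≤ μ) {c : ℝ}
    (hc : c ^ 2 = 4 * (μ * ν)) : schmidtOfConcurrence c = μ := by
  have : 1 - c ^ 2 = (μ - ν) ^ 2 := by rw [hc]; linear_combination (-(μ + ν) - 1) * h
  rw [schmidtOfConcurrence, this, Real.sqrt_sq (by linarith)]
  linarith

/-- Schmidt decomposition of a normalised two-qubit vector with nonzero concurrence. -/
lemma exists_schmidt_decomposition (M : Matrix (Fin 2) (Fin 2) ℂ) (htr : (Mᴴ * M).trace = 1)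
    (hdet : M.det ≠ 0) :
    ∃ U V : QubitBasis, M = (U : Matrix (Fin 2) (Fin 2) ℂ) *
      schmidtMat (schmidtOfConcurrence (2 * ‖M.det‖)) * (V : Matrix (Fin 2) (Fin 2) ℂ)ᵀ := by
  obtain ⟨W, μ, hle, hM⟩ := exists_ordered_spectral_decomposition
    (Matrix.isHermitian_conjTranspose_mul_self M)
  set w := (W : Matrix (Fin 2) (Fin 2) ℂ) with hw
  have hww : wᴴ * w = 1 := W.conjTranspose_mul
  have hww' : w * wᴴ = 1 := W.mul_conjTranspose
  have hsum : μ 0 + μ 1 = 1 := by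
    have : (Mᴴ * M).trace = ((μ 0 + μ 1 : ℝ) : ℂ) := by
      rw [hM, Matrix.trace_mul_comm, ← Matrix.mul_assoc, hww, one_mul, Matrix.trace_diagonal,
        Fin.sum_univ_two]
      push_cast; rfl
    rw [htr] at this
    exact_mod_cast this.symm
  have hprod : ‖M.det‖ ^ 2 = μ 0 * μ 1 := by
    have : (Mᴴ * M).det = ((μ 0 * μ 1 : ℝ) : ℂ) := by
      rw [hM, Matrix.det_mul_comm, ← Matrix.mul_assoc, hww, one_mul, Matrix.det_diagonal,
        Fin.prod_univ_two]
      push_cast; rfl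
    rw [Matrix.det_mul, Matrix.det_conjTranspose, Complex.star_def,
      Complex.conj_mul'] at this
    exact_mod_cast this
  -- The nonzero determinant makes both eigenvalues positive, so that the diagonal matrix of their
  -- square roots can be inverted below.
  have hpos : 0 < μ 0 * μ 1 := by
    rw [← hprod]; positivity
  have h0 : 0 < μ 0 := by linarith
  have h1 : 0 < μ 1 := (pos_iff_pos_of_mul_pos hpos).mp h0
  have hα : schmidtOfConcurrence (2 * ‖M.det‖) = μ 0 :=
    schmidtOfConcurrence_eq hsum hle (by rw [mul_pow, hprod]; ring)
  have hα' : 1 - μ 0 = μ 1 := by linarith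
  have hi : ∀ i, (Real.sqrt (μ i) : ℂ) ≠ 0 := by
    intro i
    fin_cases i
    · exact_mod_cast (Real.sqrt_pos.mpr h0).ne'
    · exact_mod_cast (Real.sqrt_pos.mpr h1).ne'
  have hsq : ∀ i, (Real.sqrt (μ i) : ℂ) * (Real.sqrt (μ i) : ℂ) = (μ i : ℂ) := by
    intro i
    rw [← Complex.ofReal_mul, Real.mul_self_sqrt]
    fin_cases i
    exacts [h0.le, h1.le]
  let D : Matrix (Fin 2) (Fin 2) ℂ := Matrix.diagonal fun i => (Real.sqrt (μ i) : ℂ)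
  let D' : Matrix (Fin 2) (Fin 2) ℂ := Matrix.diagonal fun i => (Real.sqrt (μ i) : ℂ)⁻¹
  have hD : schmidtMat (schmidtOfConcurrence (2 * ‖M.det‖)) = D := by
    rw [hα, schmidtMat, hα']
    congr 1
    funext i
    fin_cases i <;> rfl
  have hD'D : D' * D = 1 := by
    simp only [D, D', Matrix.diagonal_mul_diagonal, ← Matrix.diagonal_one]
    congr 1; funext i; exact inv_mul_cancel₀ (hi i)
  have hD'D' : D'ᴴ * (Matrix.diagonal fun i => (μ i : ℂ)) * D' = 1 := by
    simp only [D', Matrix.diagonal_conjTranspose, Matrix.diagonal_mul_diagonal,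
      ← Matrix.diagonal_one]
    congr 1; funext i
    have := hi i
    rw [← hsq]
    simp only [Pi.star_apply, star_inv₀, Complex.star_def, Complex.conj_ofReal]
    field_simp
  -- Polar decomposition: M times the inverse square root of Mᴴ M is an isometry, here written in
  -- the eigenbasis.
  have hQ : (M * w * D')ᴴ * (M * w * D') = 1 := by
    calc _ = D'ᴴ * (wᴴ * (Mᴴ * M) * w) * D' := by
          simp only [Matrix.conjTranspose_mul, Matrix.mul_assoc]
      _ = D'ᴴ * ((wᴴ * w) * (Matrix.diagonal fun i => (μ i : ℂ)) * (wᴴ * w)) * D' := by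
          rw [hM]; simp only [Matrix.mul_assoc]
      _ = 1 := by rw [hww, one_mul, mul_one, hD'D']
  refine ⟨QubitBasis.ofIsometry _ hQ, W.conj, ?_⟩
  rw [hD]
  calc M = M * w * (D' * D) * wᴴ := by rw [hD'D, mul_one, Matrix.mul_assoc, hww', mul_one]
    _ = M * w * D' * D * wᴴ := by simp only [Matrix.mul_assoc]
    _ = _ := rfl

end Schmidt

/-! ### Concurrence and Schmidt weight determine each other -/

section Concurrence

lemma concurrence_pos {α : ℝ} (h : α ∈ Set.Ico (1 / 2 : ℝ) 1) : 0 < concurrence α :=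
  mul_pos two_pos (Real.sqrt_pos.mpr (mul_pos (by linarith [h.1]) (by linarith [h.2])))

lemma concurrence_sq {α : ℝ} (h : α ∈ Set.Ico (1 / 2 : ℝ) 1) :
    concurrence α ^ 2 = 4 * (α * (1 - α)) := by
  rw [concurrence, mul_pow, Real.sq_sqrt (mul_nonneg (by linarith [h.1]) (by linarith [h.2]))]
  ring

lemma concurrence_le_one {α : ℝ} (h : α ∈ Set.Ico (1 / 2 : ℝ) 1) : concurrence α ≤ 1 := by
  refine (sq_le_one_iff₀ (concurrence_pos h).le).mp ?_
  rw [concurrence_sq h]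
  nlinarith [sq_nonneg (2 * α - 1)]

lemma schmidtOfConcurrence_concurrence {α : ℝ} (h : α ∈ Set.Ico (1 / 2 : ℝ) 1) :
    schmidtOfConcurrence (concurrence α) = α :=
  schmidtOfConcurrence_eq (by ring) (by linarith [h.1]) (concurrence_sq h)

lemma schmidtOfConcurrence_mem {c : ℝ} (h0 : 0 < c) :
    schmidtOfConcurrence c ∈ Set.Ico (1 / 2 : ℝ) 1 := by
  have h : Real.sqrt (1 - c ^ 2) < 1 := by
    rw [Real.sqrt_lt' one_pos]; nlinarith
  have := Real.sqrt_nonneg (1 - c ^ 2)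
  constructor <;> simp only [schmidtOfConcurrence] <;> linarith

lemma concurrence_schmidtOfConcurrence {c : ℝ} (h0 : 0 < c) (h1 : c ≤ 1) :
    concurrence (schmidtOfConcurrence c) = c := by
  refine (sq_eq_sq₀ (concurrence_pos (schmidtOfConcurrence_mem h0)).le h0.le).mp ?_
  rw [concurrence_sq (schmidtOfConcurrence_mem h0), schmidtOfConcurrence]
  have : Real.sqrt (1 - c ^ 2) ^ 2 = 1 - c ^ 2 := Real.sq_sqrt (by nlinarith)
  linear_combination -this

lemma prod_concurrence_mem {κ : Type*} (S : Finset κ) (α : κ → ℝ)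
    (h : ∀ s ∈ S, α s ∈ Set.Ico (1 / 2 : ℝ) 1) :
    0 < ∏ s ∈ S, concurrence (α s) ∧ ∏ s ∈ S, concurrence (α s) ≤ 1 :=
  ⟨Finset.prod_pos fun s hs => concurrence_pos (h s hs),
    Finset.prod_le_one (fun s hs => (concurrence_pos (h s hs)).le)
      fun s hs => concurrence_le_one (h s hs)⟩

end Concurrence

/-! ### Amplitude matrices and the measurement that swaps deterministically -/

section Amplitudes

/-- The amplitudes `c` of two qubits as a matrix. -/
def ampMat (c : Fin 2 × Fin 2 → ℂ) : Matrix (Fin 2) (Fin 2) ℂ := Matrix.of fun i j => c (i, j)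

/-- The two-qubit vector with the matrix of amplitudes `M`. -/
def matVec (M : Matrix (Fin 2) (Fin 2) ℂ) : Fin 2 × Fin 2 → ℂ := fun q => M q.1 q.2

@[simp] lemma ampMat_matVec (M : Matrix (Fin 2) (Fin 2) ℂ) : ampMat (matVec M) = M := rfl

@[simp] lemma matVec_ampMat (c : Fin 2 × Fin 2 → ℂ) : matVec (ampMat c) = c := rfl

lemma ampMat_apply (c : Fin 2 × Fin 2 → ℂ) (i j : Fin 2) : ampMat c i j = c (i, j) := rfl

lemma ampMat_inBasis (U V : QubitBasis) (c : Fin 2 × Fin 2 → ℂ) :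
    ampMat (inBasis U V c) = (U : Matrix (Fin 2) (Fin 2) ℂ) * ampMat c *
      (V : Matrix (Fin 2) (Fin 2) ℂ)ᵀ := by
  ext i j
  simp only [ampMat, inBasis, Matrix.mulVec, dotProduct, Matrix.of_apply, Matrix.mul_apply,
    Fintype.sum_prod_type, Matrix.kroneckerMap_apply, Fin.sum_univ_two, Matrix.transpose_apply]
  ring

lemma ampMat_schmidtVec (α : ℝ) : ampMat (schmidtVec α) = schmidtMat α := by
  ext i j
  fin_cases i <;> fin_cases j <;> simp [ampMat, schmidtVec, schmidtMat]

lemma ampMat_map_star_inBasis (U V : QubitBasis) (c : Fin 2 × Fin 2 → ℂ) :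
    (ampMat (inBasis U V c)).map star = (U : Matrix (Fin 2) (Fin 2) ℂ).map star *
      (ampMat c).map star * (V : Matrix (Fin 2) (Fin 2) ℂ)ᴴ := by
  rw [ampMat_inBasis]
  ext i j
  simp [Matrix.mul_apply]

lemma sum_rankOne_inBasis {h : Fin 4 → Fin 2 × Fin 2 → ℂ} (hh : ∑ i, rankOne (h i) = 1)
    (U V : QubitBasis) : ∑ i, rankOne (inBasis U V (h i)) = 1 := by
  have hW : ((U : Matrix (Fin 2) (Fin 2) ℂ) ⊗ₖ (V : Matrix (Fin 2) (Fin 2) ℂ)) *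
      ((U : Matrix (Fin 2) (Fin 2) ℂ) ⊗ₖ (V : Matrix (Fin 2) (Fin 2) ℂ))ᴴ = 1 :=
    mul_eq_one_comm.mp (kronecker_isometry U.conjTranspose_mul V.conjTranspose_mul)
  calc _ = ((U : Matrix (Fin 2) (Fin 2) ℂ) ⊗ₖ (V : Matrix (Fin 2) (Fin 2) ℂ)) *
        (∑ i, rankOne (h i)) *
        ((U : Matrix (Fin 2) (Fin 2) ℂ) ⊗ₖ (V : Matrix (Fin 2) (Fin 2) ℂ))ᴴ := by
        simp only [Matrix.mul_sum, Matrix.sum_mul, sandwich_rankOne, inBasis]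
    _ = 1 := by rw [hh, mul_one, hW]

/-- Four maximally entangled vectors, pairwise orthogonal, whose amplitudes all have the same
absolute value in the computational basis. -/
def hadamardVec : Fin 4 → Fin 2 × Fin 2 → ℂ :=
  ![matVec ((1 / 2 : ℂ) • !![1, 1; 1, -1]), matVec ((1 / 2 : ℂ) • !![1, 1; -1, 1]),
    matVec ((1 / 2 : ℂ) • !![1, -1; 1, 1]), matVec ((1 / 2 : ℂ) • !![-1, 1; 1, 1])]

lemma sum_rankOne_hadamardVec : ∑ i, rankOne (hadamardVec i) = 1 := by
  ext ⟨a, b⟩ ⟨c, d⟩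
  simp only [Matrix.sum_apply, rankOne, Matrix.vecMulVec_apply, Fin.sum_univ_four, hadamardVec]
  fin_cases a <;> fin_cases b <;> fin_cases c <;> fin_cases d <;>
    simp [matVec] <;> norm_num

lemma ampMat_hadamardVec_map_star (i : Fin 4) :
    (ampMat (hadamardVec i)).map star = ampMat (hadamardVec i) := by
  ext a b
  fin_cases i <;> fin_cases a <;> fin_cases b <;>
    simp [hadamardVec, matVec, ampMat, Complex.conj_ofNat]

lemma sum_rankOne_bellVec : ∑ i, rankOne (bellVec i) = 1 := by
  have h2 : ((Real.sqrt 2 : ℝ) : ℂ)⁻¹ * ((Real.sqrt 2 : ℝ) : ℂ)⁻¹ = 1 / 2 := by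
    rw [← mul_inv, ← Complex.ofReal_mul, Real.mul_self_sqrt (by norm_num)]; norm_num
  ext ⟨a, b⟩ ⟨c, d⟩
  simp only [Matrix.sum_apply, rankOne, Matrix.vecMulVec_apply, Fin.sum_univ_four, bellVec]
  fin_cases a <;> fin_cases b <;> fin_cases c <;> fin_cases d <;>
    simp [h2] <;> norm_num

/-- A vector with Schmidt coefficients `√α, √(1 - α)`. -/
def HasSchmidt (A : Matrix (Fin 2) (Fin 2) ℂ) (α : ℝ) : Prop :=
  ∃ U V : QubitBasis, A = (U : Matrix (Fin 2) (Fin 2) ℂ) * schmidtMat α *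
    (V : Matrix (Fin 2) (Fin 2) ℂ)ᵀ

lemma hasSchmidt_inBasis (α : ℝ) (U V : QubitBasis) :
    HasSchmidt (ampMat (inBasis U V (schmidtVec α))) α :=
  ⟨U, V, by rw [ampMat_inBasis, ampMat_schmidtVec]⟩

lemma hasSchmidt_schmidtMat (α : ℝ) : HasSchmidt (schmidtMat α) α := ⟨1, 1, by simp⟩

/-- Concurrence is twice the modulus of the determinant, which is why it is multiplicative under
swapping. -/
lemma norm_det_schmidtMat {α : ℝ} (h : α ∈ Set.Ico (1 / 2 : ℝ) 1) :
    2 * ‖(schmidtMat α).det‖ = concurrence α := by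
  rw [schmidtMat, Matrix.det_diagonal, Fin.prod_univ_two, concurrence,
    Real.sqrt_mul (by linarith [h.1])]
  simp [abs_of_nonneg, Real.sqrt_nonneg]

/-- After a suitable measurement of a node that shares pure states with its neighbours, for every
outcome the neighbours share a pure state whose concurrence is the product of the two. -/
lemma exists_swap_basis {A B : Matrix (Fin 2) (Fin 2) ℂ} {α β : ℝ}
    (hα : α ∈ Set.Ico (1 / 2 : ℝ) 1) (hβ : β ∈ Set.Ico (1 / 2 : ℝ) 1)
    (hA : HasSchmidt A α) (hB : HasSchmidt B β) :
    ∃ f : Fin 4 → Fin 2 × Fin 2 → ℂ, ∑ i, rankOne (f i) = 1 ∧ ∀ i,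
      HasSchmidt ((2 : ℂ) • (A * (ampMat (f i)).map star * B))
        (schmidtOfConcurrence (concurrence α * concurrence β)) := by
  obtain ⟨U, V, rfl⟩ := hA
  obtain ⟨W, Z, rfl⟩ := hB
  refine ⟨fun i => inBasis V W (hadamardVec i), sum_rankOne_inBasis sum_rankOne_hadamardVec V W,
    fun i => ?_⟩
  set H := ampMat (hadamardVec i) with hH
  have hdetH : ‖H.det‖ = 1 / 2 := by
    rw [hH]
    fin_cases i <;>
      simp [hadamardVec, Matrix.det_fin_two] <;> norm_num
  -- All entries of H have modulus 1/2, so X is normalised for every outcome. The factor 2 reflects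
  -- that each outcome has probability 1/4.
  set X := (2 : ℂ) • (schmidtMat α * H * schmidtMat β) with hX
  have hX' : (2 : ℂ) • ((U : Matrix (Fin 2) (Fin 2) ℂ) * schmidtMat α *
      (V : Matrix (Fin 2) (Fin 2) ℂ)ᵀ * (ampMat (inBasis V W (hadamardVec i))).map star *
      ((W : Matrix (Fin 2) (Fin 2) ℂ) * schmidtMat β * (Z : Matrix (Fin 2) (Fin 2) ℂ)ᵀ)) =
      (U : Matrix (Fin 2) (Fin 2) ℂ) * X * (Z : Matrix (Fin 2) (Fin 2) ℂ)ᵀ := by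
    rw [ampMat_map_star_inBasis, ampMat_hadamardVec_map_star, hX, Matrix.mul_smul, Matrix.smul_mul]
    congr 1
    calc _ = (U : Matrix (Fin 2) (Fin 2) ℂ) * schmidtMat α *
        ((V : Matrix (Fin 2) (Fin 2) ℂ)ᵀ * (V : Matrix (Fin 2) (Fin 2) ℂ).map star) * H *
        ((W : Matrix (Fin 2) (Fin 2) ℂ)ᴴ * (W : Matrix (Fin 2) (Fin 2) ℂ)) * schmidtMat β *
        (Z : Matrix (Fin 2) (Fin 2) ℂ)ᵀ := by simp only [Matrix.mul_assoc, hH]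
      _ = _ := by
        rw [V.transpose_mul_map_star, W.conjTranspose_mul]
        simp only [Matrix.mul_assoc, mul_one]
  -- Determinants multiply: 2² from the scalar and 1/2 from H leave 2 |det| of each Schmidt matrix.
  -- The value does not depend on the outcome.
  have hdet : 2 * ‖X.det‖ = concurrence α * concurrence β := by
    rw [← norm_det_schmidtMat hα, ← norm_det_schmidtMat hβ, hX, Matrix.det_smul]
    simp only [Matrix.det_mul, norm_mul, hdetH, norm_pow, Fintype.card_fin]
    norm_num
    ring
  have htr : (Xᴴ * X).trace = 1 := by
    have key : ∀ γ : ℝ, γ ∈ Set.Ico (1 / 2 : ℝ) 1 → ((Real.sqrt γ : ℝ) : ℂ) ^ 2 = γ ∧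
        ((Real.sqrt (1 - γ) : ℝ) : ℂ) ^ 2 = 1 - γ := by
      intro γ hγ
      constructor
      · rw [← Complex.ofReal_pow, Real.sq_sqrt (by linarith [hγ.1])]
      · rw [← Complex.ofReal_pow, Real.sq_sqrt (by linarith [hγ.2])]; push_cast; rfl
    obtain ⟨a0, a1⟩ := key α hα
    obtain ⟨b0, b1⟩ := key β hβ
    rw [hX, hH]
    fin_cases i <;>
    · simp [Matrix.trace_fin_two, Matrix.mul_apply, Fin.sum_univ_two, hadamardVec, schmidtMat,
        matVec, ampMat, Complex.conj_ofNat]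
      ring_nf
      rw [a0, a1, b0, b1]
      ring
  obtain ⟨U', Z', h⟩ := exists_schmidt_decomposition X htr (by
    rw [← norm_ne_zero_iff]
    have := mul_pos (concurrence_pos hα) (concurrence_pos hβ)
    intro h0
    rw [h0] at hdet
    linarith)
  rw [hdet] at h
  refine ⟨U * U', Z * Z', ?_⟩
  rw [hX', h, Submonoid.coe_mul, Submonoid.coe_mul, Matrix.transpose_mul]
  simp only [Matrix.mul_assoc]

end Amplitudes

/-! ### Entanglement swapping at one node -/

section Merge

variable {n : ℕ}

/-- A shared vector with amplitudes `M` of the qubits `a` and `b`. -/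
def link (a b : Slot n) (M : Matrix (Fin 2) (Fin 2) ℂ) : (Slot n → Fin 2) → ℂ :=
  fun β => M (β a) (β b)

/-- The qubit `t` is in the state `|0⟩`. -/
def zeroAt (t : Slot n) : (Slot n → Fin 2) → ℂ := fun β => if β t = 0 then 1 else 0

/-- The function `R` does not depend on the bit of the qubit `t`. -/
def IndepOf (t : Slot n) (R : (Slot n → Fin 2) → ℂ) : Prop :=
  ∀ β c, R (Function.update β t c) = R β

lemma IndepOf.mul {t : Slot n} {R R' : (Slot n → Fin 2) → ℂ} (h : IndepOf t R)
    (h' : IndepOf t R') : IndepOf t (R * R') := fun β c => by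
  simp [h β c, h' β c]

lemma IndepOf.prod {κ : Type*} {S : Finset κ} {t : Slot n} {R : κ → (Slot n → Fin 2) → ℂ}
    (h : ∀ s ∈ S, IndepOf t (R s)) : IndepOf t (∏ s ∈ S, R s) := fun β c => by
  rw [Finset.prod_apply, Finset.prod_apply]
  exact Finset.prod_congr rfl fun s hs => h s hs β c

lemma indepOf_link {a b t : Slot n} (ha : t ≠ a) (hb : t ≠ b) (M : Matrix (Fin 2) (Fin 2) ℂ) :
    IndepOf t (link a b M) := fun β c => by
  simp [link, Function.update_of_ne ha.symm, Function.update_of_ne hb.symm]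

lemma indepOf_zeroAt {a t : Slot n} (ha : t ≠ a) : IndepOf t (zeroAt a) := fun β c => by
  simp [zeroAt, Function.update_of_ne ha.symm]

lemma slotOp_left {a b : Slot n} (hab : a ≠ b) (U M : Matrix (Fin 2) (Fin 2) ℂ)
    {R : (Slot n → Fin 2) → ℂ} (hR : IndepOf a R) :
    slotOp a U (link a b M * R) = link a b (U * M) * R := by
  funext β
  simp [slotOp, link, Function.update_of_ne hab.symm, hR β, Matrix.mul_apply]
  ring

lemma slotOp_right {a b : Slot n} (hab : a ≠ b) (V M : Matrix (Fin 2) (Fin 2) ℂ)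
    {R : (Slot n → Fin 2) → ℂ} (hR : IndepOf b R) :
    slotOp b V (link a b M * R) = link a b (M * Vᵀ) * R := by
  funext β
  simp only [slotOp, link, Pi.mul_apply, Function.update_of_ne hab, hR β, Matrix.mul_apply,
    Finset.sum_mul, Function.update_self, Matrix.transpose_apply]
  exact Finset.sum_congr rfl fun _ _ => by ring

lemma link_smul (a b : Slot n) (c : ℂ) (M : Matrix (Fin 2) (Fin 2) ℂ)
    (R : (Slot n → Fin 2) → ℂ) : link a b (c • M) * R = c • (link a b M * R) := by
  funext β
  simp [link, mul_assoc]

/-- Projecting a node contracts the two amplitude matrices meeting there, with the conjugated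
amplitudes of f in between. Swapping thus becomes matrix multiplication, and R collects the qubits
that take no part. -/
lemma nodeOp_link (k : Fin n) (f : Fin 2 × Fin 2 → ℂ) {a b : Slot n}
    (ha : a ≠ (k.castSucc, true)) (ha' : a ≠ (k.succ, false)) (hb : b ≠ (k.castSucc, true))
    (hb' : b ≠ (k.succ, false)) (A B : Matrix (Fin 2) (Fin 2) ℂ) {R : (Slot n → Fin 2) → ℂ}
    (hR : IndepOf (k.castSucc, true) R) (hR' : IndepOf (k.succ, false) R) :
    nodeOp k f (link a (k.castSucc, true) A * (link (k.succ, false) b B * R)) =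
      link a b (A * (ampMat f).map star * B) *
        (zeroAt (k.castSucc, true) * (zeroAt (k.succ, false) * R)) := by
  funext β
  have h12 : ((k.castSucc, true) : Slot n) ≠ (k.succ, false) := by simp
  simp only [nodeOp, zeroAt, link, Pi.mul_apply]
  by_cases h1 : β (k.castSucc, true) = 0
  · by_cases h2 : β (k.succ, false) = 0
    · simp only [h1, h2, and_self, if_true, Function.update_of_ne ha', Function.update_of_ne ha,
        Function.update_of_ne hb, Function.update_of_ne hb', Function.update_self,
        Function.update_of_ne h12, hR' _, hR β, Matrix.mul_apply, Matrix.map_apply, one_mul,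
        Fintype.sum_prod_type, ampMat_apply, Fin.sum_univ_two]
      ring
    · simp [h2]
  · simp [h1]

/-- Local unitaries bring a shared pure state into its Schmidt form. -/
lemma exists_isLOCC_schmidt {a b : Slot n} (hab : a ≠ b) {A : Matrix (Fin 2) (Fin 2) ℂ} {α : ℝ}
    (hA : HasSchmidt A α) :
    ∃ Λ : Op (chainDims n) → Op (chainDims n), IsLOCC Λ ∧ ∀ R, IndepOf a R → IndepOf b R →
      Λ (slotState (link a b A * R)) = slotState (link a b (schmidtMat α) * R) := by
  obtain ⟨U, V, rfl⟩ := hA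
  obtain ⟨Λ₁, h₁, h₁'⟩ := exists_isLOCC_slotOp a (U : Matrix (Fin 2) (Fin 2) ℂ)ᴴ (by
    rw [Matrix.conjTranspose_conjTranspose]; exact U.mul_conjTranspose)
  obtain ⟨Λ₂, h₂, h₂'⟩ := exists_isLOCC_slotOp b (V : Matrix (Fin 2) (Fin 2) ℂ)ᴴ (by
    rw [Matrix.conjTranspose_conjTranspose]; exact V.mul_conjTranspose)
  refine ⟨_, h₁.comp h₂, fun R ha hb => ?_⟩
  rw [h₁', slotOp_left hab _ _ ha, h₂', slotOp_right hab _ _ hb]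
  congr 3
  have hV : (V : Matrix (Fin 2) (Fin 2) ℂ)ᵀ * ((V : Matrix (Fin 2) (Fin 2) ℂ)ᴴ)ᵀ = 1 := by
    rw [← Matrix.transpose_mul, V.conjTranspose_mul, Matrix.transpose_one]
  calc _ = ((U : Matrix (Fin 2) (Fin 2) ℂ)ᴴ * (U : Matrix (Fin 2) (Fin 2) ℂ)) * schmidtMat α *
      ((V : Matrix (Fin 2) (Fin 2) ℂ)ᵀ * ((V : Matrix (Fin 2) (Fin 2) ℂ)ᴴ)ᵀ) := by
        simp only [Matrix.mul_assoc]
    _ = _ := by rw [hV, U.conjTranspose_mul, one_mul, mul_one]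

lemma orthonormal_of_sum_rankOne {f : Fin 4 → Fin 2 × Fin 2 → ℂ} (hf : ∑ i, rankOne (f i) = 1)
    (q q' : Fin 2 × Fin 2) : ∑ i, f i q * star (f i q') = if q = q' then 1 else 0 := by
  have := congrFun (congrFun hf q) q'
  simpa [Matrix.sum_apply, rankOne, Matrix.vecMulVec_apply, Matrix.one_apply] using this

/-- Deterministic entanglement swapping: the node `k`, which shares pure states with the holders of
the qubits `a` and `b`, lets them share a pure state whose concurrence is the product. -/
lemma exists_isLOCC_swap (k : Fin n) {a b : Slot n} (hab : a ≠ b)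
    (ha : a ≠ (k.castSucc, true)) (ha' : a ≠ (k.succ, false)) (hb : b ≠ (k.castSucc, true))
    (hb' : b ≠ (k.succ, false)) {A B : Matrix (Fin 2) (Fin 2) ℂ} {α β : ℝ}
    (hα : α ∈ Set.Ico (1 / 2 : ℝ) 1) (hβ : β ∈ Set.Ico (1 / 2 : ℝ) 1)
    (hA : HasSchmidt A α) (hB : HasSchmidt B β) :
    ∃ Λ : Op (chainDims n) → Op (chainDims n), IsLOCC Λ ∧ ∀ R, IndepOf a R → IndepOf b R →
      IndepOf (k.castSucc, true) R → IndepOf (k.succ, false) R →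
      Λ (slotState (link a (k.castSucc, true) A * (link (k.succ, false) b B * R))) =
        slotState (link a b (schmidtMat (schmidtOfConcurrence (concurrence α * concurrence β))) *
          (zeroAt (k.castSucc, true) * (zeroAt (k.succ, false) * R))) := by
  obtain ⟨f, hf, hf'⟩ := exists_swap_basis hα hβ hA hB
  choose Λ hΛ hΛ' using fun i => exists_isLOCC_schmidt hab (hf' i)
  obtain ⟨Λ', h, h'⟩ := exists_isLOCC_nodeOp k f (orthonormal_of_sum_rankOne hf) Λ hΛ
  refine ⟨Λ', h, fun R hRa hRb hR hR' => ?_⟩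
  set R' := zeroAt (k.castSucc, true) * (zeroAt (k.succ, false) * R) with hR'_def
  have hR'a : IndepOf a R' := (indepOf_zeroAt ha).mul ((indepOf_zeroAt ha').mul hRa)
  have hR'b : IndepOf b R' := (indepOf_zeroAt hb).mul ((indepOf_zeroAt hb').mul hRb)
  rw [h']
  have key : ∀ i, Λ i (slotState (nodeOp k (f i) (link a (k.castSucc, true) A *
      (link (k.succ, false) b B * R)))) = (1 / 4 : ℂ) • slotState (link a b
        (schmidtMat (schmidtOfConcurrence (concurrence α * concurrence β))) * R') := by
    intro i
    obtain ⟨L, hL⟩ := (hΛ i).exists_linear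
    -- Relative to the normalised vector the amplitude is 1/2, giving weight 1/4. The four outcomes,
    -- corrected to the same vector, add up to weight one.
    have hs : A * (ampMat (f i)).map star * B =
        (1 / 2 : ℂ) • ((2 : ℂ) • (A * (ampMat (f i)).map star * B)) := by
      rw [smul_smul]; norm_num
    rw [nodeOp_link k (f i) ha ha' hb hb' A B hR hR', ← hR'_def, hs, link_smul, slotState_smul, hL,
      map_smul, ← hL, hΛ' i R' hR'a hR'b]
    norm_num
  rw [Finset.sum_congr rfl fun i _ => key i, Finset.sum_const, Finset.card_univ, Fintype.card_fin,
    ← Nat.cast_smul_eq_nsmul ℂ, smul_smul]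
  norm_num

end Merge

/-! ### Shortening the side chains -/

section Concatenation

variable {n : ℕ}

/-- The qubits of the segments `a, …, b` other than the two outer ones. -/
def innerSlots (a b : Fin (n + 1)) : Finset (Slot n) :=
  Finset.univ.filter fun t => if t.2 then a ≤ t.1 ∧ t.1 < b else a < t.1 ∧ t.1 ≤ b

lemma mem_innerSlots_true {a b s : Fin (n + 1)} :
    ((s, true) : Slot n) ∈ innerSlots a b ↔ a ≤ s ∧ s < b := by
  simp [innerSlots]

lemma mem_innerSlots_false {a b s : Fin (n + 1)} :
    ((s, false) : Slot n) ∈ innerSlots a b ↔ a < s ∧ s ≤ b := by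
  simp [innerSlots]

lemma innerSlots_self (a : Fin (n + 1)) : innerSlots a a = ∅ := by
  ext ⟨s, b⟩
  cases b
  · simp [mem_innerSlots_false]
  · simp [mem_innerSlots_true]

lemma innerSlots_succ {a : Fin (n + 1)} {k : Fin n} (h : a ≤ k.castSucc) :
    innerSlots a k.succ =
      insert (k.castSucc, true) (insert (k.succ, false) (innerSlots a k.castSucc)) := by
  ext ⟨s, b⟩
  cases b <;>
    simp only [mem_innerSlots_false, mem_innerSlots_true, Finset.mem_insert, Prod.mk.injEq,
      Fin.ext_iff, Fin.lt_def, Fin.le_def, Fin.val_succ, Fin.val_castSucc] at h ⊢ <;> grind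

lemma prod_innerSlots_succ {a : Fin (n + 1)} {k : Fin n} (h : a ≤ k.castSucc) :
    ∏ t ∈ innerSlots a k.succ, zeroAt t = zeroAt (k.castSucc, true) *
      (zeroAt (k.succ, false) * ∏ t ∈ innerSlots a k.castSucc, zeroAt t) := by
  rw [innerSlots_succ h, Finset.prod_insert, Finset.prod_insert]
  · simp [mem_innerSlots_false, Fin.le_def]
  · simp [mem_innerSlots_true]

lemma mem_Icc_of_mem_innerSlots {a b : Fin (n + 1)} {t : Slot n} (h : t ∈ innerSlots a b) :
    t.1 ∈ Finset.Icc a b := by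
  obtain ⟨s, c⟩ := t
  cases c
  · rw [mem_innerSlots_false] at h
    exact Finset.mem_Icc.mpr ⟨h.1.le, h.2⟩
  · rw [mem_innerSlots_true] at h
    exact Finset.mem_Icc.mpr ⟨h.1, h.2.le⟩

lemma indepOf_prod_zeroAt {a b : Fin (n + 1)} {t : Slot n} (h : t ∉ innerSlots a b) :
    IndepOf t (∏ t ∈ innerSlots a b, zeroAt t) :=
  IndepOf.prod fun _ hs => indepOf_zeroAt fun h' => h (h' ▸ hs)

lemma Icc_castSucc_succ {a : Fin (n + 1)} {k : Fin n} (h : a ≤ k.castSucc) :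
    Finset.Icc a k.succ = insert k.succ (Finset.Icc a k.castSucc) := by
  ext s
  simp only [Finset.mem_Icc, Finset.mem_insert, Fin.ext_iff, Fin.le_def, Fin.val_succ,
    Fin.val_castSucc] at h ⊢
  omega

/-- The segments `a, …, b` in pure states are converted into one pure state between the outer
qubits, whose concurrence is the product of the concurrences. -/
lemma exists_isLOCC_concatenate (a : Fin (n + 1)) (A : Fin (n + 1) → Matrix (Fin 2) (Fin 2) ℂ)
    (α : Fin (n + 1) → ℝ) (b : Fin (n + 1)) : a ≤ b →
    (∀ s ∈ Finset.Icc a b, α s ∈ Set.Ico (1 / 2 : ℝ) 1 ∧ HasSchmidt (A s) (α s)) →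
    ∃ Λ : Op (chainDims n) → Op (chainDims n), IsLOCC Λ ∧ ∀ G,
      (∀ t : Slot n, t.1 ∈ Finset.Icc a b → IndepOf t G) →
      Λ (slotState (G * ∏ s ∈ Finset.Icc a b, link (s, false) (s, true) (A s))) =
        slotState (link (a, false) (b, true)
          (schmidtMat (schmidtOfConcurrence (∏ s ∈ Finset.Icc a b, concurrence (α s)))) *
          (G * ∏ t ∈ innerSlots a b, zeroAt t)) := by
  -- The case of one segment is needed twice: the induction runs over b with a fixed, so it may
  -- start at b = 0 or at a successor equal to a.
  have base : (∀ s ∈ Finset.Icc a a, α s ∈ Set.Ico (1 / 2 : ℝ) 1 ∧ HasSchmidt (A s) (α s)) →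
      ∃ Λ : Op (chainDims n) → Op (chainDims n), IsLOCC Λ ∧ ∀ G,
      (∀ t : Slot n, t.1 ∈ Finset.Icc a a → IndepOf t G) →
      Λ (slotState (G * ∏ s ∈ Finset.Icc a a, link (s, false) (s, true) (A s))) =
        slotState (link (a, false) (a, true)
          (schmidtMat (schmidtOfConcurrence (∏ s ∈ Finset.Icc a a, concurrence (α s)))) *
          (G * ∏ t ∈ innerSlots a a, zeroAt t)) := by
    intro h
    obtain ⟨hα, hA⟩ := h a (by simp)
    obtain ⟨Λ, hΛ, hΛ'⟩ := exists_isLOCC_schmidt (a := ((a, false) : Slot n)) (b := (a, true))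
      (by simp) hA
    refine ⟨Λ, hΛ, fun G hG => ?_⟩
    rw [Finset.Icc_self, Finset.prod_singleton, Finset.prod_singleton, innerSlots_self,
      Finset.prod_empty, mul_one, schmidtOfConcurrence_concurrence hα, mul_comm,
      hΛ' G (hG _ (by simp)) (hG _ (by simp))]
  induction b using Fin.induction with
  | zero =>
    intro h hA
    obtain rfl : a = 0 := Fin.le_zero_iff.mp h
    exact base hA
  | succ k ih =>
    intro h hA
    rcases h.eq_or_lt with rfl | hlt
    · exact base hA
    have hk : a ≤ k.castSucc := Fin.le_castSucc_iff.mpr hlt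
    have hIcc := Icc_castSucc_succ hk
    have hnot : k.succ ∉ Finset.Icc a k.castSucc := by simp [Fin.le_def]
    obtain ⟨Λ₁, h₁, h₁'⟩ := ih hk fun s hs => hA s (by rw [hIcc]; exact Finset.mem_insert_of_mem hs)
    obtain ⟨hα, hAk⟩ := hA k.succ (by rw [hIcc]; exact Finset.mem_insert_self _ _)
    have hc := prod_concurrence_mem (Finset.Icc a k.castSucc) α
      fun s hs => (hA s (by rw [hIcc]; exact Finset.mem_insert_of_mem hs)).1
    have ha0 : a ≠ k.succ := hlt.ne
    obtain ⟨Λ₂, h₂, h₂'⟩ := exists_isLOCC_swap k (a := (a, false)) (b := (k.succ, true))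
      (by simp) (by simp) (by simpa using ha0) (by simp [Fin.ext_iff]) (by simp)
      (schmidtOfConcurrence_mem hc.1) hα (hasSchmidt_schmidtMat _) hAk
    refine ⟨_, h₁.comp h₂, fun G hG => ?_⟩
    have hG' : ∀ t : Slot n, t.1 ∈ Finset.Icc a k.castSucc → IndepOf t G := fun t ht =>
      hG t (by rw [hIcc]; exact Finset.mem_insert_of_mem ht)
    -- While the earlier segments are merged, the link of the next segment counts as part of the
    -- spectator factor G.
    rw [hIcc, Finset.prod_insert hnot, Finset.prod_insert hnot, prod_innerSlots_succ hk,
      ← mul_assoc, h₁' (G * link (k.succ, false) (k.succ, true) (A k.succ))]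
    · have hR : ∀ t : Slot n, t.1 ∈ Finset.Icc a k.succ → t ∉ innerSlots a k.castSucc →
          IndepOf t (G * ∏ t ∈ innerSlots a k.castSucc, zeroAt t) := fun t ht ht' =>
        (hG t ht).mul (indepOf_prod_zeroAt ht')
      have hsplit : G * link (k.succ, false) (k.succ, true) (A k.succ) *
          ∏ t ∈ innerSlots a k.castSucc, zeroAt t = link (k.succ, false) (k.succ, true) (A k.succ) *
          (G * ∏ t ∈ innerSlots a k.castSucc, zeroAt t) := by ring
      rw [hsplit, h₂' _ (hR _ (by simpa using h) (by simp [mem_innerSlots_false]))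
        (hR _ (by simpa using h) (by simp [mem_innerSlots_true, Fin.lt_def]))
        (hR _ (by simpa [Fin.le_def] using hk) (by simp [mem_innerSlots_true]))
        (hR _ (by simpa using h) (by simp [mem_innerSlots_false, Fin.le_def])),
        concurrence_schmidtOfConcurrence hc.1 hc.2, mul_comm (concurrence (α k.succ))]
      congr 2
      ring
    · intro t ht
      refine (hG' t ht).mul (indepOf_link ?_ ?_ _) <;>
      · rintro rfl
        exact hnot ht

/-- The vector of a chain with segment vectors `w`. -/
lemma chainState_proj (w : Fin (n + 1) → Fin 2 × Fin 2 → ℂ) :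
    chainState (fun s => proj (w s)) =
      slotState (∏ s, link (s, false) (s, true) (ampMat (w s))) := by
  ext x y
  simp [chainState, slotState, rankOne, proj, Matrix.vecMulVec_apply, link, ampMat_apply,
    Finset.prod_mul_distrib, Finset.prod_apply]

/-- The chain state is multilinear in the segments, so a mixed segment can be handled one pure
component at a time. -/
lemma chainState_update_add (σ : Fin (n + 1) → TwoQubit) (m : Fin (n + 1)) (X Y : TwoQubit) :
    chainState (Function.update σ m (X + Y)) =
      chainState (Function.update σ m X) + chainState (Function.update σ m Y) := by
  ext x y
  simp only [chainState, Matrix.of_apply, Matrix.add_apply,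
    ← Finset.mul_prod_erase Finset.univ _ (Finset.mem_univ m), Function.update_self, add_mul]
  congr 2 <;>
  · refine Finset.prod_congr rfl fun s hs => ?_
    simp [Function.update_of_ne (Finset.ne_of_mem_erase hs)]

/-- The vector of a chain in which segment `m`, between the nodes `k` and `l`, is in the state with
amplitudes `W`, its holders share states with amplitudes `A` and `B` with Alice and Bob, and all
other qubits are in the state `|0⟩`. -/
def reducedVec (k l : Fin n) (A W B : Matrix (Fin 2) (Fin 2) ℂ) : (Slot n → Fin 2) → ℂ :=
  link (0, false) (k.castSucc, true) A * (link (k.succ, false) (l.castSucc, true) W *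
    (link (l.succ, false) (Fin.last n, true) B *
      ((∏ t ∈ innerSlots 0 k.castSucc, zeroAt t) *
        ∏ t ∈ innerSlots l.succ (Fin.last n), zeroAt t)))

/-- LOCC reduces a chain to the two-node chain around segment `m`. -/
lemma exists_isLOCC_reduce {m : Fin (n + 1)} {k l : Fin n} (hk : m = k.succ) (hl : m = l.castSucc)
    {α : Fin (n + 1) → ℝ} (hα : ∀ s, s ≠ m → α s ∈ Set.Ico (1 / 2 : ℝ) 1)
    (w : Fin (n + 1) → Fin 2 × Fin 2 → ℂ)
    (hw : ∀ s, s ≠ m → HasSchmidt (ampMat (w s)) (α s)) :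
    ∃ Λ : Op (chainDims n) → Op (chainDims n), IsLOCC Λ ∧ ∀ v,
      Λ (chainState fun s => proj (Function.update w m v s)) =
        slotState (reducedVec k l (schmidtMat (alphaLeft m α)) (ampMat v)
          (schmidtMat (alphaRight m α))) := by
  have hL : Finset.univ.filter (· < m) = Finset.Icc 0 k.castSucc := by
    ext s
    simp only [Finset.mem_filter, Finset.mem_univ, true_and, Finset.mem_Icc, Fin.zero_le, hk,
      Fin.le_castSucc_iff]
  have hR : Finset.univ.filter (m < ·) = Finset.Icc l.succ (Fin.last n) := by
    ext s
    simp only [Finset.mem_filter, Finset.mem_univ, true_and, Finset.mem_Icc, Fin.le_last, hl,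
      and_true, Fin.castSucc_lt_iff_succ_le]
  obtain ⟨Λ₁, h₁, h₁'⟩ := exists_isLOCC_concatenate 0 (fun s => ampMat (w s)) α k.castSucc
    (Fin.zero_le _) fun s hs => by
      rw [← hL] at hs
      have := (Finset.mem_filter.mp hs).2.ne
      exact ⟨hα s this, hw s this⟩
  obtain ⟨Λ₂, h₂, h₂'⟩ := exists_isLOCC_concatenate l.succ (fun s => ampMat (w s)) α (Fin.last n)
    (Fin.le_last _) fun s hs => by
      rw [← hR] at hs
      have := (Finset.mem_filter.mp hs).2.ne'
      exact ⟨hα s this, hw s this⟩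
  -- The protocol is fixed before v, since both components of the mixed segment must undergo the
  -- same map.
  refine ⟨_, h₁.comp h₂, fun v => ?_⟩
  rw [chainState_proj]
  have hsplit : ∏ s, link ((s, false) : Slot n) (s, true) (ampMat (Function.update w m v s)) =
      (link (m, false) (m, true) (ampMat v) *
        ∏ s ∈ Finset.Icc l.succ (Fin.last n), link (s, false) (s, true) (ampMat (w s))) *
        ∏ s ∈ Finset.Icc 0 k.castSucc, link (s, false) (s, true) (ampMat (w s)) := by
    have hne : ∀ s, s ≠ m → link ((s, false) : Slot n) (s, true)
        (ampMat (Function.update w m v s)) = link (s, false) (s, true) (ampMat (w s)) := by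
      intro s hs
      rw [Function.update_of_ne hs]
    have hu : (Finset.univ : Finset (Fin (n + 1))) =
        insert m (Finset.univ.filter (m < ·) ∪ Finset.univ.filter (· < m)) := by
      ext s
      simp only [Finset.mem_univ, Finset.mem_insert, Finset.mem_union, Finset.mem_filter, true_and,
        true_iff]
      rcases lt_trichotomy s m with h | h | h <;> simp [h]
    rw [hu, Finset.prod_insert (by simp), Finset.prod_union, hL, hR, Function.update_self,
      mul_assoc]
    · congr 2
      · exact Finset.prod_congr rfl fun s hs => hne s (by
          rw [← hR] at hs; exact (Finset.mem_filter.mp hs).2.ne')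
      · exact Finset.prod_congr rfl fun s hs => hne s (by
          rw [← hL] at hs; exact (Finset.mem_filter.mp hs).2.ne)
    · rw [Finset.disjoint_filter]
      exact fun s _ h h' => lt_asymm h h'
  have hleft : ∀ t : Slot n, t.1 ∈ Finset.Icc 0 k.castSucc → t.1 < m := fun t ht => by
    rw [← hL] at ht; exact (Finset.mem_filter.mp ht).2
  have hright : ∀ t : Slot n, t.1 ∈ Finset.Icc l.succ (Fin.last n) → m < t.1 := fun t ht => by
    rw [← hR] at ht; exact (Finset.mem_filter.mp ht).2
  rw [hsplit, h₁']
  · set P := schmidtMat (schmidtOfConcurrence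
      (∏ s ∈ Finset.Icc 0 k.castSucc, concurrence (α s))) with hP
    have : link ((0, false) : Slot n) (k.castSucc, true) P * (link (m, false) (m, true) (ampMat v) *
        (∏ s ∈ Finset.Icc l.succ (Fin.last n), link (s, false) (s, true) (ampMat (w s))) *
        ∏ t ∈ innerSlots 0 k.castSucc, zeroAt t) =
        (link (0, false) (k.castSucc, true) P * (link (m, false) (m, true) (ampMat v) *
          ∏ t ∈ innerSlots 0 k.castSucc, zeroAt t)) *
        ∏ s ∈ Finset.Icc l.succ (Fin.last n), link (s, false) (s, true) (ampMat (w s)) := by ring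
    rw [this, h₂']
    · rw [reducedVec, alphaLeft, alphaRight, hL, hR, ← hk, ← hl, ← hP]
      congr 1
      ring
    · intro t ht
      have hmt := hright t ht
      refine (indepOf_link ?_ ?_ _).mul ((indepOf_link ?_ ?_ _).mul (indepOf_prod_zeroAt ?_))
      · rintro rfl; exact absurd hmt (by simp)
      · rintro rfl; exact absurd hmt (by simp [hk, Fin.lt_def])
      · rintro rfl; exact lt_irrefl _ hmt
      · rintro rfl; exact lt_irrefl _ hmt
      · exact fun h => lt_asymm hmt (hleft t (mem_Icc_of_mem_innerSlots h))
  · intro t ht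
    have htm := hleft t ht
    refine (indepOf_link ?_ ?_ _).mul (IndepOf.prod fun s hs => ?_)
    · rintro rfl; exact lt_irrefl _ htm
    · rintro rfl; exact lt_irrefl _ htm
    · have hs' := hright (s, true) hs
      refine indepOf_link ?_ ?_ _ <;>
      · rintro rfl; exact lt_asymm hs' htm

/-- Measurements of the two nodes of a reduced chain. -/
lemma exists_isLOCC_measure_reduced {e : Party n → ℕ} {k l : Fin n} (hkl : k.succ = l.castSucc)
    {f g : Fin 4 → Fin 2 × Fin 2 → ℂ} (hf : ∑ i, rankOne (f i) = 1) (hg : ∑ i, rankOne (g i) = 1)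
    (A B : Matrix (Fin 2) (Fin 2) ℂ)
    (Λ : Fin 4 → Fin 4 → Op (chainDims n) → Op e) (hΛ : ∀ i j, IsLOCC (Λ i j)) :
    ∃ Λ' : Op (chainDims n) → Op e, IsLOCC Λ' ∧ ∀ W,
      Λ' (slotState (reducedVec k l A W B)) = ∑ i, ∑ j, Λ i j (slotState
        (link (0, false) (Fin.last n, true)
          (A * (ampMat (f i)).map star * W * (ampMat (g j)).map star * B) *
          ∏ t ∈ innerSlots 0 (Fin.last n), zeroAt t)) := by
  choose Λ₁ h₁ h₁' using fun i => exists_isLOCC_nodeOp l g (orthonormal_of_sum_rankOne hg)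
    (Λ i) (hΛ i)
  obtain ⟨Λ', h, h'⟩ := exists_isLOCC_nodeOp k f (orthonormal_of_sum_rankOne hf) Λ₁ h₁
  refine ⟨Λ', h, fun W => ?_⟩
  rw [h']
  refine Finset.sum_congr rfl fun i _ => ?_
  have hval : (l : ℕ) = k + 1 := by simpa using (congrArg Fin.val hkl).symm
  have hkn : (k : ℕ) ≠ n := k.isLt.ne
  rw [reducedVec, nodeOp_link k (f i) (by simp) (by simp [Fin.ext_iff])
    (by simp [Fin.ext_iff]; omega) (by simp), h₁']
  · refine Finset.sum_congr rfl fun j _ => ?_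
    have hcomm : ∀ X : (Slot n → Fin 2) → ℂ, ∀ Y Z : (Slot n → Fin 2) → ℂ, ∀ T,
        X * (Y * (Z * (link (l.succ, false) (Fin.last n, true) B * T))) =
        X * (link (l.succ, false) (Fin.last n, true) B * (Y * (Z * T))) := by
      intro X Y Z T; ring
    rw [hcomm, nodeOp_link l (g j) (by simp) (by simp [Fin.ext_iff])
      (by simp [Fin.ext_iff]; omega) (by simp)]
    · simp only [Matrix.mul_assoc]
      congr 3
      -- The inner qubits of the whole chain are those of the two side chains and the four qubits of
      -- the measured nodes.
      have hinner : innerSlots 0 (Fin.last n) = insert (l.castSucc, true) (insert (l.succ, false)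
          (insert (k.castSucc, true) (insert (k.succ, false)
          (innerSlots 0 k.castSucc ∪ innerSlots l.succ (Fin.last n))))) := by
        ext ⟨s, b⟩
        cases b <;>
          simp only [mem_innerSlots_false, mem_innerSlots_true, Finset.mem_insert, Prod.mk.injEq,
            Finset.mem_union, Fin.ext_iff, Fin.lt_def, Fin.le_def, Fin.val_succ, Fin.val_castSucc,
            Fin.val_zero, Fin.val_last] <;> grind
      have hd : Disjoint (innerSlots 0 k.castSucc) (innerSlots l.succ (Fin.last n)) := by
        rw [Finset.disjoint_left]
        rintro t h1 h2
        have h1' := (Finset.mem_Icc.mp (mem_Icc_of_mem_innerSlots h1)).2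
        have h2' := (Finset.mem_Icc.mp (mem_Icc_of_mem_innerSlots h2)).1
        simp only [Fin.le_def, Fin.val_succ, Fin.val_castSucc] at h1' h2'
        omega
      rw [hinner, Finset.prod_insert, Finset.prod_insert, Finset.prod_insert, Finset.prod_insert,
        Finset.prod_union hd] <;>
        simp [mem_innerSlots_false, mem_innerSlots_true, Fin.ext_iff, Fin.le_def, Fin.lt_def,
          hval]
    all_goals
      refine (indepOf_zeroAt ?_).mul ((indepOf_zeroAt ?_).mul
        ((indepOf_prod_zeroAt ?_).mul (indepOf_prod_zeroAt ?_))) <;>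
      simp [mem_innerSlots_false, mem_innerSlots_true, Fin.ext_iff, Fin.le_def, Fin.lt_def,
          hval]
  all_goals
    refine (indepOf_link ?_ ?_ _).mul ((indepOf_prod_zeroAt ?_).mul (indepOf_prod_zeroAt ?_)) <;>
    simp [mem_innerSlots_false, mem_innerSlots_true, Fin.ext_iff, Fin.le_def, Fin.lt_def,
      hval, hkn]

end Concatenation

/-! ### Discarding the nodes and the optimal filter -/

section Final

variable {n : ℕ}

/-- The labels of Alice's final qubit. -/
def endAlice : Fin 2 ≃ Fin (endDims n .alice) := Equiv.refl (Fin 2)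

/-- The labels of Bob's final qubit. -/
def endBob : Fin 2 ≃ Fin (endDims n .bob) := Equiv.refl (Fin 2)

/-- The bits of Alice and Bob in the final system. -/
def endBits : Idx (endDims n) ≃ Fin 2 × Fin 2 where
  toFun x := (endAlice.symm (x .alice), endBob.symm (x .bob))
  invFun := endIdx
  left_inv x := by
    funext j
    cases j with
    | alice => rfl
    | node k => exact (Subsingleton.elim (α := Fin 1) _ _)
    | bob => rfl
  right_inv _ := rfl

lemma endBits_apply (x : Idx (endDims n)) :
    endBits x = (endAlice.symm (x .alice), endBob.symm (x .bob)) := rfl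

/-- The final operator with the two-qubit operator `X`. -/
lemma endState_rankOne (c : Fin 2 × Fin 2 → ℂ) :
    endState (n := n) (rankOne (c ∘ endBits)) = proj c := rfl

lemma endState_add (X Y : Op (endDims n)) : endState (X + Y) = endState X + endState Y := rfl

lemma endState_sum {κ : Type*} (S : Finset κ) (X : κ → Op (endDims n)) :
    endState (∑ i ∈ S, X i) = ∑ i ∈ S, endState (X i) := by
  ext a b
  simp [endState, Matrix.sum_apply]

/-- Alice and Bob share the vector `c`, and the nodes are in the state `|00⟩`. -/
def sharedVec (c : Fin 2 × Fin 2 → ℂ) : (Slot n → Fin 2) → ℂ :=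
  link (0, false) (Fin.last n, true) (ampMat c) * ∏ t ∈ innerSlots 0 (Fin.last n), zeroAt t

/-- The isometries that embed the final system in the chain. -/
def endIsometry : ∀ j : Party n, Matrix (Fin (chainDims n j)) (Fin (endDims n j)) ℂ
  | .alice => (1 : Matrix (Fin 2) (Fin 2) ℂ)
  | .node k => Matrix.of fun a _ => if a = nodeEquiv k (0, 0) then 1 else 0
  | .bob => (1 : Matrix (Fin 2) (Fin 2) ℂ)

lemma endIsometry_isometry (j : Party n) : (endIsometry j)ᴴ * endIsometry j = 1 := by
  cases j with
  | alice => simp only [endIsometry]; exact (by simp : (1 : Matrix (Fin 2) (Fin 2) ℂ)ᴴ * 1 = 1)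
  | bob => simp only [endIsometry]; exact (by simp : (1 : Matrix (Fin 2) (Fin 2) ℂ)ᴴ * 1 = 1)
  | node k =>
    ext a b
    obtain rfl : a = b := Subsingleton.elim (α := Fin 1) a b
    rw [Matrix.one_apply_eq]
    simp [endIsometry, Matrix.mul_apply]

/-- The inner slots of the whole chain are exactly the qubits held by nodes, so |00⟩ at every node
is the product of the `zeroAt` factors. -/
lemma tensorOp_endIsometry_mulVec (c : Fin 2 × Fin 2 → ℂ) :
    tensorOp (endIsometry (n := n)) *ᵥ (c ∘ endBits) = sharedVec c ∘ slotBits := by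
  funext y
  have hA : ∀ a b : Fin 2, endIsometry (n := n) .alice (aliceEquiv a) (endAlice b) =
    if a = b then 1 else 0 := fun a b => Matrix.one_apply
  have hB : ∀ a b : Fin 2, endIsometry (n := n) .bob (bobEquiv a) (endBob b) =
    if a = b then 1 else 0 := fun a b => Matrix.one_apply
  simp only [Matrix.mulVec, dotProduct, tensorOp, Matrix.of_apply, Function.comp_apply]
  by_cases H : ∀ k, nodeBits y k = (0, 0)
  · have hz : (∏ t ∈ innerSlots 0 (Fin.last n), zeroAt t) (slotBits y) = 1 := by
      rw [Finset.prod_apply]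
      refine Finset.prod_eq_one fun t ht => ?_
      obtain ⟨s, b⟩ := t
      cases b with
      | false =>
        rw [mem_innerSlots_false] at ht
        obtain ⟨k, rfl⟩ := Fin.exists_succ_eq.mpr ht.1.ne'
        simp [zeroAt, H k]
      | true =>
        rw [mem_innerSlots_true] at ht
        obtain ⟨k, rfl⟩ := Fin.exists_castSucc_eq.mpr ht.2.ne
        simp [zeroAt, H k]
    have hlink : link (0, false) (Fin.last n, true) (ampMat c) (slotBits y) =
        c (aliceEquiv.symm (y .alice), bobEquiv.symm (y .bob)) := by
      simp [link, ampMat_apply]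
    rw [sharedVec, Pi.mul_apply, hz, mul_one, hlink, Finset.sum_eq_single
      (endBits.symm (aliceEquiv.symm (y .alice), bobEquiv.symm (y .bob)))]
    · rw [Equiv.apply_symm_apply, Finset.prod_eq_one, one_mul]
      rintro j -
      cases j with
      | alice =>
        exact (hA (aliceEquiv.symm (y .alice)) (aliceEquiv.symm (y .alice))).trans (by simp)
      | bob => exact (hB (bobEquiv.symm (y .bob)) (bobEquiv.symm (y .bob))).trans (by simp)
      | node k =>
        have := H k
        rw [nodeBits_eq, Equiv.symm_apply_eq] at this
        simp [endIsometry, this]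
    · intro x _ hx
      have hx' : endBits x ≠ (aliceEquiv.symm (y .alice), bobEquiv.symm (y .bob)) := by
        intro h; exact hx (by rw [← h, Equiv.symm_apply_apply])
      rw [endBits_apply, Ne, Prod.mk.injEq, not_and_or] at hx'
      rcases hx' with h | h
      · rw [Finset.prod_eq_zero (Finset.mem_univ Party.alice), zero_mul]
        refine (hA (aliceEquiv.symm (y .alice)) (endAlice.symm (x .alice))).trans ?_
        rw [if_neg (Ne.symm h)]
      · rw [Finset.prod_eq_zero (Finset.mem_univ Party.bob), zero_mul]
        refine (hB (bobEquiv.symm (y .bob)) (endBob.symm (x .bob))).trans ?_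
        rw [if_neg (Ne.symm h)]
    · simp
  · push Not at H
    obtain ⟨k, hk⟩ := H
    have hz : (∏ t ∈ innerSlots 0 (Fin.last n), zeroAt t) (slotBits y) = 0 := by
      rw [Finset.prod_apply]
      rw [Ne, Prod.ext_iff, not_and_or] at hk
      rcases hk with h | h
      · exact Finset.prod_eq_zero (i := (k.castSucc, true))
          (by simp [mem_innerSlots_true, Fin.castSucc_lt_last]) (if_neg (by simpa using h))
      · exact Finset.prod_eq_zero (i := (k.succ, false))
          (by simp [mem_innerSlots_false, Fin.succ_pos, Fin.le_last]) (if_neg (by simpa using h))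
    rw [sharedVec, Pi.mul_apply, hz, mul_zero]
    refine Finset.sum_eq_zero fun x _ => ?_
    rw [Finset.prod_eq_zero (Finset.mem_univ (Party.node k)), zero_mul]
    have : y (.node k) ≠ nodeEquiv k (0, 0) := by
      exact fun h => hk ((nodeEquiv k).symm_apply_eq.mpr h)
    simp [endIsometry, this]

/-- The nodes can be discarded. -/
lemma exists_isLOCC_discard : ∃ Λ : Op (chainDims n) → Op (endDims n), IsLOCC Λ ∧
    ∀ c, Λ (slotState (sharedVec c)) = rankOne (c ∘ endBits) := by
  have : Nonempty (Party n) := ⟨.alice⟩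
  obtain ⟨Λ, hΛ, hΛ'⟩ := exists_isLOCC_undo_isometry (e := endDims n)
    (fun j => by cases j <;> simp [endDims]) Finset.univ (chainDims n) endIsometry
    endIsometry_isometry (by simp)
  refine ⟨Λ, hΛ, fun c => ?_⟩
  rw [slotState, ← tensorOp_endIsometry_mulVec, ← sandwich_rankOne, hΛ']

lemma localOpOn_endAlice (M : Matrix (Fin 2) (Fin 2) ℂ) (c : Fin 2 × Fin 2 → ℂ) :
    localOpOn (endAlice (n := n)) M *ᵥ (c ∘ endBits) = matVec (M * ampMat c) ∘ endBits := by
  funext y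
  simp [localOpOn_mulVec, endBits_apply, matVec, Matrix.mul_apply, ampMat_apply]

lemma localOpOn_endBob (M : Matrix (Fin 2) (Fin 2) ℂ) (c : Fin 2 × Fin 2 → ℂ) :
    localOpOn (endBob (n := n)) M *ᵥ (c ∘ endBits) = matVec (ampMat c * Mᵀ) ∘ endBits := by
  funext y
  simp [localOpOn_mulVec, endBits_apply, matVec, Matrix.mul_apply, ampMat_apply, mul_comm]

/-- The expectation value of `X` in the vector `φ`. -/
def overlap {κ : Type*} [Fintype κ] (φ : κ → ℂ) (X : Matrix κ κ ℂ) : ℝ :=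
  (star φ ⬝ᵥ (X *ᵥ φ)).re

lemma overlap_add {κ : Type*} [Fintype κ] (φ : κ → ℂ) (X Y : Matrix κ κ ℂ) :
    overlap φ (X + Y) = overlap φ X + overlap φ Y := by
  simp [overlap, Matrix.add_mulVec, dotProduct_add]

lemma overlap_sum {κ τ : Type*} [Fintype κ] (φ : κ → ℂ) (S : Finset τ) (X : τ → Matrix κ κ ℂ) :
    overlap φ (∑ i ∈ S, X i) = ∑ i ∈ S, overlap φ (X i) := by
  simp only [overlap, Matrix.sum_mulVec, dotProduct_sum, Complex.re_sum]

lemma overlap_rankOne {κ : Type*} [Fintype κ] (φ c : κ → ℂ) :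
    overlap φ (rankOne c) = Complex.normSq (star φ ⬝ᵥ c) := by
  rw [overlap, rankOne, Matrix.vecMulVec_mulVec, dotProduct_smul, op_smul_eq_mul,
    ← Complex.conj_re]
  have : star c ⬝ᵥ φ = star (star φ ⬝ᵥ c) := by rw [Matrix.star_dotProduct]
  rw [this, Complex.star_def, Complex.mul_conj]
  simp

/-- `(|00⟩ + |11⟩) / √2`. -/
def phiPlus : Fin 2 × Fin 2 → ℂ := matVec (((1 / Real.sqrt 2 : ℝ) : ℂ) • 1)

lemma isMaxEntangled_phiPlus : IsMaxEntangled phiPlus := by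
  have h2 : ((Real.sqrt 2 : ℝ) : ℂ)⁻¹ * ((Real.sqrt 2 : ℝ) : ℂ)⁻¹ = 1 / 2 := by
    rw [← mul_inv, ← Complex.ofReal_mul, Real.mul_self_sqrt (by norm_num)]; norm_num
  have : (Matrix.of fun i j => phiPlus (i, j)) =
      (((1 / Real.sqrt 2 : ℝ) : ℂ) • 1 : Matrix (Fin 2) (Fin 2) ℂ) := rfl
  rw [IsMaxEntangled, this]
  ext i j
  fin_cases i <;> fin_cases j <;> simp [h2]

lemma overlap_phiPlus (M : Matrix (Fin 2) (Fin 2) ℂ) :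
    overlap phiPlus (proj (matVec M)) = Complex.normSq (M 0 0 + M 1 1) / 2 := by
  have h : star phiPlus ⬝ᵥ matVec M = ((1 / Real.sqrt 2 : ℝ) : ℂ) * (M 0 0 + M 1 1) := by
    simp [dotProduct, Fintype.sum_prod_type, phiPlus, matVec, Fin.sum_univ_two]
    ring
  rw [show proj (matVec M) = rankOne (matVec M) from rfl, overlap_rankOne, h, Complex.normSq_mul,
    Complex.normSq_ofReal]
  have : 1 / Real.sqrt 2 * (1 / Real.sqrt 2) = 1 / 2 := by
    rw [div_mul_div_comm, Real.mul_self_sqrt (by norm_num)]; norm_num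
  rw [this]; ring

/-- The mixture of `√q u₀ ⊗ v₁` and `x u₀ ⊗ v₀ + z u₁ ⊗ v₁`. -/
def mixState (q x z : ℝ) (U V : QubitBasis) : TwoQubit :=
  proj (inBasis U V (matVec !![0, ((Real.sqrt q : ℝ) : ℂ); 0, 0])) +
    proj (inBasis U V (matVec !![(x : ℂ), 0; 0, (z : ℂ)]))

/-- The filter `diag(f, 1)` of Alice in the basis `U`; if it fails, Bob resets his qubit. -/
lemma exists_isLOCC_filter (U V : QubitBasis) {f : ℝ} (hf0 : 0 ≤ f) (hf : f ≤ 1) :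
    ∃ Λ : Op (endDims n) → Op (endDims n), IsLOCC Λ ∧ ∀ w : Matrix (Fin 2) (Fin 2) ℂ,
      overlap phiPlus (endState (Λ (rankOne (inBasis U V (matVec w) ∘ endBits)))) =
        (Complex.normSq (f * w 0 0 + w 1 1) +
          (1 - f ^ 2) * (Complex.normSq (w 0 0) + Complex.normSq (w 0 1))) / 2 := by
  let u := (U : Matrix (Fin 2) (Fin 2) ℂ)
  let v := (V : Matrix (Fin 2) (Fin 2) ℂ)
  have huu : uᴴ * u = 1 := U.conjTranspose_mul
  have huu' : u * uᴴ = 1 := U.mul_conjTranspose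
  have hvv : vᴴ * v = 1 := V.conjTranspose_mul
  have hvv' : v * vᴴ = 1 := V.mul_conjTranspose
  have hg : ((Real.sqrt (1 - f ^ 2) : ℝ) : ℂ) * ((Real.sqrt (1 - f ^ 2) : ℝ) : ℂ) =
      1 - (f : ℂ) * f := by
    rw [← Complex.ofReal_mul, Real.mul_self_sqrt (by nlinarith)]; push_cast; ring
  -- `F 1` completes the filter `F 0` to a measurement and leaves Alice in u₀. `N` measures Bob's
  -- qubit and resets it to |0⟩, so failure yields a product state of overlap 1/2.
  let F : Fin 2 → Matrix (Fin 2) (Fin 2) ℂ :=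
    ![!![(f : ℂ), 0; 0, 1], !![((Real.sqrt (1 - f ^ 2) : ℝ) : ℂ), 0; 0, 0]]
  let N : Fin 2 → Matrix (Fin 2) (Fin 2) ℂ := ![!![1, 0; 0, 0], !![0, 1; 0, 0]]
  have hF : ∑ i, (F i)ᴴ * F i = 1 := by
    ext i j
    fin_cases i <;> fin_cases j <;> simp [F, Matrix.mul_apply, Fin.sum_univ_two, hg]
  have hN : ∑ i, (N i)ᴴ * N i = 1 := by
    ext i j
    fin_cases i <;> fin_cases j <;> simp [N, Matrix.mul_apply, Fin.sum_univ_two]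
  have hrot : ∀ {K : Fin 2 → Matrix (Fin 2) (Fin 2) ℂ} {t : Matrix (Fin 2) (Fin 2) ℂ},
      ∑ i, (K i)ᴴ * K i = 1 → t * tᴴ = 1 → ∑ i, (K i * tᴴ)ᴴ * (K i * tᴴ) = 1 := by
    intro K t hK ht
    calc _ = t * (∑ i, (K i)ᴴ * K i) * tᴴ := by
          simp only [Matrix.mul_sum, Matrix.sum_mul, Matrix.conjTranspose_mul,
            Matrix.conjTranspose_conjTranspose, Matrix.mul_assoc]
      _ = 1 := by rw [hK, mul_one, ht]
  have hV : ∀ M K : Matrix (Fin 2) (Fin 2) ℂ, M * vᵀ * (K * vᴴ)ᵀ = M * Kᵀ := by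
    intro M K
    rw [Matrix.mul_assoc, ← Matrix.transpose_mul, Matrix.mul_assoc, hvv, mul_one]
  have hB0 : ∃ Λ : Op (endDims n) → Op (endDims n), IsLOCC Λ ∧ ∀ M,
      Λ (rankOne (matVec (M * vᵀ) ∘ endBits)) = rankOne (matVec M ∘ endBits) := by
    refine ⟨_, IsLOCC.localUnitary endBob vᴴ
      (by rw [Matrix.conjTranspose_conjTranspose, hvv']), fun M => ?_⟩
    rw [sandwich_rankOne, localOpOn_endBob, ampMat_matVec]
    simpa using congrArg (fun X => rankOne (matVec X ∘ endBits (n := n))) (hV M 1)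
  have hB1 : ∃ Λ : Op (endDims n) → Op (endDims n), IsLOCC Λ ∧ ∀ M,
      Λ (rankOne (matVec (M * vᵀ) ∘ endBits)) =
        ∑ i, rankOne (matVec (M * (N i)ᵀ) ∘ endBits) := by
    refine ⟨_, IsLOCC.measureOn endBob (fun i => N i * vᴴ) (hrot hN hvv')
      (fun _ X => X) (fun _ => IsLOCC.done), fun M => ?_⟩
    refine Finset.sum_congr rfl fun i _ => ?_
    rw [sandwich_rankOne, localOpOn_endBob, ampMat_matVec, hV]
  obtain ⟨Λ₀, h₀, h₀'⟩ := hB0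
  obtain ⟨Λ₁, h₁, h₁'⟩ := hB1
  refine ⟨_, IsLOCC.measureOn endAlice (fun i => F i * uᴴ) (hrot hF huu')
    ![Λ₀, Λ₁] (fun i => by fin_cases i; exacts [h₀, h₁]), fun w => ?_⟩
  have hA : ∀ i, F i * uᴴ * ampMat (inBasis U V (matVec w)) = F i * w * vᵀ := by
    intro i
    rw [ampMat_inBasis, ampMat_matVec]
    calc _ = F i * (uᴴ * u) * w * vᵀ := by simp only [Matrix.mul_assoc]; rfl
      _ = _ := by rw [huu, mul_one]
  simp only [sandwich_rankOne, localOpOn_endAlice, hA]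
  rw [Fin.sum_univ_two]
  simp only [Matrix.cons_val_zero, Matrix.cons_val_one, h₀', h₁']
  rw [Fin.sum_univ_two, endState_add, endState_add, overlap_add, overlap_add, endState_rankOne,
    endState_rankOne, endState_rankOne, overlap_phiPlus, overlap_phiPlus, overlap_phiPlus]
  have hgn : Real.sqrt (1 - f ^ 2) * Real.sqrt (1 - f ^ 2) = 1 - f ^ 2 :=
    Real.mul_self_sqrt (by nlinarith)
  rw [Matrix.eta_fin_two w]
  simp [F, N, Matrix.mul_apply, Fin.sum_univ_two, Complex.normSq_mul, Complex.normSq_ofReal, hgn]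
  ring

/-- The fully entangled fraction `(q + x² + z² + (x z)² / q) / 2` of the mixture is reached. -/
lemma exists_isLOCC_overlap_mixState (U V : QubitBasis) {q x z : ℝ} (hq : 0 < q) (hx : 0 ≤ x)
    (hz : 0 ≤ z) (hxz : x * z ≤ q) :
    ∃ Λ : Op (chainDims n) → Op (endDims n), IsLOCC Λ ∧
      overlap phiPlus (endState (Λ (
        slotState (sharedVec (inBasis U V (matVec !![0, ((Real.sqrt q : ℝ) : ℂ); 0, 0]))) +
        slotState (sharedVec (inBasis U V (matVec !![(x : ℂ), 0; 0, (z : ℂ)])))))) =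
        (q + x ^ 2 + z ^ 2 + (x * z) ^ 2 / q) / 2 := by
  obtain ⟨Λ₁, h₁, h₁'⟩ := exists_isLOCC_discard (n := n)
  -- A filter parameter f gives (q + x² + z² + 2fxz - f²q)/2. This is maximal at f = xz/q, which is
  -- an admissible filter precisely because xz ≤ q.
  obtain ⟨Λ₂, h₂, h₂'⟩ := exists_isLOCC_filter (n := n) U V (f := x * z / q) (by positivity)
    ((div_le_one hq).mpr hxz)
  refine ⟨_, h₁.comp h₂, ?_⟩
  obtain ⟨L₁, hL₁⟩ := h₁.exists_linear
  obtain ⟨L₂, hL₂⟩ := h₂.exists_linear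
  rw [hL₁, map_add, ← hL₁, ← hL₁, hL₂, map_add, ← hL₂, ← hL₂, h₁', h₁', endState_add, overlap_add,
    h₂', h₂']
  have : Complex.normSq (((x * z / q : ℝ) : ℂ) * x + z) = (x * z / q * x + z) ^ 2 := by
    rw [← Complex.ofReal_mul, ← Complex.ofReal_add, Complex.normSq_ofReal, sq]
  simp [Complex.normSq_ofReal] at this ⊢
  rw [Real.mul_self_sqrt hq.le, this]
  field_simp
  ring

end Final

/-! ### Squared norms under measurements -/

section NormSquare

/-- The squared norm of a vector of amplitudes. -/
def sqNorm {κ : Type*} [Fintype κ] (v : κ → ℂ) : ℝ := ∑ i, Complex.normSq (v i)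

lemma sqNorm_eq {κ : Type*} [Fintype κ] (v : κ → ℂ) : (sqNorm v : ℂ) = star v ⬝ᵥ v := by
  simp only [sqNorm, dotProduct, Complex.ofReal_sum, Complex.normSq_eq_conj_mul_self]
  rfl

/-- Conservation of probability. The target dimension may depend on the outcome, as it does in a
round of LOCC. -/
lemma sum_sqNorm_mulVec {κ : Type*} [Fintype κ] [DecidableEq κ] {τ : Type*} [Fintype τ]
    {κ' : τ → Type*} [∀ x, Fintype (κ' x)] (M : ∀ x, Matrix (κ' x) κ ℂ)
    (hM : ∑ x, (M x)ᴴ * M x = 1) (v : κ → ℂ) : ∑ x, sqNorm (M x *ᵥ v) = sqNorm v := by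
  have h : ∀ x, (sqNorm (M x *ᵥ v) : ℂ) = star v ⬝ᵥ (((M x)ᴴ * M x) *ᵥ v) := by
    intro x
    rw [sqNorm_eq, Matrix.star_mulVec, ← Matrix.dotProduct_mulVec, Matrix.mulVec_mulVec]
  have : ((∑ x, sqNorm (M x *ᵥ v) : ℝ) : ℂ) = (sqNorm v : ℂ) := by
    rw [Complex.ofReal_sum]
    simp only [h]
    rw [← dotProduct_sum, ← Matrix.sum_mulVec, hM, Matrix.one_mulVec, sqNorm_eq]
  exact_mod_cast this

lemma sqNorm_inBasis (U V : QubitBasis) (c : Fin 2 × Fin 2 → ℂ) :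
    sqNorm (inBasis U V c) = sqNorm c := by
  simpa [inBasis] using sum_sqNorm_mulVec (fun _ : Unit =>
    (U : Matrix (Fin 2) (Fin 2) ℂ) ⊗ₖ (V : Matrix (Fin 2) (Fin 2) ℂ))
    (by simpa using kronecker_isometry U.conjTranspose_mul V.conjTranspose_mul) c

end NormSquare

/-! ### Product vectors across a bipartite cut -/

section Cut

variable {ι : Type}

/-- A vector that is a product across the cut of the parties into those with `P` and the others. -/
def IsCutProduct (P : ι → Prop) {d : ι → ℕ} (v : Idx d → ℂ) : Prop :=
  ∃ (F : (∀ j : {j // P j}, Fin (d j)) → ℂ) (G : (∀ j : {j // ¬P j}, Fin (d j)) → ℂ),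
    ∀ x, v x = F (fun j => x j) * G (fun j => x j)

/-- A reference label `x₀` fills the coordinates on which a factor does not depend, so factors may
be given as functions of full labels. -/
lemma isCutProduct_of_agree {P : ι → Prop} {d : ι → ℕ} [Nonempty (Idx d)] {v F G : Idx d → ℂ}
    (hF : ∀ x y, (∀ j, P j → x j = y j) → F x = F y)
    (hG : ∀ x y, (∀ j, ¬P j → x j = y j) → G x = G y) (hv : ∀ x, v x = F x * G x) :
    IsCutProduct P v := by
  classical
  obtain ⟨x₀⟩ := ‹Nonempty (Idx d)›
  refine ⟨fun a => F fun j => if h : P j then a ⟨j, h⟩ else x₀ j,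
    fun b => G fun j => if h : P j then x₀ j else b ⟨j, h⟩, fun x => ?_⟩
  rw [hv, hF x (fun j => if P j then x j else x₀ j) fun j hj => by simp [hj],
    hG x (fun j => if P j then x₀ j else x j) fun j hj => by simp [hj]]
  simp

variable [Fintype ι] [DecidableEq ι]

lemma sum_tensorOp_conjTranspose_mul {d : ι → ℕ} (i : ι) {N : ℕ} {mid : Fin N → ι → ℕ}
    (K : ∀ (x : Fin N) (j : ι), Matrix (Fin (mid x j)) (Fin (d j)) ℂ)
    (h_meas : ∑ x, (K x i)ᴴ * K x i = 1) (h_isom : ∀ x, ∀ j, j ≠ i → (K x j)ᴴ * K x j = 1) :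
    ∑ x, (tensorOp (K x))ᴴ * tensorOp (K x) = 1 := by
  rw [← tensorOp_one]
  ext y z
  simp only [tensorOp_conjTranspose, tensorOp_mul, Matrix.sum_apply]
  simp only [tensorOp, Matrix.of_apply, ← Finset.mul_prod_erase Finset.univ _ (Finset.mem_univ i)]
  rw [← h_meas, Matrix.sum_apply, Finset.sum_mul]
  refine Finset.sum_congr rfl fun x _ => ?_
  congr 1
  exact Finset.prod_congr rfl fun j hj => by rw [h_isom x j (Finset.ne_of_mem_erase hj)]

/-- Both the operator and the vector factor across the cut, so the sum over labels is a product of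
two sums. -/
lemma IsCutProduct.tensorOp_mulVec {P : ι → Prop} {d d' : ι → ℕ} {v : Idx d → ℂ}
    (hv : IsCutProduct P v) (K : ∀ j, Matrix (Fin (d' j)) (Fin (d j)) ℂ) :
    IsCutProduct P (tensorOp K *ᵥ v) := by
  classical
  obtain ⟨F, G, hFG⟩ := hv
  refine ⟨fun y => ∑ a, (∏ j : {j // P j}, K j (y j) (a j)) * F a,
    fun y => ∑ b, (∏ j : {j // ¬P j}, K j (y j) (b j)) * G b, fun y => ?_⟩
  simp only [Matrix.mulVec, dotProduct, tensorOp, Matrix.of_apply]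
  rw [← Equiv.sum_comp (Equiv.piEquivPiSubtypeProd P fun j => Fin (d j)).symm,
    Fintype.sum_prod_type, Finset.sum_mul_sum]
  refine Finset.sum_congr rfl fun a _ => Finset.sum_congr rfl fun b _ => ?_
  rw [hFG, ← Fintype.prod_subtype_mul_prod_subtype P]
  have h1 : ∀ j : {j // P j},
      (Equiv.piEquivPiSubtypeProd P fun j => Fin (d j)).symm (a, b) j = a j := fun j => by
    simp [Equiv.piEquivPiSubtypeProd, j.2]
  have h2 : ∀ j : {j // ¬P j},
      (Equiv.piEquivPiSubtypeProd P fun j => Fin (d j)).symm (a, b) j = b j := fun j => by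
    simp [Equiv.piEquivPiSubtypeProd, j.2]
  simp only [h1, h2]
  ring

/-- LOCC does not increase the overlap of a product vector with an entangled vector. -/
lemma IsLOCC.overlap_le {P : ι → Prop} {d e : ι → ℕ} {Λ : Op d → Op e} (h : IsLOCC Λ)
    {φ : Idx e → ℂ} {c : ℝ}
    (hφ : ∀ u, IsCutProduct P u → Complex.normSq (star φ ⬝ᵥ u) ≤ c * sqNorm u) :
    ∀ v, IsCutProduct P v → overlap φ (Λ (rankOne v)) ≤ c * sqNorm v := by
  induction h with
  | done =>
    intro v hv
    rw [overlap_rankOne]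
    exact hφ v hv
  | step i K h_meas h_isom Λ hΛ ih =>
    intro v hv
    simp only [sandwich_rankOne]
    -- Each branch is again a product vector, and the squared norms of the branches add up to that
    -- of v.
    rw [overlap_sum, ← sum_sqNorm_mulVec _ (sum_tensorOp_conjTranspose_mul i K h_meas h_isom) v,
      Finset.mul_sum]
    exact Finset.sum_le_sum fun x _ => ih x _ (hv.tensorOp_mulVec _)

/-- Needed to drop the positive operator that was added to make the mixture separable. -/
lemma IsLOCC.overlap_nonneg {d e : ι → ℕ} {Λ : Op d → Op e} (h : IsLOCC Λ) (φ : Idx e → ℂ) :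
    ∀ v, 0 ≤ overlap φ (Λ (rankOne v)) := by
  induction h with
  | done =>
    intro v
    rw [overlap_rankOne]
    exact Complex.normSq_nonneg _
  | step i K h_meas h_isom Λ hΛ ih =>
    intro v
    simp only [sandwich_rankOne]
    rw [overlap_sum]
    exact Finset.sum_nonneg fun x _ => ih x _

end Cut

/-! ### The upper bound for every LOCC protocol -/

section UpperBound

variable {n : ℕ}

lemma normSq_dotProduct_le (c b : Fin 2 → ℂ) :
    Complex.normSq (∑ j, c j * b j) ≤ sqNorm c * sqNorm b := by
  have h1 : ‖∑ j, c j * b j‖ ≤ ∑ j, ‖c j‖ * ‖b j‖ :=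
    (norm_sum_le _ _).trans (by simp)
  have h2 := Finset.sum_mul_sq_le_sq_mul_sq Finset.univ (fun j => ‖c j‖) (fun j => ‖b j‖)
  simp only [sqNorm, Complex.normSq_eq_norm_sq]
  exact (pow_le_pow_left₀ (norm_nonneg _) h1 2).trans h2

/-- Contracting φ with a leaves a vector of squared norm |a|²/2, because the reduced state of φ is
half the identity. Cauchy-Schwarz with b does the rest. -/
lemma IsMaxEntangled.normSq_product_le {φ : Fin 2 × Fin 2 → ℂ} (hφ : IsMaxEntangled φ)
    (a b : Fin 2 → ℂ) :
    Complex.normSq (star φ ⬝ᵥ fun q => a q.1 * b q.2) ≤ 1 / 2 * (sqNorm a * sqNorm b) := by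
  let c : Fin 2 → ℂ := (ampMat φ)ᴴ *ᵥ a
  have hc : sqNorm c = 1 / 2 * sqNorm a := by
    have : (sqNorm c : ℂ) = ((1 / 2 * sqNorm a : ℝ) : ℂ) := by
      have hM : ampMat φ * (ampMat φ)ᴴ = (1 / 2 : ℂ) • 1 := hφ
      rw [sqNorm_eq, Matrix.star_mulVec, Matrix.conjTranspose_conjTranspose,
        ← Matrix.dotProduct_mulVec, Matrix.mulVec_mulVec, hM, Matrix.smul_mulVec,
        Matrix.one_mulVec, dotProduct_smul, ← sqNorm_eq]
      push_cast
      rfl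
    exact_mod_cast this
  have h := normSq_dotProduct_le c b
  have hsum : star φ ⬝ᵥ (fun q => a q.1 * b q.2) = ∑ j, c j * b j := by
    simp [dotProduct, Fintype.sum_prod_type, Fin.sum_univ_two, c, ampMat_apply]
    ring
  rw [hsum]
  rw [hc] at h
  linarith

lemma overlap_endState (φ : Fin 2 × Fin 2 → ℂ) (X : Op (endDims n)) :
    overlap φ (endState X) = overlap (φ ∘ endBits) X := by
  simp only [overlap, dotProduct, Matrix.mulVec, endState, Matrix.submatrix_apply]
  rw [← Equiv.sum_comp (endBits (n := n)).symm]
  refine congrArg Complex.re (Finset.sum_congr rfl fun q _ => ?_)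
  rw [← Equiv.sum_comp (endBits (n := n)).symm]
  simp only [Pi.star_apply, Function.comp_apply, Equiv.apply_symm_apply]
  rfl

/-- The parties on Alice's side of segment `m`. -/
def leftParties (m : Fin (n + 1)) : Party n → Prop
  | .alice => True
  | .node k => k.castSucc < m
  | .bob => False

/-- The nodes end with one-dimensional systems, so a product across the chain's cut is a product
between Alice and Bob. -/
lemma isMaxEntangled_end_le {φ : Fin 2 × Fin 2 → ℂ} (hφ : IsMaxEntangled φ) (m : Fin (n + 1))
    (u : Idx (endDims n) → ℂ) (hu : IsCutProduct (leftParties m) u) :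
    Complex.normSq (star (φ ∘ endBits) ⬝ᵥ u) ≤ 1 / 2 * sqNorm u := by
  obtain ⟨F, G, h⟩ := hu
  let a : Fin 2 → ℂ := fun i => F fun j => endIdx (n := n) (i, 0) j.1
  let b : Fin 2 → ℂ := fun i => G fun j => endIdx (n := n) (0, i) j.1
  have hval : ∀ q, u (endBits.symm q) = a q.1 * b q.2 := by
    rintro ⟨i, j⟩
    rw [h]
    congr 2
    · funext ⟨t, ht⟩
      cases t with
      | alice => rfl
      | node k => rfl
      | bob => exact ht.elim
    · funext ⟨t, ht⟩
      cases t with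
      | alice => exact (ht trivial).elim
      | node k => rfl
      | bob => rfl
  have h1 : star (φ ∘ endBits) ⬝ᵥ u = star φ ⬝ᵥ fun q => a q.1 * b q.2 := by
    simp only [dotProduct]
    rw [← Equiv.sum_comp (endBits (n := n)).symm]
    simp [hval]
  have h2 : sqNorm u = sqNorm a * sqNorm b := by
    simp only [sqNorm]
    rw [← Equiv.sum_comp (endBits (n := n)).symm, Fintype.sum_prod_type, Finset.sum_mul_sum]
    simp [hval]
  rw [h1, h2]
  exact hφ.normSq_product_le a b

/-- The amplitudes of a chain with segment vectors `w`. -/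
def chainVec (w : Fin (n + 1) → Fin 2 × Fin 2 → ℂ) : Idx (chainDims n) → ℂ :=
  fun x => ∏ s, w s (leftBit x s, rightBit x s)

lemma chainState_proj_eq_rankOne (w : Fin (n + 1) → Fin 2 × Fin 2 → ℂ) :
    chainState (fun s => proj (w s)) = rankOne (chainVec w) := by
  ext x y
  simp [chainState, chainVec, rankOne, proj, Matrix.vecMulVec_apply, Finset.prod_mul_distrib]

/-- Chain labels correspond bijectively to one pair of bits per segment, so the sum over labels
factors. -/
lemma sqNorm_chainVec (w : Fin (n + 1) → Fin 2 × Fin 2 → ℂ) :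
    sqNorm (chainVec w) = ∏ s, sqNorm (w s) := by
  let E : (Slot n → Fin 2) ≃ (Fin (n + 1) → Fin 2 × Fin 2) :=
    (Equiv.curry _ _ _).trans (Equiv.piCongrRight fun _ => Equiv.boolArrowEquivProd _)
  simp only [sqNorm, chainVec]
  rw [Fintype.prod_sum, ← Equiv.sum_comp (slotBits.trans E)]
  refine Finset.sum_congr rfl fun x _ => ?_
  rw [map_prod]
  rfl

lemma leftBit_congr {m s : Fin (n + 1)} (hs : s ≤ m) {x y : Idx (chainDims n)}
    (h : ∀ j, leftParties m j → x j = y j) : leftBit x s = leftBit y s := by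
  cases s using Fin.cases with
  | zero => rw [leftBit_zero, leftBit_zero, h .alice trivial]
  | succ k => rw [leftBit_succ, leftBit_succ, nodeBits_eq, nodeBits_eq,
      h (.node k) (Fin.castSucc_lt_iff_succ_le.mpr hs)]

lemma rightBit_congr_left {m s : Fin (n + 1)} (hs : s < m) {x y : Idx (chainDims n)}
    (h : ∀ j, leftParties m j → x j = y j) : rightBit x s = rightBit y s := by
  cases s using Fin.lastCases with
  | last => exact absurd hs (Fin.le_last m).not_gt
  | cast k => rw [rightBit_castSucc, rightBit_castSucc, nodeBits_eq, nodeBits_eq, h (.node k) hs]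

lemma rightBit_congr {m s : Fin (n + 1)} (hs : m ≤ s) {x y : Idx (chainDims n)}
    (h : ∀ j, ¬leftParties m j → x j = y j) : rightBit x s = rightBit y s := by
  cases s using Fin.lastCases with
  | last => rw [rightBit_last, rightBit_last, h .bob not_false]
  | cast k => rw [rightBit_castSucc, rightBit_castSucc, nodeBits_eq, nodeBits_eq,
      h (.node k) hs.not_gt]

lemma leftBit_congr_right {m s : Fin (n + 1)} (hs : m < s) {x y : Idx (chainDims n)}
    (h : ∀ j, ¬leftParties m j → x j = y j) : leftBit x s = leftBit y s := by
  cases s using Fin.cases with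
  | zero => exact absurd hs (Fin.zero_le m).not_gt
  | succ k => rw [leftBit_succ, leftBit_succ, nodeBits_eq, nodeBits_eq,
      h (.node k) (Fin.le_castSucc_iff.mpr hs).not_gt]

/-- Every segment other than m lies wholly on one side of the cut, so only segment m could entangle
the two sides. -/
lemma isCutProduct_chainVec (w : Fin (n + 1) → Fin 2 × Fin 2 → ℂ) (m : Fin (n + 1))
    (a b : Fin 2 → ℂ) (hm : ∀ q, w m q = a q.1 * b q.2) :
    IsCutProduct (leftParties m) (chainVec w) := by
  have : Nonempty (Idx (chainDims n)) := ⟨mkIdx 0 (fun _ => (0, 0)) 0⟩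
  refine isCutProduct_of_agree
    (F := fun x => a (leftBit x m) * ∏ s ∈ Finset.univ.filter (· < m),
      w s (leftBit x s, rightBit x s))
    (G := fun x => b (rightBit x m) * ∏ s ∈ Finset.univ.filter (m < ·),
      w s (leftBit x s, rightBit x s)) ?_ ?_ ?_
  · intro x y h
    rw [leftBit_congr le_rfl h]
    congr 1
    refine Finset.prod_congr rfl fun s hs => ?_
    have hs := (Finset.mem_filter.mp hs).2
    rw [leftBit_congr hs.le h, rightBit_congr_left hs h]
  · intro x y h
    rw [rightBit_congr le_rfl h]
    congr 1
    refine Finset.prod_congr rfl fun s hs => ?_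
    have hs := (Finset.mem_filter.mp hs).2
    rw [rightBit_congr hs.le h, leftBit_congr_right hs h]
  · intro x
    have hu : (Finset.univ : Finset (Fin (n + 1))) =
        insert m (Finset.univ.filter (· < m) ∪ Finset.univ.filter (m < ·)) := by
      ext s
      simp only [Finset.mem_univ, Finset.mem_insert, Finset.mem_union, Finset.mem_filter, true_and,
        true_iff]
      rcases lt_trichotomy s m with h | h | h <;> simp [h]
    rw [chainVec, Finset.prod_congr hu fun _ _ => rfl, Finset.prod_insert (by simp),
      Finset.prod_union, hm]
    · ring
    · rw [Finset.disjoint_filter]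
      exact fun s _ h h' => lt_asymm h h'

/-- The mixture is dominated by a separable operator of trace `q + x² + z² + (x z)² / q`. -/
lemma mixState_add_eq_sum_product (U V : QubitBasis) {q : ℝ} (hq : 0 < q) (x z : ℝ) :
    ∃ a b : Fin 4 → Fin 2 → ℂ,
      mixState q x z U V +
          proj (inBasis U V (matVec !![0, 0; ((x * z / Real.sqrt q : ℝ) : ℂ), 0])) =
        ∑ k, proj (inBasis U V fun r => a k r.1 * b k r.2) ∧
      ∑ k, sqNorm (fun r : Fin 2 × Fin 2 => a k r.1 * b k r.2) =
        q + x ^ 2 + z ^ 2 + (x * z) ^ 2 / q := by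
  have hs : Real.sqrt q ≠ 0 := (Real.sqrt_pos.mpr hq).ne'
  have hsq : Real.sqrt q * Real.sqrt q = q := Real.mul_self_sqrt hq.le
  -- Amplitudes x/2, z/2 at 00, 11 carry no phase, those at 01 and 10 carry conjugate phases.
  -- Summing over the fourth roots of unity cancels all cross terms except the one between 00 and
  -- 11.
  let ω : Fin 4 → ℂ := ![1, Complex.I, -1, -Complex.I]
  refine ⟨fun k => ![1 / 2, ((z / Real.sqrt q : ℝ) : ℂ) * ω k / 2],
    fun k => ![(x : ℂ), (Real.sqrt q : ℂ) * star (ω k)], ?_, ?_⟩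
  · have hW : ∀ c, proj (inBasis U V c) =
        ((U : Matrix (Fin 2) (Fin 2) ℂ) ⊗ₖ (V : Matrix (Fin 2) (Fin 2) ℂ)) * rankOne c *
        ((U : Matrix (Fin 2) (Fin 2) ℂ) ⊗ₖ (V : Matrix (Fin 2) (Fin 2) ℂ))ᴴ := fun c =>
      (sandwich_rankOne _ _).symm
    simp only [mixState, hW, ← Matrix.mul_add, ← Matrix.add_mul, ← Matrix.mul_sum, ← Matrix.sum_mul]
    congr 2
    have hsC : (Real.sqrt q : ℂ) ≠ 0 := by exact_mod_cast hs
    ext ⟨i, j⟩ ⟨k, l⟩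
    simp only [rankOne, Matrix.add_apply, Matrix.sum_apply, Matrix.vecMulVec_apply,
      Fin.sum_univ_four, ω]
    fin_cases i <;> fin_cases j <;> fin_cases k <;> fin_cases l <;>
    · simp [matVec]
      try field_simp
      try ring_nf
      try simp
      try ring
  · have hω : ∀ k, Complex.normSq (ω k) = 1 := by
      intro k; fin_cases k <;> simp [ω]
    have hterm : ∀ k, sqNorm (fun r : Fin 2 × Fin 2 =>
        (![1 / 2, ((z / Real.sqrt q : ℝ) : ℂ) * ω k / 2] : Fin 2 → ℂ) r.1 *
        (![(x : ℂ), (Real.sqrt q : ℂ) * star (ω k)] : Fin 2 → ℂ) r.2) =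
        (q + x ^ 2 + z ^ 2 + (x * z) ^ 2 / q) / 4 := by
      intro k
      simp only [sqNorm, Fintype.sum_prod_type, Fin.sum_univ_two, Complex.normSq_mul,
        Matrix.cons_val_zero, Matrix.cons_val_one, Complex.normSq_div, Complex.star_def,
        Complex.normSq_conj, hω, Complex.normSq_ofReal, Complex.normSq_one, Complex.normSq_ofNat,
        hsq]
      have : z / Real.sqrt q * (z / Real.sqrt q) = z ^ 2 / q := by
        rw [div_mul_div_comm, hsq, sq]
      rw [this]
      field_simp
      ring
    rw [Finset.sum_congr rfl fun k _ => hterm k, Finset.sum_const, Finset.card_univ,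
      Fintype.card_fin]
    simp
    ring

/-- No LOCC protocol exceeds the fully entangled fraction `(q + x² + z² + (x z)² / q) / 2`. -/
lemma IsLOCC.overlap_chain_le (m : Fin (n + 1)) (w : Fin (n + 1) → Fin 2 × Fin 2 → ℂ)
    (hw : ∀ s, s ≠ m → sqNorm (w s) = 1) (U V : QubitBasis) {q : ℝ} (hq : 0 < q) (x z : ℝ)
    {Λ : Op (chainDims n) → Op (endDims n)} (hΛ : IsLOCC Λ) {φ : Fin 2 × Fin 2 → ℂ}
    (hφ : IsMaxEntangled φ) :
    overlap φ (endState (Λ (chainState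
      (Function.update (fun s => proj (w s)) m (mixState q x z U V))))) ≤
      (q + x ^ 2 + z ^ 2 + (x * z) ^ 2 / q) / 2 := by
  obtain ⟨a, b, hab, hsum⟩ := mixState_add_eq_sum_product U V hq x z
  obtain ⟨L, hL⟩ := hΛ.exists_linear
  have hupd : ∀ v, chainState (Function.update (fun s => proj (w s)) m (proj v)) =
      rankOne (chainVec (Function.update w m v)) := by
    intro v
    rw [← chainState_proj_eq_rankOne]
    congr 1
    funext s
    by_cases h : s = m
    · subst h; simp
    · simp [Function.update_of_ne h]
  have hsumst : ∀ X : Fin 4 → TwoQubit,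
      chainState (Function.update (fun s => proj (w s)) m (∑ k, X k)) =
        ∑ k, chainState (Function.update (fun s => proj (w s)) m (X k)) := by
    intro X
    simp only [Fin.sum_univ_four, chainState_update_add]
  have key := congrArg (fun X => overlap φ (endState (Λ (chainState
    (Function.update (fun s => proj (w s)) m X))))) hab
  simp only [chainState_update_add, hsumst, hupd, hL, map_add, map_sum, endState_add, endState_sum,
    overlap_add, overlap_sum] at key
  simp only [← hL, overlap_endState] at key ⊢
  -- The contribution of the added component only helps the inequality.
  have h1 := hΛ.overlap_nonneg (φ ∘ endBits) (chainVec (Function.update w m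
    (inBasis U V (matVec !![0, 0; ((x * z / Real.sqrt q : ℝ) : ℂ), 0]))))
  have h2 : ∀ k, overlap (φ ∘ endBits) (Λ (rankOne (chainVec (Function.update w m
      (inBasis U V fun r => a k r.1 * b k r.2))))) ≤
      1 / 2 * sqNorm (fun r : Fin 2 × Fin 2 => a k r.1 * b k r.2) := by
    intro k
    have hn : sqNorm (chainVec (Function.update w m (inBasis U V fun r => a k r.1 * b k r.2))) =
        sqNorm (fun r : Fin 2 × Fin 2 => a k r.1 * b k r.2) := by
      rw [sqNorm_chainVec, Finset.prod_eq_single m]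
      · rw [Function.update_self, sqNorm_inBasis]
      · intro s _ hs
        rw [Function.update_of_ne hs, hw s hs]
      · simp
    rw [← hn]
    refine hΛ.overlap_le (isMaxEntangled_end_le hφ m) _ (isCutProduct_chainVec _ m
      ((U : Matrix (Fin 2) (Fin 2) ℂ) *ᵥ a k) ((V : Matrix (Fin 2) (Fin 2) ℂ) *ᵥ b k) fun r => ?_)
    rw [Function.update_self]
    simp only [inBasis, Matrix.mulVec, dotProduct, Fintype.sum_prod_type,
      Matrix.kroneckerMap_apply, Fin.sum_univ_two]
    ring
  have h3 := Finset.sum_le_sum fun k (_ : k ∈ Finset.univ) => h2 k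
  rw [← Finset.mul_sum, hsum] at h3
  linarith

end UpperBound

/-! ### The optimal fraction of a single mixture -/

section Optimal

variable {n : ℕ}

/-- A bound valid for every maximally entangled φ also makes the supremum in `fef` bounded, so
reaching it at `phiPlus` alone pins that supremum down. -/
lemma isGreatest_achievableFEF {σ : Fin (n + 1) → TwoQubit} {B : ℝ}
    (hle : ∀ Λ : Op (chainDims n) → Op (endDims n), IsLOCC Λ → ∀ φ, IsMaxEntangled φ →
      overlap φ (endState (Λ (chainState σ))) ≤ B)
    (hex : ∃ Λ : Op (chainDims n) → Op (endDims n), IsLOCC Λ ∧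
      overlap phiPlus (endState (Λ (chainState σ))) = B) :
    IsGreatest (achievableFEF σ) B := by
  constructor
  · obtain ⟨Λ, hΛ, hB⟩ := hex
    refine ⟨Λ, hΛ, le_antisymm ?_ ?_⟩
    · refine le_csSup ⟨B, ?_⟩ ⟨phiPlus, isMaxEntangled_phiPlus, hB.symm⟩
      rintro r ⟨φ, hφ, rfl⟩
      exact hle Λ hΛ φ hφ
    · refine csSup_le ⟨_, phiPlus, isMaxEntangled_phiPlus, rfl⟩ ?_
      rintro r ⟨φ, hφ, rfl⟩
      exact hle Λ hΛ φ hφ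
  · rintro r ⟨Λ, hΛ, rfl⟩
    refine csSup_le ⟨_, phiPlus, isMaxEntangled_phiPlus, rfl⟩ ?_
    rintro r ⟨φ, hφ, rfl⟩
    exact hle Λ hΛ φ hφ

lemma chainState_update_mixState (w : Fin (n + 1) → Fin 2 × Fin 2 → ℂ) (m : Fin (n + 1))
    (q x z : ℝ) (U V : QubitBasis) :
    chainState (Function.update (fun s => proj (w s)) m (mixState q x z U V)) =
      chainState (fun s => proj (Function.update w m
        (inBasis U V (matVec !![0, ((Real.sqrt q : ℝ) : ℂ); 0, 0])) s)) +
      chainState (fun s => proj (Function.update w m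
        (inBasis U V (matVec !![(x : ℂ), 0; 0, (z : ℂ)])) s)) := by
  have hupd : ∀ v, Function.update (fun s => proj (w s)) m (proj v) =
      fun s => proj (Function.update w m v s) := by
    intro v
    funext s
    by_cases h : s = m
    · subst h; simp
    · simp [Function.update_of_ne h]
  rw [mixState, chainState_update_add, hupd, hupd]

/-- The optimal fully entangled fraction of a single mixture. -/
lemma ofef_mixState (U V : QubitBasis) {q x z : ℝ} (hq : 0 < q) (hx : 0 ≤ x) (hz : 0 ≤ z)
    (hxz : x * z ≤ q) :
    ofef (mixState q x z U V) = (q + x ^ 2 + z ^ 2 + (x * z) ^ 2 / q) / 2 := by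
  have hσ : (fun _ : Fin (0 + 1) => mixState q x z U V) =
      Function.update (fun _ => proj 0) 0 (mixState q x z U V) := by
    funext s
    obtain rfl : s = 0 := Subsingleton.elim (α := Fin 1) s 0
    simp
  have hshared : ∀ c, chainState (n := 0) (fun s => proj (Function.update (fun _ => 0) 0 c s)) =
      slotState (sharedVec c) := by
    intro c
    rw [chainState_proj]
    congr 1
  refine (isGreatest_achievableFEF (n := 0) (fun Λ hΛ φ hφ => ?_) ?_).csSup_eq
  · rw [hσ]
    exact hΛ.overlap_chain_le 0 (fun _ => 0)
      (fun s hs => (hs (Subsingleton.elim (α := Fin 1) s 0)).elim) U V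
      hq x z hφ
  · rw [hσ, chainState_update_mixState fun _ => 0]
    obtain ⟨Λ, hΛ, h⟩ := exists_isLOCC_overlap_mixState (n := 0) U V hq hx hz hxz
    refine ⟨Λ, hΛ, ?_⟩
    rw [← h]
    exact congrArg (fun X => overlap phiPlus (endState (Λ X)))
      (congrArg₂ (· + ·) (hshared _) (hshared _))

end Optimal

/-! ### Bell outcomes as diagonal filters -/

section Bell

/-- `√2` times the matrices of amplitudes of the Bell basis. -/
def bellUnitary : Fin 4 → QubitBasis :=
  ![1, QubitBasis.ofIsometry !![1, 0; 0, -1] (by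
      ext i j; fin_cases i <;> fin_cases j <;> simp [Matrix.mul_apply]),
    QubitBasis.ofIsometry !![0, 1; 1, 0] (by
      ext i j; fin_cases i <;> fin_cases j <;> simp [Matrix.mul_apply]),
    QubitBasis.ofIsometry !![0, 1; -1, 0] (by
      ext i j; fin_cases i <;> fin_cases j <;> simp [Matrix.mul_apply])]

/-- The first diagonal entry of the filter that a Bell outcome induces. -/
def bellFst (α : ℝ) : Fin 4 → ℝ :=
  ![Real.sqrt α, Real.sqrt α, Real.sqrt (1 - α), Real.sqrt (1 - α)]

/-- The second diagonal entry of the filter that a Bell outcome induces. -/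
def bellSnd (α : ℝ) : Fin 4 → ℝ :=
  ![Real.sqrt (1 - α), Real.sqrt (1 - α), Real.sqrt α, Real.sqrt α]

/-- The filter that a Bell outcome induces. -/
def bellFilter (α : ℝ) (i : Fin 4) : Matrix (Fin 2) (Fin 2) ℂ :=
  !![(bellFst α i : ℂ), 0; 0, (bellSnd α i : ℂ)]

lemma ampMat_bellVec_map_star (i : Fin 4) :
    (ampMat (bellVec i)).map star = ampMat (bellVec i) := by
  ext a b
  fin_cases i <;> fin_cases a <;> fin_cases b <;>
    simp [bellVec, ampMat]

/-- Bell amplitude matrices are diagonal or antidiagonal, so a diagonal matrix moves past them with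
its entries kept or exchanged. What remains outside is a unitary for Alice, and in the next lemma
for Bob. -/
lemma schmidtMat_mul_bellVec (α : ℝ) (i : Fin 4) :
    schmidtMat α * ampMat (bellVec i) = ((1 / Real.sqrt 2 : ℝ) : ℂ) •
      ((bellUnitary i : Matrix (Fin 2) (Fin 2) ℂ) * bellFilter α i) := by
  ext a b
  fin_cases i <;> fin_cases a <;> fin_cases b <;>
    simp [bellVec, ampMat, schmidtMat, bellUnitary, bellFilter, bellFst, bellSnd, Matrix.mul_apply,
      Fin.sum_univ_two, mul_comm]

lemma bellVec_mul_schmidtMat (α : ℝ) (i : Fin 4) :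
    ampMat (bellVec i) * schmidtMat α = ((1 / Real.sqrt 2 : ℝ) : ℂ) •
      (bellFilter α i * (bellUnitary i : Matrix (Fin 2) (Fin 2) ℂ)) := by
  ext a b
  fin_cases i <;> fin_cases a <;> fin_cases b <;>
    simp [bellVec, ampMat, schmidtMat, bellUnitary, bellFilter, bellFst, bellSnd, Matrix.mul_apply,
      Fin.sum_univ_two, mul_comm]

/-- The amplitudes that Alice and Bob share after the Bell measurements at two nodes. -/
lemma swap_bellVec (U₀ V₀ U₁ V₁ U₂ V₂ : QubitBasis) (α β : ℝ) (c : Fin 2 × Fin 2 → ℂ)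
    (i j : Fin 4) :
    ampMat (inBasis U₀ V₀ (schmidtVec α)) * (ampMat (inBasis V₀ U₁ (bellVec i))).map star *
      ampMat (inBasis U₁ V₁ c) * (ampMat (inBasis V₁ U₂ (bellVec j))).map star *
      ampMat (inBasis U₂ V₂ (schmidtVec β)) =
    ampMat (inBasis (U₀ * bellUnitary i) (V₂ * (bellUnitary j).transpose)
      (matVec ((1 / 2 : ℂ) • (bellFilter α i * ampMat c * bellFilter β j)))) := by
  have h2 : ((1 / Real.sqrt 2 : ℝ) : ℂ) * ((1 / Real.sqrt 2 : ℝ) : ℂ) = 1 / 2 := by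
    rw [← Complex.ofReal_mul, div_mul_div_comm, Real.mul_self_sqrt (by norm_num)]; norm_num
  rw [ampMat_map_star_inBasis, ampMat_map_star_inBasis]
  simp only [ampMat_inBasis, ampMat_bellVec_map_star, ampMat_schmidtVec,
    ampMat_matVec, Submonoid.coe_mul, QubitBasis.coe_transpose, Matrix.transpose_mul,
    Matrix.transpose_transpose]
  set u₀ := (U₀ : Matrix (Fin 2) (Fin 2) ℂ)
  set v₀ := (V₀ : Matrix (Fin 2) (Fin 2) ℂ)
  set u₁ := (U₁ : Matrix (Fin 2) (Fin 2) ℂ)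
  set v₁ := (V₁ : Matrix (Fin 2) (Fin 2) ℂ)
  set u₂ := (U₂ : Matrix (Fin 2) (Fin 2) ℂ)
  set v₂ := (V₂ : Matrix (Fin 2) (Fin 2) ℂ)
  have e₀ : v₀ᵀ * v₀.map star = 1 := V₀.transpose_mul_map_star
  have e₁ : u₁ᴴ * u₁ = 1 := U₁.conjTranspose_mul
  have e₂ : v₁ᵀ * v₁.map star = 1 := V₁.transpose_mul_map_star
  have e₃ : u₂ᴴ * u₂ = 1 := U₂.conjTranspose_mul
  calc _ = u₀ * schmidtMat α * (v₀ᵀ * v₀.map star) * ampMat (bellVec i) * (u₁ᴴ * u₁) * ampMat c *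
      (v₁ᵀ * v₁.map star) * ampMat (bellVec j) * (u₂ᴴ * u₂) * schmidtMat β * v₂ᵀ := by
        simp only [Matrix.mul_assoc]
    _ = u₀ * (schmidtMat α * ampMat (bellVec i)) * ampMat c *
        (ampMat (bellVec j) * schmidtMat β) * v₂ᵀ := by
        rw [e₀, e₁, e₂, e₃]
        simp only [Matrix.mul_assoc, Matrix.mul_one]
    _ = _ := by
        rw [schmidtMat_mul_bellVec, bellVec_mul_schmidtMat]
        simp only [Matrix.mul_smul, Matrix.smul_mul, smul_smul, h2, Matrix.mul_assoc]

/-- The weight of `u₀ ⊗ v₁` after the Bell measurements. -/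
def bellQ (α β q : ℝ) (i j : Fin 4) : ℝ := q * (bellFst α i * bellSnd β j / 2) ^ 2

/-- The amplitude of `u₀ ⊗ v₀` after the Bell measurements. -/
def bellX (α β x : ℝ) (i j : Fin 4) : ℝ := x * (bellFst α i * bellFst β j / 2)

/-- The amplitude of `u₁ ⊗ v₁` after the Bell measurements. -/
def bellZ (α β z : ℝ) (i j : Fin 4) : ℝ := z * (bellSnd α i * bellSnd β j / 2)

lemma bellFst_nonneg (α : ℝ) (i : Fin 4) : 0 ≤ bellFst α i := by
  fin_cases i <;> simp [bellFst, Real.sqrt_nonneg]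

lemma bellSnd_nonneg (α : ℝ) (i : Fin 4) : 0 ≤ bellSnd α i := by
  fin_cases i <;> simp [bellSnd, Real.sqrt_nonneg]

lemma bellFilter_q (α β : ℝ) {q : ℝ} (hq : 0 ≤ q) (i j : Fin 4) :
    (1 / 2 : ℂ) • (bellFilter α i * !![0, ((Real.sqrt q : ℝ) : ℂ); 0, 0] * bellFilter β j) =
      !![0, ((Real.sqrt (bellQ α β q i j) : ℝ) : ℂ); 0, 0] := by
  have h : Real.sqrt (bellQ α β q i j) = Real.sqrt q * (bellFst α i * bellSnd β j / 2) := by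
    rw [bellQ, Real.sqrt_mul hq, Real.sqrt_sq]
    exact div_nonneg (mul_nonneg (bellFst_nonneg _ _) (bellSnd_nonneg _ _)) zero_le_two
  rw [h]
  ext a b
  fin_cases a <;> fin_cases b <;> simp [bellFilter]
  ring

lemma bellFilter_xz (α β x z : ℝ) (i j : Fin 4) :
    (1 / 2 : ℂ) • (bellFilter α i * !![(x : ℂ), 0; 0, (z : ℂ)] * bellFilter β j) =
      !![(bellX α β x i j : ℂ), 0; 0, (bellZ α β z i j : ℂ)] := by
  ext a b
  fin_cases a <;> fin_cases b <;>
    simp [bellFilter, bellX, bellZ] <;> ring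

/-- The filtered mixtures satisfy the hypotheses on the parameters of a mixture. -/
lemma bell_parameters {α β q x z : ℝ} (hα : α ∈ Set.Ico (1 / 2 : ℝ) 1)
    (hβ : β ∈ Set.Ico (1 / 2 : ℝ) 1) (hq : 0 < q) (hx : 0 ≤ x) (hz : 0 ≤ z)
    (h : x * z * (Real.sqrt α * Real.sqrt β) ≤ q * (Real.sqrt (1 - α) * Real.sqrt (1 - β)))
    (i j : Fin 4) :
    0 < bellQ α β q i j ∧ 0 ≤ bellX α β x i j ∧ 0 ≤ bellZ α β z i j ∧
      bellX α β x i j * bellZ α β z i j ≤ bellQ α β q i j := by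
  have hb : ∀ {γ : ℝ}, γ ∈ Set.Ico (1 / 2 : ℝ) 1 → 0 < Real.sqrt (1 - γ) ∧
      Real.sqrt (1 - γ) ≤ Real.sqrt γ := fun hγ =>
    ⟨Real.sqrt_pos.mpr (by linarith [hγ.2]), Real.sqrt_le_sqrt (by linarith [hγ.1])⟩
  obtain ⟨a1, a2⟩ := hb hα
  obtain ⟨b1, b2⟩ := hb hβ
  have ha : 0 < bellFst α i ∧ Real.sqrt (1 - α) ≤ bellFst α i ∧ bellSnd α i ≤ Real.sqrt α := by
    fin_cases i <;> simp [bellFst, bellSnd, a2, a1, a1.trans_le a2]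
  have hb' : 0 < bellSnd β j ∧ Real.sqrt (1 - β) ≤ bellSnd β j ∧ bellFst β j ≤ Real.sqrt β := by
    fin_cases j <;> simp [bellFst, bellSnd, b2, b1, b1.trans_le b2]
  have n1 := bellSnd_nonneg α i
  have n2 := bellFst_nonneg β j
  -- This is the required inequality divided by `bellFst α i * bellSnd β j / 4`. It is tightest when
  -- those two entries are √(1-α) and √(1-β), which is the hypothesis `h`.
  have hkey : x * z * (bellSnd α i * bellFst β j) ≤ q * (bellFst α i * bellSnd β j) := by
    calc _ ≤ x * z * (Real.sqrt α * Real.sqrt β) := by gcongr; exacts [ha.2.2, hb'.2.2]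
      _ ≤ _ := h
      _ ≤ _ := mul_le_mul_of_nonneg_left (mul_le_mul ha.2.1 hb'.2.1 b1.le ha.1.le) hq.le
  refine ⟨?_, ?_, ?_, ?_⟩
  · have := mul_pos ha.1 hb'.1
    rw [bellQ]; positivity
  · exact mul_nonneg hx (div_nonneg (mul_nonneg ha.1.le n2) zero_le_two)
  · exact mul_nonneg hz (div_nonneg (mul_nonneg n1 hb'.1.le) zero_le_two)
  · have := mul_le_mul_of_nonneg_right hkey
      (div_nonneg (mul_nonneg ha.1.le hb'.1.le) (by norm_num : (0 : ℝ) ≤ 4))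
    simp only [bellQ, bellX, bellZ]
    linarith

/-- The Bell measurements preserve the optimal fully entangled fraction on average. -/
lemma sum_bell_value {α β q x z : ℝ} (hα : α ∈ Set.Ico (1 / 2 : ℝ) 1)
    (hβ : β ∈ Set.Ico (1 / 2 : ℝ) 1) (hq : 0 < q) :
    ∑ i, ∑ j, (bellQ α β q i j + bellX α β x i j ^ 2 + bellZ α β z i j ^ 2 +
      (bellX α β x i j * bellZ α β z i j) ^ 2 / bellQ α β q i j) / 2 =
      (q + x ^ 2 + z ^ 2 + (x * z) ^ 2 / q) / 2 := by
  have hpos : ∀ {γ : ℝ}, γ ∈ Set.Ico (1 / 2 : ℝ) 1 → ∀ i,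
      bellFst γ i ≠ 0 ∧ bellSnd γ i ≠ 0 := by
    intro γ hγ i
    have h1 := (Real.sqrt_pos.mpr (by linarith [hγ.1] : 0 < γ)).ne'
    have h2 := (Real.sqrt_pos.mpr (by linarith [hγ.2] : 0 < 1 - γ)).ne'
    fin_cases i <;> simp only [bellFst, bellSnd] <;> simp [h1, h2]
  -- Each term is multiplied by one squared entry per node. Over the four outcomes of a node these
  -- sum to 2, so the total factor 4/8 restores the prefactor 1/2.
  have hterm : ∀ i j, (bellQ α β q i j + bellX α β x i j ^ 2 + bellZ α β z i j ^ 2 +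
      (bellX α β x i j * bellZ α β z i j) ^ 2 / bellQ α β q i j) / 2 =
      (q * (bellFst α i ^ 2 * bellSnd β j ^ 2) + x ^ 2 * (bellFst α i ^ 2 * bellFst β j ^ 2) +
        z ^ 2 * (bellSnd α i ^ 2 * bellSnd β j ^ 2) +
        (x * z) ^ 2 / q * (bellSnd α i ^ 2 * bellFst β j ^ 2)) / 8 := by
    intro i j
    obtain ⟨_, _⟩ := hpos hα i
    obtain ⟨_, _⟩ := hpos hβ j
    simp only [bellQ, bellX, bellZ]
    field_simp
    ring
  have hs : ∀ {γ : ℝ}, γ ∈ Set.Ico (1 / 2 : ℝ) 1 → Real.sqrt γ ^ 2 = γ ∧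
      Real.sqrt (1 - γ) ^ 2 = 1 - γ := fun hγ =>
    ⟨Real.sq_sqrt (by linarith [hγ.1]), Real.sq_sqrt (by linarith [hγ.2])⟩
  simp only [hterm, Fin.sum_univ_four]
  simp [bellFst, bellSnd, (hs hα).1, (hs hα).2, (hs hβ).1, (hs hβ).2]
  ring

end Bell

/-! ### The average over the Bell outcomes -/

section Average

lemma chainVec_two_apply (a w b : Fin 2 × Fin 2 → ℂ) (s q r : Fin 2 × Fin 2) :
    chainVec (n := 2) ![a, w, b] (mkIdx s.1 ![q, r] s.2) =
      a (s.1, q.1) * w (q.2, r.1) * b (r.2, s.2) := by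
  have l0 : leftBit (mkIdx (n := 2) s.1 ![q, r] s.2) 0 = s.1 := rfl
  have l1 : leftBit (mkIdx (n := 2) s.1 ![q, r] s.2) 1 = q.2 :=
    (leftBit_succ (n := 2) _ 0).trans (by simp)
  have l2 : leftBit (mkIdx (n := 2) s.1 ![q, r] s.2) 2 = r.2 :=
    (leftBit_succ (n := 2) _ 1).trans (by simp)
  have r0 : rightBit (mkIdx (n := 2) s.1 ![q, r] s.2) 0 = q.1 :=
    (rightBit_castSucc (n := 2) _ 0).trans (by simp)
  have r1 : rightBit (mkIdx (n := 2) s.1 ![q, r] s.2) 1 = r.1 :=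
    (rightBit_castSucc (n := 2) _ 1).trans (by simp)
  have r2 : rightBit (mkIdx (n := 2) s.1 ![q, r] s.2) 2 = s.2 :=
    rightBit_last (n := 2) _
  rw [chainVec, Fin.prod_univ_three, l0, l1, l2, r0, r1, r2]
  rfl

lemma chainState_two_apply (a w b : Fin 2 × Fin 2 → ℂ) (s t : Fin 2 × Fin 2)
    (q r q' r' : Fin 2 × Fin 2) :
    chainState (n := 2) (fun i => proj ((![a, w, b] : Fin 3 → Fin 2 × Fin 2 → ℂ) i))
      (mkIdx s.1 ![q, r] s.2) (mkIdx t.1 ![q', r'] t.2) =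
      (a (s.1, q.1) * w (q.2, r.1) * b (r.2, s.2)) *
        star (a (t.1, q'.1) * w (q'.2, r'.1) * b (r'.2, t.2)) := by
  rw [chainState_proj_eq_rankOne, rankOne, Matrix.vecMulVec_apply, Pi.star_apply,
    chainVec_two_apply, chainVec_two_apply]

/-- The partial trace counterpart of the contraction in `nodeOp_link`, for the two nodes at once. -/
lemma projectNodes_proj (f g a w b : Fin 2 × Fin 2 → ℂ) :
    projectNodes f g (chainState (n := 2)
      (fun i => proj ((![a, w, b] : Fin 3 → Fin 2 × Fin 2 → ℂ) i))) =
      proj (matVec (ampMat a * (ampMat f).map star * ampMat w * (ampMat g).map star *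
        ampMat b)) := by
  have hval : ∀ s : Fin 2 × Fin 2, matVec (ampMat a * (ampMat f).map star * ampMat w *
      (ampMat g).map star * ampMat b) s =
      ∑ q, ∑ r, star (f q) * star (g r) * (a (s.1, q.1) * w (q.2, r.1) * b (r.2, s.2)) := by
    intro s
    simp only [matVec, Matrix.mul_apply, Fintype.sum_prod_type, Fin.sum_univ_two, Matrix.map_apply,
      ampMat_apply]
    ring
  ext s t
  simp only [projectNodes, Matrix.of_apply, chainState_two_apply]
  rw [proj, Matrix.vecMulVec_apply, Pi.star_apply, hval, hval]
  have hterm : ∀ q r q' r', star (f q) * star (g r) *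
      (a (s.1, q.1) * w (q.2, r.1) * b (r.2, s.2) *
        star (a (t.1, q'.1) * w (q'.2, r'.1) * b (r'.2, t.2))) * f q' * g r' =
      star (f q) * star (g r) * (a (s.1, q.1) * w (q.2, r.1) * b (r.2, s.2)) *
        star (star (f q') * star (g r') * (a (t.1, q'.1) * w (q'.2, r'.1) * b (r'.2, t.2))) := by
    intro q r q' r'
    simp only [star_mul', star_star]
    ring
  simp only [hterm, ← Finset.mul_sum, ← Finset.sum_mul, star_sum]

lemma projectNodes_add (f g : Fin 2 × Fin 2 → ℂ) (X Y : Op (chainDims 2)) :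
    projectNodes f g (X + Y) = projectNodes f g X + projectNodes f g Y := by
  ext s t
  simp only [projectNodes, Matrix.of_apply, Matrix.add_apply, mul_add, add_mul,
    Finset.sum_add_distrib]

lemma outcomeProb_mixState {q : ℝ} (hq : 0 ≤ q) (x z : ℝ) (U V : QubitBasis) :
    outcomeProb (mixState q x z U V) = q + x ^ 2 + z ^ 2 := by
  have h : ∀ v : Fin 2 × Fin 2 → ℂ, (proj v).trace.re = sqNorm v := by
    intro v
    rw [proj, Matrix.trace_vecMulVec, dotProduct_comm, ← sqNorm_eq, Complex.ofReal_re]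
  rw [outcomeProb, mixState, Matrix.trace_add, Complex.add_re, h, h, sqNorm_inBasis,
    sqNorm_inBasis]
  simp [sqNorm, Fintype.sum_prod_type, matVec, Complex.normSq_ofReal, Real.mul_self_sqrt hq]
  ring

lemma smul_proj_inBasis (r : ℝ) (hr : 0 ≤ r) (U V : QubitBasis) (c : Fin 2 × Fin 2 → ℂ) :
    (r : ℂ) • proj (inBasis U V c) = proj (inBasis U V (((Real.sqrt r : ℝ) : ℂ) • c)) := by
  have h : ((Real.sqrt r : ℝ) : ℂ) * star ((Real.sqrt r : ℝ) : ℂ) = (r : ℂ) := by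
    rw [Complex.star_def, Complex.conj_ofReal, ← Complex.ofReal_mul, Real.mul_self_sqrt hr]
  have := rankOne_smul ((Real.sqrt r : ℝ) : ℂ) (inBasis U V c)
  rw [h] at this
  have e : inBasis U V (((Real.sqrt r : ℝ) : ℂ) • c) =
      ((Real.sqrt r : ℝ) : ℂ) • inBasis U V c := Matrix.mulVec_smul _ _ _
  rw [e]
  exact this.symm

lemma smul_mixState {r : ℝ} (hr : 0 ≤ r) {q : ℝ} (x z : ℝ) (U V : QubitBasis) :
    (r : ℂ) • mixState q x z U V =
      mixState (r * q) (Real.sqrt r * x) (Real.sqrt r * z) U V := by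
  rw [mixState, smul_add, smul_proj_inBasis r hr, smul_proj_inBasis r hr, mixState]
  congr 3
  · funext s
    obtain ⟨i, j⟩ := s
    fin_cases i <;> fin_cases j <;> simp [matVec, Real.sqrt_mul hr]
  · funext s
    obtain ⟨i, j⟩ := s
    fin_cases i <;> fin_cases j <;> simp [matVec]

/-- The value is homogeneous of degree one in the state, and so is the condition xz ≤ q. The
normalisation therefore cancels against the probability. -/
lemma outcomeProb_mul_ofef (U V : QubitBasis) {q x z : ℝ} (hq : 0 < q) (hx : 0 ≤ x) (hz : 0 ≤ z)
    (hxz : x * z ≤ q) :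
    outcomeProb (mixState q x z U V) * ofef (outcomeState (mixState q x z U V)) =
      (q + x ^ 2 + z ^ 2 + (x * z) ^ 2 / q) / 2 := by
  have hT : 0 < q + x ^ 2 + z ^ 2 := by positivity
  have hr : 0 < (q + x ^ 2 + z ^ 2)⁻¹ := inv_pos.mpr hT
  have hss := Real.mul_self_sqrt hr.le
  rw [outcomeState, outcomeProb_mixState hq.le, ← Complex.ofReal_inv, smul_mixState hr.le,
    ofef_mixState U V (by positivity) (by positivity) (by positivity)]
  · generalize Real.sqrt (q + x ^ 2 + z ^ 2)⁻¹ = s at hss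
    have hs2 : s ^ 2 = (q + x ^ 2 + z ^ 2)⁻¹ := by rw [sq, hss]
    have h1 : (s * x) ^ 2 = (q + x ^ 2 + z ^ 2)⁻¹ * x ^ 2 := by rw [mul_pow, hs2]
    have h2 : (s * z) ^ 2 = (q + x ^ 2 + z ^ 2)⁻¹ * z ^ 2 := by rw [mul_pow, hs2]
    rw [mul_pow (s * x) (s * z), h1, h2]
    field_simp
  · calc _ = Real.sqrt (q + x ^ 2 + z ^ 2)⁻¹ * Real.sqrt (q + x ^ 2 + z ^ 2)⁻¹ * (x * z) := by ring
      _ = (q + x ^ 2 + z ^ 2)⁻¹ * (x * z) := by rw [hss]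
      _ ≤ _ := mul_le_mul_of_nonneg_left hxz hr.le

/-- The Bell measurements at the nodes of a two-node chain. -/
lemma bellAverageOFEF_mixState {α β q x z : ℝ} (hα : α ∈ Set.Ico (1 / 2 : ℝ) 1)
    (hβ : β ∈ Set.Ico (1 / 2 : ℝ) 1) (hq : 0 < q) (hx : 0 ≤ x) (hz : 0 ≤ z)
    (h : x * z * (Real.sqrt α * Real.sqrt β) ≤ q * (Real.sqrt (1 - α) * Real.sqrt (1 - β)))
    (U V : Fin 3 → QubitBasis) :
    bellAverageOFEF ![pureState α (U 0) (V 0), mixState q x z (U 1) (V 1),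
      pureState β (U 2) (V 2)] U V = (q + x ^ 2 + z ^ 2 + (x * z) ^ 2 / q) / 2 := by
  rw [bellAverageOFEF, ← sum_bell_value hα hβ hq]
  refine Finset.sum_congr rfl fun i _ => Finset.sum_congr rfl fun j _ => ?_
  obtain ⟨h1, h2, h3, h4⟩ := bell_parameters hα hβ hq hx hz h i j
  rw [← outcomeProb_mul_ofef (U 0 * bellUnitary i) (V 2 * (bellUnitary j).transpose) h1 h2 h3 h4]
  have hτ : projectNodes (inBasis (V 0) (U 1) (bellVec i)) (inBasis (V 1) (U 2) (bellVec j))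
      (chainState (n := 2) ![pureState α (U 0) (V 0), mixState q x z (U 1) (V 1),
      pureState β (U 2) (V 2)]) = mixState (bellQ α β q i j) (bellX α β x i j)
        (bellZ α β z i j) (U 0 * bellUnitary i) (V 2 * (bellUnitary j).transpose) := by
    have hσ : ![pureState α (U 0) (V 0), mixState q x z (U 1) (V 1), pureState β (U 2) (V 2)] =
        Function.update (fun s => proj ((![inBasis (U 0) (V 0) (schmidtVec α), 0,
          inBasis (U 2) (V 2) (schmidtVec β)] : Fin 3 → Fin 2 × Fin 2 → ℂ) s)) 1
          (mixState q x z (U 1) (V 1)) := by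
      funext s
      fin_cases s <;> rfl
    have hupd : ∀ c : Fin 2 × Fin 2 → ℂ, Function.update ![inBasis (U 0) (V 0) (schmidtVec α), 0,
        inBasis (U 2) (V 2) (schmidtVec β)] 1 c = ![inBasis (U 0) (V 0) (schmidtVec α), c,
        inBasis (U 2) (V 2) (schmidtVec β)] := by
      intro c
      funext s
      fin_cases s <;> rfl
    rw [hσ, chainState_update_mixState, projectNodes_add, hupd, hupd, projectNodes_proj,
      projectNodes_proj, swap_bellVec, swap_bellVec, ampMat_matVec, ampMat_matVec,
      bellFilter_q α β hq.le, bellFilter_xz, matVec_ampMat, matVec_ampMat, mixState]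
  simp only [hτ]

end Average

/-! ### The chain with one mixed segment, and the embedded two-node chain -/

section Chain

variable {n : ℕ}

lemma inBasis_one (c : Fin 2 × Fin 2 → ℂ) : inBasis 1 1 c = c := by
  simp [inBasis]

lemma sqNorm_schmidtVec {α : ℝ} (h : α ∈ Set.Ico (1 / 2 : ℝ) 1) : sqNorm (schmidtVec α) = 1 := by
  simp [sqNorm, Fintype.sum_prod_type, schmidtVec, Complex.normSq_ofReal,
    Real.mul_self_sqrt (by linarith [h.1] : 0 ≤ α),
    Real.mul_self_sqrt (by linarith [h.2] : 0 ≤ 1 - α)]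

/-- The optimal fully entangled fraction of a chain with one mixed segment. -/
lemma isGreatest_achievableFEF_chain {m : Fin (n + 1)} {k l : Fin n} (hk : m = k.succ)
    (hl : m = l.castSucc) {α : Fin (n + 1) → ℝ} (hα : ∀ s, s ≠ m → α s ∈ Set.Ico (1 / 2 : ℝ) 1)
    (w : Fin (n + 1) → Fin 2 × Fin 2 → ℂ) (hw : ∀ s, s ≠ m → HasSchmidt (ampMat (w s)) (α s))
    (hw1 : ∀ s, s ≠ m → sqNorm (w s) = 1) (hαl : alphaLeft m α ∈ Set.Ico (1 / 2 : ℝ) 1)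
    (hαr : alphaRight m α ∈ Set.Ico (1 / 2 : ℝ) 1) {q x z : ℝ} (hq : 0 < q) (hx : 0 ≤ x)
    (hz : 0 ≤ z) (U V : QubitBasis)
    (h : x * z * (Real.sqrt (alphaLeft m α) * Real.sqrt (alphaRight m α)) ≤
      q * (Real.sqrt (1 - alphaLeft m α) * Real.sqrt (1 - alphaRight m α))) :
    IsGreatest (achievableFEF (Function.update (fun s => proj (w s)) m (mixState q x z U V)))
      ((q + x ^ 2 + z ^ 2 + (x * z) ^ 2 / q) / 2) := by
  refine isGreatest_achievableFEF (fun Λ hΛ φ hφ => hΛ.overlap_chain_le m w hw1 U V hq x z hφ) ?_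
  obtain ⟨Λ₁, h₁, h₁'⟩ := exists_isLOCC_reduce hk hl hα w hw
  have hpar := bell_parameters hαl hαr hq hx hz h
  choose Λ hΛ hΛ' using fun i j => exists_isLOCC_overlap_mixState (n := n)
    (1 * bellUnitary i) (1 * (bellUnitary j).transpose) (hpar i j).1 (hpar i j).2.1
    (hpar i j).2.2.1 (hpar i j).2.2.2
  obtain ⟨Λ₂, h₂, h₂'⟩ := exists_isLOCC_measure_reduced (hk.symm.trans hl)
    (sum_rankOne_inBasis sum_rankOne_bellVec 1 U) (sum_rankOne_inBasis sum_rankOne_bellVec V 1)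
    (schmidtMat (alphaLeft m α)) (schmidtMat (alphaRight m α)) Λ hΛ
  refine ⟨_, h₁.comp h₂, ?_⟩
  obtain ⟨L₁, hL₁⟩ := h₁.exists_linear
  obtain ⟨L₂, hL₂⟩ := h₂.exists_linear
  have hmap : ∀ X Y, Λ₂ (Λ₁ (X + Y)) = Λ₂ (Λ₁ X) + Λ₂ (Λ₁ Y) := fun X Y => by
    simp only [hL₁, hL₂, map_add]
  have hbell : ∀ (i j : Fin 4) c, link (0, false) (Fin.last n, true)
      (schmidtMat (alphaLeft m α) * (ampMat (inBasis 1 U (bellVec i))).map star *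
        ampMat (inBasis U V c) * (ampMat (inBasis V 1 (bellVec j))).map star *
        schmidtMat (alphaRight m α)) * ∏ t ∈ innerSlots 0 (Fin.last n), zeroAt t =
      sharedVec (inBasis (1 * bellUnitary i) (1 * (bellUnitary j).transpose)
        (matVec ((1 / 2 : ℂ) • (bellFilter (alphaLeft m α) i * ampMat c *
          bellFilter (alphaRight m α) j)))) := by
    intro i j c
    have hswap := swap_bellVec 1 1 U V 1 1 (alphaLeft m α) (alphaRight m α) c i j
    rw [inBasis_one (schmidtVec _), inBasis_one (schmidtVec _), ampMat_schmidtVec,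
      ampMat_schmidtVec] at hswap
    rw [sharedVec, ← hswap]
  have hΛadd : ∀ i j X Y, Λ i j X + Λ i j Y = Λ i j (X + Y) := fun i j X Y => by
    obtain ⟨L, hL⟩ := (hΛ i j).exists_linear
    simp only [hL, map_add]
  rw [chainState_update_mixState, hmap, h₁', h₁', h₂', h₂', ← sum_bell_value hαl hαr hq]
  simp only [hbell, ← Finset.sum_add_distrib, hΛadd]
  simp only [endState_sum, overlap_sum, ampMat_matVec, bellFilter_q _ _ hq.le, bellFilter_xz, hΛ']

/-- Identifies the vector left by the side-chain protocol with the embedded two-node chain. -/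
lemma placeTwoNode_mulVec {m : Fin (n + 1)} {k l : Fin n} (hk : m = k.succ) (hl : m = l.castSucc)
    (a w b : Fin 2 × Fin 2 → ℂ) :
    placeTwoNode m *ᵥ chainVec (n := 2) ![a, w, b] =
      reducedVec k l (ampMat a) (ampMat w) (ampMat b) ∘ slotBits := by
  funext y
  have hkl : (l : ℕ) = k + 1 := by
    have := congrArg Fin.val (hk.symm.trans hl)
    simpa using this.symm
  have hplace : ∀ x, placeTwoNode m y x = if y = mkIdx (aliceEquiv.symm (x .alice))
      (fun j => if j = k then nodeBits x 0 else if j = l then nodeBits x 1 else (0, 0))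
      (bobEquiv.symm (x .bob)) then 1 else 0 := by
    intro x
    have hfun : (fun j : Fin n => if (j : ℕ) + 1 = m then nodeBits x 0 else
        if (j : ℕ) = m then nodeBits x 1 else (0, 0)) =
        fun j => if j = k then nodeBits x 0 else if j = l then nodeBits x 1 else (0, 0) := by
      funext j
      have h1 : ((j : ℕ) + 1 = m) = (j = k) := by
        rw [hk]; simp [Fin.ext_iff]
      have h2 : ((j : ℕ) = m) = (j = l) := by
        rw [hl]; simp [Fin.ext_iff]
      simp only [h1, h2]
    rw [← hfun]
    rfl
  have hlk : l ≠ k := by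
    intro h; rw [h] at hkl; omega
  -- The only two-node label that can be placed at y.
  let x₀ : Idx (chainDims 2) := mkIdx (aliceEquiv.symm (y .alice)) ![nodeBits y k, nodeBits y l]
    (bobEquiv.symm (y .bob))
  have hx₀ : ∀ x, y = mkIdx (aliceEquiv.symm (x .alice))
      (fun j => if j = k then nodeBits x 0 else if j = l then nodeBits x 1 else (0, 0))
      (bobEquiv.symm (x .bob)) → x = x₀ := by
    intro x hx
    have h1 : aliceEquiv.symm (y .alice) = aliceEquiv.symm (x .alice) := by
      rw [hx, mkIdx_alice, Equiv.symm_apply_apply]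
    have h2 : bobEquiv.symm (y .bob) = bobEquiv.symm (x .bob) := by
      rw [hx, mkIdx_bob, Equiv.symm_apply_apply]
    have h3 : nodeBits y k = nodeBits x 0 := by
      rw [hx, nodeBits_mkIdx, if_pos rfl]
    have h4 : nodeBits y l = nodeBits x 1 := by
      rw [hx, nodeBits_mkIdx, if_neg hlk, if_pos rfl]
    funext j
    cases j with
    | alice =>
      change _ = aliceEquiv (aliceEquiv.symm (y .alice))
      rw [h1, Equiv.apply_symm_apply]
    | bob =>
      change _ = bobEquiv (bobEquiv.symm (y .bob))
      rw [h2, Equiv.apply_symm_apply]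
    | node j =>
      change _ = nodeEquiv j (![nodeBits y k, nodeBits y l] j)
      rw [h3, h4]
      fin_cases j
      · exact ((nodeEquiv (n := 2) 0).apply_symm_apply _).symm
      · exact ((nodeEquiv (n := 2) 1).apply_symm_apply _).symm
  have hvec : chainVec (n := 2) ![a, w, b] x₀ =
      a (aliceEquiv.symm (y .alice), (nodeBits y k).1) *
        w ((nodeBits y k).2, (nodeBits y l).1) *
        b ((nodeBits y l).2, bobEquiv.symm (y .bob)) :=
    chainVec_two_apply a w b (aliceEquiv.symm (y .alice), bobEquiv.symm (y .bob)) _ _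
  simp only [Matrix.mulVec, dotProduct, hplace, ite_mul, one_mul, zero_mul]
  rw [Finset.sum_eq_single x₀ (fun x _ hx => if_neg fun h => hx (hx₀ x h)) (by simp)]
  have hred : (reducedVec k l (ampMat a) (ampMat w) (ampMat b) ∘ slotBits) y =
      chainVec (n := 2) ![a, w, b] x₀ * ((∏ t ∈ innerSlots 0 k.castSucc, zeroAt t) (slotBits y) *
        (∏ t ∈ innerSlots l.succ (Fin.last n), zeroAt t) (slotBits y)) := by
    rw [hvec]
    simp only [reducedVec, Function.comp_apply, Pi.mul_apply, link, slotBits_false, slotBits_true,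
      leftBit_zero, leftBit_succ, rightBit_castSucc, rightBit_last, ampMat_apply]
    ring
  rw [hred]
  -- If some other node is not in |00⟩, both sides vanish; otherwise only `x₀` contributes.
  by_cases H : ∀ j, j ≠ k → j ≠ l → nodeBits y j = (0, 0)
  · rw [if_pos, Finset.prod_apply, Finset.prod_apply, Finset.prod_eq_one, Finset.prod_eq_one,
      mul_one, mul_one]
    · rintro ⟨s, c⟩ ht
      cases c with
      | false =>
        rw [mem_innerSlots_false] at ht
        obtain ⟨j, rfl⟩ := Fin.exists_succ_eq.mpr ((Fin.zero_le _).trans_lt ht.1).ne'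
        have hj := H j (by
            rintro rfl
            simp only [Fin.lt_def, Fin.le_def, Fin.val_succ, Fin.val_last] at ht
            omega)
          (by rintro rfl; exact lt_irrefl _ ht.1)
        simp [zeroAt, hj]
      | true =>
        rw [mem_innerSlots_true] at ht
        obtain ⟨j, rfl⟩ := Fin.exists_castSucc_eq.mpr ht.2.ne
        have hj := H j (by
            rintro rfl
            simp only [Fin.lt_def, Fin.le_def, Fin.val_succ, Fin.val_castSucc, Fin.val_last] at ht
            omega)
          (by
              rintro rfl
              simp only [Fin.lt_def, Fin.le_def, Fin.val_succ, Fin.val_castSucc, Fin.val_last] at ht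
              omega)
        simp [zeroAt, hj]
    · rintro ⟨s, c⟩ ht
      cases c with
      | false =>
        rw [mem_innerSlots_false] at ht
        obtain ⟨j, rfl⟩ := Fin.exists_succ_eq.mpr ht.1.ne'
        have hj := H j (by
            rintro rfl
            simp only [Fin.lt_def, Fin.le_def, Fin.val_succ, Fin.val_castSucc, Fin.val_zero] at ht
            omega)
          (by
              rintro rfl
              simp only [Fin.lt_def, Fin.le_def, Fin.val_succ, Fin.val_castSucc, Fin.val_zero] at ht
              omega)
        simp [zeroAt, hj]
      | true =>
        rw [mem_innerSlots_true] at ht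
        obtain ⟨j, rfl⟩ := Fin.exists_castSucc_eq.mpr (ht.2.trans_le (Fin.le_last _)).ne
        have hj := H j (by rintro rfl; exact lt_irrefl _ ht.2)
          (by
              rintro rfl
              simp only [Fin.lt_def, Fin.le_def, Fin.val_castSucc, Fin.val_zero] at ht
              omega)
        simp [zeroAt, hj]
    · funext j
      cases j with
      | alice => rfl
      | bob => rfl
      | node j =>
        have hx0 : nodeBits x₀ 0 = nodeBits y k := nodeBits_mkIdx _ _ _ _
        have hx1 : nodeBits x₀ 1 = nodeBits y l := nodeBits_mkIdx _ _ _ _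
        rw [mkIdx_node, hx0, hx1, ← Equiv.symm_apply_eq, ← nodeBits_eq]
        split_ifs with h1 h2
        · rw [h1]
        · rw [h2]
        · exact H j h1 h2
  · rw [if_neg]
    · push Not at H
      obtain ⟨j, hjk, hjl, hj⟩ := H
      have hjk' : (j : ℕ) ≠ k := fun h => hjk (Fin.ext h)
      have hjl' : (j : ℕ) ≠ l := fun h => hjl (Fin.ext h)
      have hjn := j.isLt
      rw [Ne, Prod.ext_iff, not_and_or] at hj
      symm
      -- As l directly follows k, such a node lies in the left or in the right side chain, and its
      -- nonzero bit kills the corresponding product.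
      rcases lt_or_gt_of_ne hjk' with hlt | hgt
      · rw [Finset.prod_apply]
        rcases hj with h | h
        · rw [Finset.prod_eq_zero (i := (j.castSucc, true))
            (by
              rw [mem_innerSlots_true]
              simp only [Fin.lt_def, Fin.le_def, Fin.val_castSucc, Fin.val_zero]
              omega) (if_neg (by simpa using h))]
          simp
        · rw [Finset.prod_eq_zero (i := (j.succ, false))
            (by
              rw [mem_innerSlots_false]
              simp only [Fin.lt_def, Fin.le_def, Fin.val_succ, Fin.val_castSucc, Fin.val_zero]
              omega) (if_neg (by simpa using h))]
          simp
      · rw [Finset.prod_apply (s := innerSlots l.succ (Fin.last n))]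
        rcases hj with h | h
        · rw [Finset.prod_eq_zero (s := innerSlots l.succ (Fin.last n)) (i := (j.castSucc, true))
            (by
              rw [mem_innerSlots_true]
              simp only [Fin.lt_def, Fin.le_def, Fin.val_succ, Fin.val_castSucc, Fin.val_last]
              omega)
            (if_neg (by simpa using h))]
          simp
        · rw [Finset.prod_eq_zero (s := innerSlots l.succ (Fin.last n)) (i := (j.succ, false))
            (by
              rw [mem_innerSlots_false]
              simp only [Fin.lt_def, Fin.le_def, Fin.val_succ, Fin.val_last]
              omega)
            (if_neg (by simpa using h))]
          simp
    · intro hy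
      apply H
      intro j h1 h2
      rw [hy, nodeBits_mkIdx, if_neg h1, if_neg h2]

end Chain

/-! ### The noisy state and condition (*) -/

section Noisy

lemma noisyState_eq_mixState {p δ : ℝ} (hp : p ∈ Set.Icc (0 : ℝ) 1) (U V : QubitBasis) :
    noisyState p δ U V = mixState p (Real.sqrt (1 - p) * Real.sqrt δ)
      (Real.sqrt (1 - p) * Real.sqrt (1 - δ)) U V := by
  rw [noisyState, smul_proj_inBasis p hp.1, smul_proj_inBasis (1 - p) (by linarith [hp.2]),
    mixState]
  congr 3
  · funext ⟨i, j⟩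
    fin_cases i <;> fin_cases j <;> simp [matVec, ket01]
  · funext ⟨i, j⟩
    fin_cases i <;> fin_cases j <;> simp [matVec, schmidtVec]

/-- The condition on the parameters, without division. -/
lemma noisy_condition {p δ αl αr : ℝ} (hp : p ∈ Set.Icc (0 : ℝ) 1)
    (hδ : δ ∈ Set.Ico (1 / 2 : ℝ) 1) (hl : αl ∈ Set.Ico (1 / 2 : ℝ) 1)
    (hr : αr ∈ Set.Ico (1 / 2 : ℝ) 1)
    (h : p = 1 ∨ αl * αr / ((1 - αl) * (1 - αr)) ≤ p ^ 2 / (δ * (1 - δ) * (1 - p) ^ 2)) :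
    0 < p ∧ Real.sqrt (1 - p) * Real.sqrt δ * (Real.sqrt (1 - p) * Real.sqrt (1 - δ)) *
      (Real.sqrt αl * Real.sqrt αr) ≤ p * (Real.sqrt (1 - αl) * Real.sqrt (1 - αr)) := by
  obtain ⟨hp0, hp1⟩ := hp
  obtain ⟨hδ0, hδ1⟩ := hδ
  obtain ⟨hl0, hl1⟩ := hl
  obtain ⟨hr0, hr1⟩ := hr
  rcases h with rfl | h
  · refine ⟨one_pos, ?_⟩
    simp only [sub_self, Real.sqrt_zero, zero_mul]
    positivity
  -- For p = 1 the quotient in `h` is a division by zero and carries no information. The claim holds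
  -- because its left-hand side vanishes.
  by_cases hpe : p = 1
  · subst hpe
    refine ⟨one_pos, ?_⟩
    simp only [sub_self, Real.sqrt_zero, zero_mul]
    positivity
  have hplt : 0 < 1 - p := sub_pos.mpr (lt_of_le_of_ne hp1 hpe)
  have e1 : 0 < 1 - δ := by linarith
  have e2 : 0 < 1 - αl := by linarith
  have e3 : 0 < 1 - αr := by linarith
  have e4 : 0 < δ := by linarith
  have e5 : 0 < αl := by linarith
  have e6 : 0 < αr := by linarith
  rw [div_le_div_iff₀ (by positivity) (by positivity)] at h
  -- For p = 0 the right-hand side of (*) would vanish while the left-hand side is positive.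
  refine ⟨lt_of_le_of_ne hp0 fun h0 => ?_, ?_⟩
  · rw [← h0] at h
    have : 0 < αl * αr * (δ * (1 - δ) * (1 - 0) ^ 2) := by positivity
    linarith
  · refine (sq_le_sq₀ (by positivity) (by positivity)).mp ?_
    have s1 : Real.sqrt (1 - p) ^ 2 = 1 - p := Real.sq_sqrt hplt.le
    simp only [mul_pow, s1, Real.sq_sqrt e4.le, Real.sq_sqrt e1.le, Real.sq_sqrt e2.le,
      Real.sq_sqrt e3.le, Real.sq_sqrt e5.le, Real.sq_sqrt e6.le]
    linarith

/-- Since α ≥ 1/2, condition (*) is stronger than xz ≤ q, so the formula for the optimal fraction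
also applies to the unmeasured noisy state. -/
lemma mul_le_of_sqrt_le {q y αl αr : ℝ} (hq : 0 < q) (hl : αl ∈ Set.Ico (1 / 2 : ℝ) 1)
    (hr : αr ∈ Set.Ico (1 / 2 : ℝ) 1)
    (h : y * (Real.sqrt αl * Real.sqrt αr) ≤ q * (Real.sqrt (1 - αl) * Real.sqrt (1 - αr))) :
    y ≤ q := by
  have h1 : Real.sqrt (1 - αl) ≤ Real.sqrt αl := Real.sqrt_le_sqrt (by linarith [hl.1])
  have h2 : Real.sqrt (1 - αr) ≤ Real.sqrt αr := Real.sqrt_le_sqrt (by linarith [hr.1])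
  have h3 : 0 < Real.sqrt αl := Real.sqrt_pos.mpr (by linarith [hl.1])
  have h4 : 0 < Real.sqrt αr := Real.sqrt_pos.mpr (by linarith [hr.1])
  refine le_of_mul_le_mul_right (h.trans ?_) (mul_pos h3 h4)
  exact mul_le_mul_of_nonneg_left (mul_le_mul h1 h2 (Real.sqrt_nonneg _) h3.le) hq.le

end Noisy

end

end Repeater

/-! ### Assembly of both parts -/

open Repeater
theorem theorem2 (p δ : ℝ) (hp : p ∈ Set.Icc (0 : ℝ) 1) (hδ : δ ∈ Set.Ico (1 / 2 : ℝ) 1) :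
    -- two nodes, with the noisy state in the middle segment
    (∀ αl αr : ℝ, αl ∈ Set.Ico (1 / 2 : ℝ) 1 → αr ∈ Set.Ico (1 / 2 : ℝ) 1 →
      -- for `p = 1` the right-hand side of the condition is `+∞`
      (p = 1 ∨ αl * αr / ((1 - αl) * (1 - αr)) ≤ p ^ 2 / (δ * (1 - δ) * (1 - p) ^ 2)) →
      ∀ U V : Fin 3 → QubitBasis,
        let ρ : TwoQubit := noisyState p δ (U 1) (V 1)
        let σ : Fin 3 → TwoQubit := ![pureState αl (U 0) (V 0), ρ, pureState αr (U 2) (V 2)]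
        bellAverageOFEF σ U V = ofef ρ ∧
          chainOFEF (n := 2) σ = ofef ρ ∧ ofef ρ ∈ achievableFEF (n := 2) σ) ∧
    -- `n` nodes, with the noisy state in an interior segment `m`
    (∀ (n : ℕ) (m : Fin (n + 1)), 0 < m → m < Fin.last n →
      ∀ α : Fin (n + 1) → ℝ, (∀ s, s ≠ m → α s ∈ Set.Ico (1 / 2 : ℝ) 1) →
      ∀ U V : Fin (n + 1) → QubitBasis,
        let ρ : TwoQubit := noisyState p δ (U m) (V m)
        let σ : Fin (n + 1) → TwoQubit := fun s => if s = m then ρ else pureState (α s) (U s) (V s)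
        let αl : ℝ := alphaLeft m α
        let αr : ℝ := alphaRight m α
        -- LOCC reduces the chain deterministically to the two-node chain with parameters `αl, αr`
        (αl ∈ Set.Ico (1 / 2 : ℝ) 1 ∧ αr ∈ Set.Ico (1 / 2 : ℝ) 1 ∧
          ∃ Λ : Op (chainDims n) → Op (chainDims n), IsLOCC Λ ∧
            Λ (chainState σ) =
              placeTwoNode m * chainState (n := 2) ![pureState αl 1 1, ρ, pureState αr 1 1] *
                (placeTwoNode m)ᴴ) ∧
        ((p = 1 ∨ αl * αr / ((1 - αl) * (1 - αr)) ≤ p ^ 2 / (δ * (1 - δ) * (1 - p) ^ 2)) →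
          -- Bell measurements at the two nodes of the reduced chain
          bellAverageOFEF ![pureState αl 1 1, ρ, pureState αr 1 1] ![1, U m, 1] ![1, V m, 1] =
              ofef ρ ∧
            chainOFEF σ = ofef ρ ∧ ofef ρ ∈ achievableFEF σ)) := by
  have hx0 : 0 ≤ Real.sqrt (1 - p) * Real.sqrt δ := by positivity
  have hz0 : 0 ≤ Real.sqrt (1 - p) * Real.sqrt (1 - δ) := by positivity
  -- The optimality claims of both parts are instances of this; part (a) is n = 2, m = 1.
  have main : ∀ (n : ℕ) (m : Fin (n + 1)), 0 < m → m < Fin.last n →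
      ∀ α : Fin (n + 1) → ℝ, (∀ s, s ≠ m → α s ∈ Set.Ico (1 / 2 : ℝ) 1) →
      ∀ U V : Fin (n + 1) → QubitBasis,
      alphaLeft m α ∈ Set.Ico (1 / 2 : ℝ) 1 → alphaRight m α ∈ Set.Ico (1 / 2 : ℝ) 1 →
      (p = 1 ∨ alphaLeft m α * alphaRight m α / ((1 - alphaLeft m α) * (1 - alphaRight m α)) ≤
        p ^ 2 / (δ * (1 - δ) * (1 - p) ^ 2)) →
      IsGreatest (achievableFEF (Function.update
        (fun s => proj (inBasis (U s) (V s) (schmidtVec (α s)))) m (noisyState p δ (U m) (V m))))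
        (ofef (noisyState p δ (U m) (V m))) := by
    intro n m hm0 hmn α hα U V hl hr h
    obtain ⟨k, hk⟩ := Fin.exists_succ_eq.mpr hm0.ne'
    obtain ⟨l, hl'⟩ := Fin.exists_castSucc_eq.mpr hmn.ne
    obtain ⟨hp0, hc⟩ := noisy_condition hp hδ hl hr h
    rw [noisyState_eq_mixState hp, ofef_mixState _ _ hp0 hx0 hz0 (mul_le_of_sqrt_le hp0 hl hr hc)]
    exact isGreatest_achievableFEF_chain hk.symm hl'.symm hα _
      (fun s _ => hasSchmidt_inBasis (α s) (U s) (V s))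
      (fun s hs => by rw [sqNorm_inBasis, sqNorm_schmidtVec (hα s hs)]) hl hr hp0 hx0 hz0 _ _ hc
  have average : ∀ αl αr : ℝ, αl ∈ Set.Ico (1 / 2 : ℝ) 1 → αr ∈ Set.Ico (1 / 2 : ℝ) 1 →
      (p = 1 ∨ αl * αr / ((1 - αl) * (1 - αr)) ≤ p ^ 2 / (δ * (1 - δ) * (1 - p) ^ 2)) →
      ∀ U V : Fin 3 → QubitBasis,
        bellAverageOFEF ![pureState αl (U 0) (V 0), noisyState p δ (U 1) (V 1),
          pureState αr (U 2) (V 2)] U V = ofef (noisyState p δ (U 1) (V 1)) := by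
    intro αl αr hl hr h U V
    obtain ⟨hp0, hc⟩ := noisy_condition hp hδ hl hr h
    rw [noisyState_eq_mixState hp, ofef_mixState _ _ hp0 hx0 hz0 (mul_le_of_sqrt_le hp0 hl hr hc)]
    exact bellAverageOFEF_mixState hl hr hp0 hx0 hz0 hc U V
  refine ⟨?_, ?_⟩
  · intro αl αr hl hr h U V
    dsimp only
    refine ⟨average αl αr hl hr h U V, ?_⟩
    -- The middle entry is arbitrary: neither side product involves the noisy segment.
    let α : Fin 3 → ℝ := ![αl, αl, αr]
    have hα : ∀ s, α s ∈ Set.Ico (1 / 2 : ℝ) 1 := by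
      intro s
      fin_cases s
      exacts [hl, hl, hr]
    have h0 : Finset.univ.filter (· < (1 : Fin 3)) = {0} := by decide
    have h2 : Finset.univ.filter ((1 : Fin 3) < ·) = {2} := by decide
    have el : alphaLeft (n := 2) 1 α = αl := by
      rw [alphaLeft, h0, Finset.prod_singleton]
      exact schmidtOfConcurrence_concurrence hl
    have er : alphaRight (n := 2) 1 α = αr := by
      rw [alphaRight, h2, Finset.prod_singleton]
      exact schmidtOfConcurrence_concurrence hr
    have hσ : ![pureState αl (U 0) (V 0), noisyState p δ (U 1) (V 1), pureState αr (U 2) (V 2)] =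
        Function.update (fun s : Fin 3 => proj (inBasis (U s) (V s) (schmidtVec (α s)))) 1
          (noisyState p δ (U 1) (V 1)) := by
      funext s
      fin_cases s <;> rfl
    have hmain := main 2 1 (by decide) (by decide) α (fun s _ => hα s) U V (by rw [el]; exact hl)
      (by rw [er]; exact hr) (by rw [el, er]; exact h)
    rw [hσ]
    exact ⟨hmain.csSup_eq, hmain.1⟩
  · intro n m hm0 hmn α hα U V
    dsimp only
    have hσ : (fun s => if s = m then noisyState p δ (U m) (V m) else
        pureState (α s) (U s) (V s)) = Function.update
        (fun s => proj (inBasis (U s) (V s) (schmidtVec (α s)))) m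
          (noisyState p δ (U m) (V m)) := by
      funext s
      by_cases hs : s = m
      · subst hs; simp
      · simp [hs, pureState]
    have hl : alphaLeft m α ∈ Set.Ico (1 / 2 : ℝ) 1 :=
      schmidtOfConcurrence_mem (prod_concurrence_mem _ α
        fun s hs => hα s (Finset.mem_filter.mp hs).2.ne).1
    have hr : alphaRight m α ∈ Set.Ico (1 / 2 : ℝ) 1 :=
      schmidtOfConcurrence_mem (prod_concurrence_mem _ α
        fun s hs => hα s (Finset.mem_filter.mp hs).2.ne').1
    rw [hσ]
    refine ⟨⟨hl, hr, ?_⟩, fun h => ⟨average _ _ hl hr h ![1, U m, 1] ![1, V m, 1], ?_⟩⟩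
    · obtain ⟨k, hk⟩ := Fin.exists_succ_eq.mpr hm0.ne'
      obtain ⟨l, hl'⟩ := Fin.exists_castSucc_eq.mpr hmn.ne
      obtain ⟨Λ, hΛ, hΛ'⟩ := exists_isLOCC_reduce hk.symm hl'.symm hα
        (fun s => inBasis (U s) (V s) (schmidtVec (α s)))
        (fun s _ => hasSchmidt_inBasis (α s) (U s) (V s))
      refine ⟨Λ, hΛ, ?_⟩
      have hσ' : ![pureState (alphaLeft m α) 1 1, noisyState p δ (U m) (V m),
          pureState (alphaRight m α) 1 1] =
          Function.update (fun s => proj ((![schmidtVec (alphaLeft m α), 0,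
          schmidtVec (alphaRight m α)] : Fin 3 → Fin 2 × Fin 2 → ℂ) s)) 1
          (noisyState p δ (U m) (V m)) := by
        funext s
        fin_cases s
        · exact congrArg proj (inBasis_one _)
        · rfl
        · exact congrArg proj (inBasis_one _)
      have hupd : ∀ c : Fin 2 × Fin 2 → ℂ, Function.update ![schmidtVec (alphaLeft m α), 0,
          schmidtVec (alphaRight m α)] 1 c =
          ![schmidtVec (alphaLeft m α), c, schmidtVec (alphaRight m α)] := by
        intro c
        funext s
        fin_cases s <;> rfl
      obtain ⟨L, hL⟩ := hΛ.exists_linear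
      -- By linearity it is enough to compare the two pure components, on each of which the protocol
      -- yields the placed two-node vector.
      rw [hσ', noisyState_eq_mixState hp, chainState_update_mixState, chainState_update_mixState,
        hL, map_add, ← hL, ← hL, hΛ', hΛ', hupd, hupd, chainState_proj_eq_rankOne (n := 2),
        chainState_proj_eq_rankOne (n := 2), Matrix.mul_add, Matrix.add_mul, sandwich_rankOne,
        sandwich_rankOne, placeTwoNode_mulVec hk.symm hl'.symm,
        placeTwoNode_mulVec hk.symm hl'.symm, ampMat_schmidtVec, ampMat_schmidtVec, slotState,
        slotState]
    · have hmain := main n m hm0 hmn α hα U V hl hr h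
      exact ⟨hmain.csSup_eq, hmain.1⟩
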